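/- **Setting for external products.** Let $\mathcal M$ be an abelian category (e.g. $Mod_R$ or $Mod_R(G)$) with a bi-additive functor $\otimes:\mathcal M\times\mathcal M\to\mathcal M$ such that $P\otimes Q$ is projective whenever $P,Q$ are. For a projective resolution $B_\bullet\to B$ let $\widetilde B_0=B$ and let $\widetilde B_k$ ($k\ge 1$) be its syzygies, so that there are short exact sequences $0\to\widetilde B_{k+1}\to B_k\to\widetilde B_k\to 0$. Call $B_\bullet$ *good* if for every $k\ge0$ the functors $\widetilde B_k\otimes-$ and $-\otimes\widetilde B_k$ are exact and preserve projectives. For a projective resolution $A_\bullet$ of $A$, $\mathrm{Ext}^p(A,B)$ is the cohomology of $\mathrm{Hom}(A_\bullet,B)$ (zero for $p<0$) with the differential $\varphi\mapsto(-1)^{p+1}\varphi\circ a_{p+1}$ in degree $p$, where $a_{p+1}:A_{p+1}\to A_p$; $\delta$ denotes connecting homomorphisms. For $n\in\mathbb Z$, $$\widehat{\mathrm{Ext}}^n(A,B)=\varinjlim_k\big(\mathrm{Ext}^{n+k}(A,\widetilde B_k),\ \delta^{n+k}\big).$$ For a short exact sequence $0\to B''\to B'\to B\to0$ and a short exact sequence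 of projective resolutions $0\to B''_\bullet\to B'_\bullet\to B_\bullet\to 0$ over it, $\widehat\delta^n:\widehat{\mathrm{Ext}}^n(A,B)\to\widehat{\mathrm{Ext}}^{n+1}(A,B'')$ is the homomorphism given at stage $k$ by $(-1)^k$ times the connecting homomorphism of $0\to\widetilde B''_k\to\widetilde B'_k\to\widetilde B_k\to0$. If $A_\bullet\otimes C_\bullet$ (with differential $a\otimes 1+(-1)^i\,1\otimes c$ on $A_i\otimes C_j$) is a projective resolution of $A\otimes C$, then $[u]\vee[v]=(-1)^{pq}[u\otimes v]$ defines $\vee:\mathrm{Ext}^p(A,B)\times\mathrm{Ext}^q(C,E)\to\mathrm{Ext}^{p+q}(A\otimes C,B\otimes E)$. If moreover $B_\bullet$ and $E_\bullet$ are good, then $B\otimes E$ has the projective resolution with terms $B_0\otimes\widetilde E_0,\ \widetilde B_1\otimes E_0,\ B_1\otimes\widetilde E_1,\ \widetilde B_2\otimes E_1,\dots$ and syzygies $B\otimes E,\ \widetilde B_1\otimes\widetilde E_0,\ \widetilde B_1\otimes\widetilde E_1,\ \widetilde B_2\otimes\widetilde E_1,\dots$. The external product $$\vee:\widehat{\mathrm{Ext}}^m(A,B)\times\widehat{\mathrm{Ext}}^n(C,E)\to\widehat{\mathrm{Ext}}^{m+n}(A\otimes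 C,B\otimes E)\qquad(m,n\in\mathbb Z)$$ is the direct limit over $k$ of $\sigma_{m,k}\cdot\vee:\mathrm{Ext}^{m+k}(A,\widetilde B_k)\times\mathrm{Ext}^{n+k}(C,\widetilde E_k)\to\mathrm{Ext}^{m+n+2k}(A\otimes C,\widetilde B_k\otimes\widetilde E_k)$ with $\sigma_{m,k}=\prod_{j=1}^k(-1)^{m+j}$, the signs that make these maps compatible with the direct systems ($\sigma_{m,k}=1$ if $4\mid k$). **Lemma.** 1. (a) Let $A_\bullet,C_\bullet$ be projective resolutions of $A,C$ such that $A_\bullet\otimes C_\bullet$ is a projective resolution of $A\otimes C$. Let $0\to B''\to B'\to B\to0$ be a short exact sequence with a short exact sequence of projective resolutions $0\to B''_\bullet\to B'_\bullet\to B_\bullet\to0$, where $B''_\bullet$, $B_\bullet$ and a projective resolution $E_\bullet$ of $E$ are good and where all functors $\widetilde B'_k\otimes-$ are exact. Then for all $m,n\in\mathbb Z$, $x\in\widehat{\mathrm{Ext}}^m(A,B)$, $y\in\widehat{\mathrm{Ext}}^n(C,E)$, $$(\widehat\delta^m x)\vee y=\widehat\delta^{m+n}(x\vee y)\in\widehat{\mathrm{Ext}}^{m+n+1}(A\otimes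 C,B''\otimes E),$$ where $\widehat\delta^{m+n}$ on the right belongs to $0\to B''\otimes E\to B'\otimes E\to B\otimes E\to0$ and may be computed from any short exact sequence of projective resolutions over it whose outer terms are the above resolutions of $B''\otimes E$ and $B\otimes E$. (b) Let $A_\bullet,C_\bullet$ be as in (a). Let $0\to E''\to E'\to E\to0$ be a short exact sequence with a short exact sequence of projective resolutions $0\to E''_\bullet\to E'_\bullet\to E_\bullet\to0$, where $E''_\bullet$, $E_\bullet$ and a projective resolution $B_\bullet$ of $B$ are good and where all functors $-\otimes\widetilde E'_k$ are exact. Then for all $m,n\in\mathbb Z$, $x\in\widehat{\mathrm{Ext}}^m(A,B)$, $y\in\widehat{\mathrm{Ext}}^n(C,E)$, $$x\vee(\widehat\delta^n y)=(-1)^m\,\widehat\delta^{m+n}(x\vee y)\in\widehat{\mathrm{Ext}}^{m+n+1}(A\otimes C,B\otimes E''),$$ with $\widehat\delta^{m+n}$ for $0\to B\otimes E''\to B\otimes E'\to B\otimes E\to0$, computed as in (a). (c) (Cup products.) Let moreover $U:\mathcal M\to\mathcal N$ be an additive, exact, faithful functor to an abelian category with a bi-additive functor $\otimes$, with a natural isomorphism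 $U(X\otimes Y)\cong U(X)\otimes U(Y)$ (e.g. the restriction $Mod_R(G)\to Mod_R$), such that $U$ preserves projectives, and let $R\in\mathcal M$ be an object such that $U(R)$ is projective, with an isomorphism $R\otimes R\cong R$. Then the tensor product of any two projective resolutions of $R$ is a projective resolution of $R\otimes R$. Put $\widehat H^m(G,M)=\widehat{\mathrm{Ext}}^m(R,M)$, and let $\smile:\widehat H^m(G,M)\times\widehat H^n(G,N)\to\widehat H^{m+n}(G,M\otimes N)$ be the external product followed by the map induced by $R\cong R\otimes R$ (computed by any lift to the projective resolutions). Under the hypotheses of (a) and (b) on the coefficients, $(\widehat\delta^m x)\smile y=\widehat\delta^{m+n}(x\smile y)$ for short exact sequences in the first coefficient variable and $x\smile(\widehat\delta^n y)=(-1)^m\,\widehat\delta^{m+n}(x\smile y)$ for those in the second one. 2. (Yoneda products.) Let $\mathcal C$ be an abelian category. For objects $F,H$ with projective resolutions $F_\bullet,H_\bullet$ (extended by zero to complexes indexed by $\mathbb Z$), let $\widehat{\mathrm{Ext}}^n_{\mathcal C}(F,H)$ be the $n$-th cohomology of the quotient of the complex $\prod_k\mathrm{Hom}(F_{k+n},H_k)$,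 $n\in\mathbb Z$, of cochains by its subcomplex of the cochains with only finitely many nonzero components, and let the Yoneda product $\circ:\widehat{\mathrm{Ext}}_{\mathcal C}^n(H,J)\times\widehat{\mathrm{Ext}}_{\mathcal C}^m(F,H)\to\widehat{\mathrm{Ext}}_{\mathcal C}^{m+n}(F,J)$ be induced by the composition of cochains. Let $0\to J''\to J'\to J\to0$ be a short exact sequence, let $0\to J''_\bullet\to J'_\bullet\to J_\bullet\to0$ be a short exact sequence of projective resolutions over it, and let $\widehat\delta^n:\widehat{\mathrm{Ext}}^n_{\mathcal C}(-,J)\to\widehat{\mathrm{Ext}}^{n+1}_{\mathcal C}(-,J'')$ be the connecting homomorphism of the resulting short exact sequence of quotient complexes. Then for all $m,n\in\mathbb Z$, $y\in\widehat{\mathrm{Ext}}_{\mathcal C}^n(H,J)$ and $x\in\widehat{\mathrm{Ext}}_{\mathcal C}^m(F,H)$, $$(\widehat\delta^n y)\circ x=\widehat\delta^{m+n}(y\circ x)\in\widehat{\mathrm{Ext}}_{\mathcal C}^{m+n+1}(F,J'').$$ -/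

import Mathlib

open CategoryTheory CategoryTheory.Limits

universe v u v' u' v'' u''

namespace CompletedExt

section Groups

/-- An additive homomorphism given by its graph. -/
noncomputable def homOfRel {G H : Type*} [AddCommGroup G] [AddCommGroup H]
    (R : AddSubgroup (G × H)) (tot : ∀ x, ∃ y, (x, y) ∈ R)
    (single : ∀ y, ((0 : G), y) ∈ R → y = 0) : G →+ H :=
  AddMonoidHom.mk' (fun x => (tot x).choose) (by
    intro a b
    have h := R.sub_mem (R.sub_mem (tot (a + b)).choose_spec (tot a).choose_spec)
      (tot b).choose_spec
    simp only [Prod.mk_sub_mk, add_sub_cancel_left, sub_self] at h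
    have := single _ h
    rw [sub_sub, sub_eq_zero] at this
    exact this)

theorem homOfRel_mem {G H : Type*} [AddCommGroup G] [AddCommGroup H]
    (R : AddSubgroup (G × H)) (tot : ∀ x, ∃ y, (x, y) ∈ R)
    (single : ∀ y, ((0 : G), y) ∈ R → y = 0) (x : G) :
    (x, homOfRel R tot single x) ∈ R := (tot x).choose_spec

theorem homOfRel_eq {G H : Type*} [AddCommGroup G] [AddCommGroup H]
    (R : AddSubgroup (G × H)) (tot : ∀ x, ∃ y, (x, y) ∈ R)
    (single : ∀ y, ((0 : G), y) ∈ R → y = 0) {x : G} {y : H} (h : (x, y) ∈ R) :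
    homOfRel R tot single x = y := by
  have h' := R.sub_mem (homOfRel_mem R tot single x) h
  simp only [Prod.mk_sub_mk, sub_self] at h'
  exact sub_eq_zero.1 (single _ h')

end Groups

section Ext

variable {C : Type u} [Category.{v} C] [Abelian C]

/-- The families of morphisms `K.X q ⟶ B` that vanish outside degree `p`, that is, the group
`Hom(K_p, B)`, read as zero if `p < 0`. -/
def homDeg (K : ChainComplex C ℕ) (B : C) (p : ℤ) : AddSubgroup (∀ q, K.X q ⟶ B) where
  carrier := {φ | ∀ q : ℕ, (q : ℤ) ≠ p → φ q = 0}
  zero_mem' := fun _ _ => rfl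
  add_mem' := fun ha hb q hq => by simp [ha q hq, hb q hq]
  neg_mem' := fun ha q hq => by simp [ha q hq]

/-- Precomposition with the differential of `K`: the `q`-th component is
`K.X q ⟶ K.X (q - 1) ⟶ B` if `q ≥ 1`, and it is zero if `q = 0`. -/
def coD (K : ChainComplex C ℕ) (B : C) : (∀ q, K.X q ⟶ B) →+ (∀ q, K.X q ⟶ B) where
  toFun φ q := K.d q (q - 1) ≫ φ (q - 1)
  map_zero' := by ext; simp
  map_add' _ _ := by ext; simp

theorem coD_succ (K : ChainComplex C ℕ) (B : C) (φ : ∀ q, K.X q ⟶ B) (q : ℕ) :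
    coD K B φ (q + 1) = K.d (q + 1) q ≫ φ q := rfl

theorem coD_zero (K : ChainComplex C ℕ) (B : C) (φ : ∀ q, K.X q ⟶ B) :
    coD K B φ 0 = 0 := by
  change K.d 0 0 ≫ _ = 0
  rw [K.shape _ _ (by simp), zero_comp]

theorem coD_coD (K : ChainComplex C ℕ) (B : C) (φ : ∀ q, K.X q ⟶ B) :
    coD K B (coD K B φ) = 0 := by
  ext q
  rcases q with _ | _ | q
  · simp [coD_zero]
  · simp [coD_succ, coD_zero]
  · simp [coD_succ]

theorem coD_comp (K : ChainComplex C ℕ) {B B' : C} (φ : ∀ q, K.X q ⟶ B) (f : B ⟶ B') :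
    (fun q => coD K B φ q ≫ f) = coD K B' (fun q => φ q ≫ f) := by
  ext q; simp [coD]

theorem coD_mem (K : ChainComplex C ℕ) (B : C) {φ : ∀ q, K.X q ⟶ B} {p p' : ℤ} (hp : p + 1 = p')
    (h : φ ∈ homDeg K B p) : coD K B φ ∈ homDeg K B p' := by
  intro q hq
  rcases q with _ | q
  · exact coD_zero K B φ
  · rw [coD_succ, h q (by push_cast at hq; lia), comp_zero]

/-- The cocycles of degree `p` of the complex `Hom(K, B)`. -/
def cocycles (K : ChainComplex C ℕ) (B : C) (p : ℤ) : AddSubgroup (∀ q, K.X q ⟶ B) :=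
  homDeg K B p ⊓ (coD K B).ker

/-- The coboundaries of degree `p` of the complex `Hom(K, B)`. -/
def coboundaries (K : ChainComplex C ℕ) (B : C) (p : ℤ) : AddSubgroup (∀ q, K.X q ⟶ B) :=
  (homDeg K B (p - 1)).map (coD K B)

/-- The cohomology group `H^p(Hom(K, B))`. It is `Ext^p(A, B)` if `K` is a projective resolution
of `A`, and it is zero if `p < 0`. -/
def ExtGrp (K : ChainComplex C ℕ) (B : C) (p : ℤ) : Type v :=
  cocycles K B p ⧸ (coboundaries K B p).addSubgroupOf (cocycles K B p)

instance (K : ChainComplex C ℕ) (B : C) (p : ℤ) : AddCommGroup (ExtGrp K B p) :=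
  inferInstanceAs
    (AddCommGroup (cocycles K B p ⧸ (coboundaries K B p).addSubgroupOf (cocycles K B p)))

/-- The class of a cocycle. -/
def ExtGrp.mk (K : ChainComplex C ℕ) (B : C) (p : ℤ) : cocycles K B p →+ ExtGrp K B p :=
  QuotientAddGroup.mk' ((coboundaries K B p).addSubgroupOf (cocycles K B p))

theorem ExtGrp.mk_surjective (K : ChainComplex C ℕ) (B : C) (p : ℤ) :
    Function.Surjective (ExtGrp.mk K B p) :=
  QuotientAddGroup.mk'_surjective ((coboundaries K B p).addSubgroupOf (cocycles K B p))

/-- The homomorphism induced by a homomorphism on cocycles that vanishes on coboundaries. -/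
def ExtGrp.lift {K : ChainComplex C ℕ} {B : C} {p : ℤ} {H : Type*} [AddCommGroup H]
    (g : cocycles K B p →+ H) (hg : ∀ x, ExtGrp.mk K B p x = 0 → g x = 0) : ExtGrp K B p →+ H :=
  QuotientAddGroup.lift ((coboundaries K B p).addSubgroupOf (cocycles K B p)) g
    (fun x hx => hg x ((QuotientAddGroup.eq_zero_iff x).2 hx))

theorem ExtGrp.lift_mk {K : ChainComplex C ℕ} {B : C} {p : ℤ} {H : Type*} [AddCommGroup H]
    (g : cocycles K B p →+ H) (hg : ∀ x, ExtGrp.mk K B p x = 0 → g x = 0) (x : cocycles K B p) :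
    ExtGrp.lift g hg (ExtGrp.mk K B p x) = g x := rfl

theorem ExtGrp.mk_eq_zero {K : ChainComplex C ℕ} {B : C} {p : ℤ} (x : cocycles K B p) :
    ExtGrp.mk K B p x = 0 ↔ ∃ w ∈ homDeg K B (p - 1), coD K B w = x.1 :=
  (QuotientAddGroup.eq_zero_iff x).trans Iff.rfl

theorem negOnePow_smul_smul {G : Type*} [AddCommGroup G] (p : ℤ) (x : G) :
    p.negOnePow • p.negOnePow • x = x := by
  rw [smul_smul, ← Int.negOnePow_add, ← two_mul, Int.negOnePow_two_mul, one_smul]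

/-- The pairs `(x, y)` such that `x` is the class of `z`, where `z` lifts to `l : K → Y`, and
`y` is the class of `w`, where `w ≫ f` is the differential `(-1)^(p+1) • (d ≫ l)` of `l`. -/
def connRel (K : ChainComplex C ℕ) {X Y Z : C} (f : X ⟶ Y) (g : Y ⟶ Z) (p p' : ℤ) :
    AddSubgroup (ExtGrp K Z p × ExtGrp K X p') where
  carrier := {x | ∃ (z : cocycles K Z p) (w : cocycles K X p')
    (l : homDeg K Y p), x.1 = ExtGrp.mk K _ p z ∧ x.2 = ExtGrp.mk K _ p' w ∧
      (∀ q, l.1 q ≫ g = z.1 q) ∧ ∀ q, w.1 q ≫ f = p'.negOnePow • coD K _ l.1 q}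
  zero_mem' := ⟨0, 0, 0, by simp, by simp, by simp, by simp⟩
  add_mem' := by
    rintro _ _ ⟨z, w, l, h1, h2, h3, h4⟩ ⟨z', w', l', h1', h2', h3', h4'⟩
    refine ⟨z + z', w + w', l + l', by simp [h1, h1'], by simp [h2, h2'], fun q => ?_,
      fun q => ?_⟩
    · simp [h3, h3']
    · simp [h4, h4']
  neg_mem' := by
    rintro _ ⟨z, w, l, h1, h2, h3, h4⟩
    refine ⟨-z, -w, -l, by simp [h1], by simp [h2], fun q => ?_, fun q => ?_⟩
    · simp [h3]
    · simp [h4]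

theorem comp_mem_homDeg {K : ChainComplex C ℕ} {X Y : C} (g : X ⟶ Y) {r : ℤ}
    {φ : ∀ q, K.X q ⟶ X} (h : φ ∈ homDeg K X r) : (fun q => φ q ≫ g) ∈ homDeg K Y r := by
  intro q hq
  simp [h q hq]

theorem exists_lift (K : ChainComplex C ℕ) [∀ q, Projective (K.X q)] {X Y : C} (g : X ⟶ Y) [Epi g]
    {p : ℤ} (z : ∀ q, K.X q ⟶ Y) (hz : z ∈ homDeg K Y p) :
    ∃ l ∈ homDeg K X p, ∀ q, l q ≫ g = z q := by
  classical
  refine ⟨fun q => if (q : ℤ) = p then Projective.factorThru (z q) g else 0, fun q hq => ?_,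
    fun q => ?_⟩
  · simp [hq]
  · by_cases hq : (q : ℤ) = p
    · simp [hq]
    · simp [hq, hz q hq]

variable {X Y Z : C} {f : X ⟶ Y} {g : Y ⟶ Z} {hfg : f ≫ g = 0}

theorem exists_lift_of_exact (K : ChainComplex C ℕ) (hS : (ShortComplex.mk f g hfg).ShortExact)
    {p : ℤ} (z : ∀ q, K.X q ⟶ Y) (hz : z ∈ homDeg K _ p) (hz' : ∀ q, z q ≫ g = 0) :
    ∃ w ∈ homDeg K X p, ∀ q, w q ≫ f = z q := by
  have : Mono f := hS.mono_f
  refine ⟨fun q => hS.exact.lift (z q) (hz' q), fun q hq => ?_, fun q => hS.exact.lift_f _ _⟩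
  rw [← cancel_mono f]
  refine (hS.exact.lift_f _ _).trans ?_
  rw [hz q hq, zero_comp]

theorem exists_cocycle (K : ChainComplex C ℕ) (hS : (ShortComplex.mk f g hfg).ShortExact)
    {p p' : ℤ} (hp : p + 1 = p') (z : cocycles K Z p) (l : ∀ q, K.X q ⟶ Y)
    (hl : l ∈ homDeg K Y p) (hlz : ∀ q, l q ≫ g = z.1 q) :
    ∃ w : cocycles K X p', ∀ q, w.1 q ≫ f = p'.negOnePow • coD K _ l q := by
  have : Mono f := hS.mono_f
  have hd : (fun q => coD K _ l q ≫ g) = 0 := by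
    rw [coD_comp]
    rw [show (fun q => l q ≫ g) = z.1 from funext hlz]
    exact z.2.2
  obtain ⟨w, hw, hwl⟩ := exists_lift_of_exact K hS (p := p') (p'.negOnePow • coD K _ l)
    ((homDeg K Y p').zsmul_mem (coD_mem K _ hp hl) _)
    (fun q => by
      have := congrFun hd q
      simp only [Pi.zero_apply] at this
      simp [Units.smul_def, this])
  refine ⟨⟨w, hw, ?_⟩, hwl⟩
  refine funext fun q => ?_
  rw [← cancel_mono f]
  have h1 := congrFun (coD_comp K w f) q
  rw [h1, show (fun q => w q ≫ f) = p'.negOnePow • coD K _ l from funext hwl,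
    Units.smul_def, map_zsmul, coD_coD]
  simp

theorem connRel_tot (K : ChainComplex C ℕ) [∀ q, Projective (K.X q)]
    (hS : (ShortComplex.mk f g hfg).ShortExact) {p p' : ℤ} (hp : p + 1 = p') (x : ExtGrp K Z p) :
    ∃ y, (x, y) ∈ connRel K f g p p' := by
  have : Epi g := hS.epi_g
  obtain ⟨z, rfl⟩ := ExtGrp.mk_surjective _ _ _ x
  obtain ⟨l, hl, hlz⟩ := exists_lift K g z.1 z.2.1
  obtain ⟨w, hw⟩ := exists_cocycle K hS hp z l hl hlz
  exact ⟨ExtGrp.mk K _ p' w, z, w, ⟨l, hl⟩, rfl, rfl, hlz, hw⟩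

theorem connRel_single (K : ChainComplex C ℕ) [∀ q, Projective (K.X q)]
    (hS : (ShortComplex.mk f g hfg).ShortExact) {p p' : ℤ} (hp : p + 1 = p') (y : ExtGrp K X p')
    (h : (0, y) ∈ connRel K f g p p') : y = 0 := by
  have : Epi g := hS.epi_g
  have : Mono f := hS.mono_f
  obtain ⟨z, w, l, h1, h2, h3, h4⟩ := h
  dsimp only at h1 h2
  subst h2
  rw [eq_comm, ExtGrp.mk_eq_zero] at h1
  obtain ⟨v, hv, hvz⟩ := h1
  obtain ⟨t, ht, htv⟩ := exists_lift K g v hv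
  obtain ⟨s, hs, hsl⟩ := exists_lift_of_exact K hS (p := p) (l.1 - coD K _ t)
    (AddSubgroup.sub_mem _ l.2 (coD_mem K _ (by lia) ht))
    (fun q => by
      have := congrFun (coD_comp K t g) q
      rw [show (fun q => t q ≫ g) = v from funext htv, hvz] at this
      simp [h3, this])
  rw [ExtGrp.mk_eq_zero]
  refine ⟨p'.negOnePow • s, ?_, ?_⟩
  · rw [show p' - 1 = p by lia]
    exact AddSubgroup.zsmul_mem _ hs _
  · refine funext fun q => ?_
    rw [← cancel_mono f, h4, Units.smul_def, map_zsmul]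
    have := congrFun (coD_comp K s f) q
    rw [show (fun q => s q ≫ f) = l.1 - coD K _ t from funext hsl, map_sub, coD_coD,
      sub_zero] at this
    simp [← this, Units.smul_def]

/-- The connecting homomorphism `Ext^p(A, Z) → Ext^(p+1)(A, X)` of a short exact sequence
`0 → X → Y → Z → 0`, where `K` is a projective resolution of `A` and the complex `Hom(K, -)` has
the differential `φ ↦ (-1)^(p+1) • (d ≫ φ)` in degree `p`. -/
noncomputable def conn (K : ChainComplex C ℕ) [∀ q, Projective (K.X q)]
    (hS : (ShortComplex.mk f g hfg).ShortExact) {p p' : ℤ} (hp : p + 1 = p') :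
    ExtGrp K Z p →+ ExtGrp K X p' :=
  homOfRel (connRel K f g p p') (connRel_tot K hS hp) (connRel_single K hS hp)

theorem conn_eq (K : ChainComplex C ℕ) [∀ q, Projective (K.X q)]
    (hS : (ShortComplex.mk f g hfg).ShortExact) {p p' : ℤ} (hp : p + 1 = p') (z : cocycles K Z p)
    (w : cocycles K X p') (l : ∀ q, K.X q ⟶ Y) (hl : l ∈ homDeg K Y p)
    (hlz : ∀ q, l q ≫ g = z.1 q) (hw : ∀ q, w.1 q ≫ f = p'.negOnePow • coD K _ l q) :
    conn K hS hp (ExtGrp.mk K _ p z) = ExtGrp.mk K _ p' w :=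
  homOfRel_eq _ _ _ ⟨z, w, ⟨l, hl⟩, rfl, rfl, hlz, hw⟩

theorem conn_of_lift (K : ChainComplex C ℕ) [∀ q, Projective (K.X q)]
    (hS : (ShortComplex.mk f g hfg).ShortExact) {p p' : ℤ} (hp : p + 1 = p') (z : cocycles K Z p)
    (l : ∀ q, K.X q ⟶ Y) (hl : l ∈ homDeg K Y p) (hlz : ∀ q, l q ≫ g = z.1 q) :
    ∃ w : cocycles K X p', (∀ q, w.1 q ≫ f = p'.negOnePow • coD K _ l q) ∧
      conn K hS hp (ExtGrp.mk K _ p z) = ExtGrp.mk K _ p' w := by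
  obtain ⟨w, hw⟩ := exists_cocycle K hS hp z l hl hlz
  exact ⟨w, hw, conn_eq K hS hp z w l hl hlz hw⟩

end Ext

end CompletedExt

namespace CompletedExt

section SeqColim

universe w w' w''

/-- The composite `G i → G (i + 1) → ⋯ → G j` of the maps of a sequence of groups. -/
def seqMap {G : ℕ → Type w} [∀ k, AddCommGroup (G k)] (f : ∀ k, G k →+ G (k + 1)) (i j : ℕ)
    (h : i ≤ j) : G i →+ G j :=
  Nat.leRecOn h (fun {k} g => (f k).comp g) (AddMonoidHom.id (G i))

section

variable {G : ℕ → Type w} [∀ k, AddCommGroup (G k)] (f : ∀ k, G k →+ G (k + 1))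

theorem seqMap_self (i : ℕ) (x : G i) : seqMap f i i le_rfl x = x := by
  simp [seqMap, Nat.leRecOn_self]

theorem seqMap_succ (i j : ℕ) (h : i ≤ j) (x : G i) :
    seqMap f i (j + 1) (Nat.le_succ_of_le h) x = f j (seqMap f i j h x) := by
  simp [seqMap, Nat.leRecOn_succ h]

instance seqMap_directed : DirectedSystem G (fun i j h => seqMap f i j h) where
  map_self i x := seqMap_self f i x
  map_map k j i hij hjk x := by
    induction hjk with
    | refl => exact seqMap_self f j _
    | step h ih => rw [seqMap_succ f _ _ h, ih, seqMap_succ f _ _ (hij.trans h)]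

/-- The direct limit of a sequence `G 0 → G 1 → G 2 → ⋯` of abelian groups. -/
def SeqColim : Type w := DirectLimit G (seqMap f)

noncomputable instance : AddCommGroup (SeqColim f) :=
  inferInstanceAs (AddCommGroup (DirectLimit G (seqMap f)))

/-- The canonical map to the direct limit. -/
noncomputable def SeqColim.of (k : ℕ) : G k →+ SeqColim f where
  toFun x := (⟦⟨k, x⟩⟧ : DirectLimit G (seqMap f))
  map_zero' := (DirectLimit.zero_def k).symm
  map_add' x y := (DirectLimit.add_def k x y).symm

theorem SeqColim.of_succ (k : ℕ) (x : G k) : of f (k + 1) (f k x) = of f k x := by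
  have := DirectLimit.mk_apply (f := seqMap f) k (k + 1) x (Nat.le_succ k)
  rwa [seqMap_succ f k k le_rfl, seqMap_self] at this

theorem SeqColim.of_seqMap (i j : ℕ) (h : i ≤ j) (x : G i) : of f j (seqMap f i j h x) = of f i x :=
  DirectLimit.mk_apply (f := seqMap f) i j x h

theorem SeqColim.exists_of₂ (x y : SeqColim f) : ∃ k a b, x = of f k a ∧ y = of f k b :=
  DirectLimit.exists_eq_mk₂ _ x y

theorem SeqColim.exists_of (x : SeqColim f) : ∃ k a, x = of f k a :=
  DirectLimit.exists_eq_mk _ x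

theorem SeqColim.of_eq_zero (k : ℕ) (x : G k) (h : of f k x = 0) :
    ∃ j hj, seqMap f k j hj x = 0 :=
  (DirectLimit.exists_eq_zero _).1 h

/-- The homomorphism from the direct limit given by a compatible family of homomorphisms. -/
noncomputable def SeqColim.lift {H : Type w'} [AddCommGroup H] (g : ∀ k, G k →+ H)
    (hg : ∀ k x, g (k + 1) (f k x) = g k x) : SeqColim f →+ H where
  toFun := DirectLimit.lift _ (fun k x => g k x) (by
    intro i j h x
    induction h with
    | refl => rw [seqMap_self]
    | step h ih => rw [seqMap_succ f _ _ h, hg, ih])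
  map_zero' := by
    change DirectLimit.lift _ _ _ (0 : DirectLimit G (seqMap f)) = 0
    rw [DirectLimit.zero_def 0, DirectLimit.lift_def, map_zero]
  map_add' x y := by
    obtain ⟨k, a, b, rfl, rfl⟩ := DirectLimit.exists_eq_mk₂ _ x y
    change DirectLimit.lift _ _ _ ((⟦⟨k, a⟩⟧ : DirectLimit G (seqMap f)) + ⟦⟨k, b⟩⟧) = _
    rw [DirectLimit.add_def]
    simp only [DirectLimit.lift_def, map_add]

theorem SeqColim.lift_of {H : Type w'} [AddCommGroup H] (g : ∀ k, G k →+ H)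
    (hg : ∀ k x, g (k + 1) (f k x) = g k x) (k : ℕ) (x : G k) :
    lift f g hg (of f k x) = g k x := rfl

end

variable {G : ℕ → Type w} [∀ k, AddCommGroup (G k)] (f : ∀ k, G k →+ G (k + 1))
  {G' : ℕ → Type w'} [∀ k, AddCommGroup (G' k)] (f' : ∀ k, G' k →+ G' (k + 1))

theorem SeqColim.compat₂ {H : Type w''} [AddCommGroup H] (g : ∀ k, G k →+ G' k →+ H)
    (hg : ∀ k x y, g (k + 1) (f k x) (f' k y) = g k x y) (i j : ℕ) (h : i ≤ j) (x : G i)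
    (y : G' i) : g i x y = g j (seqMap f i j h x) (seqMap f' i j h y) := by
  induction h with
  | refl => rw [seqMap_self, seqMap_self]
  | step h ih => rw [seqMap_succ f _ _ h, seqMap_succ f' _ _ h, hg, ih]

/-- The biadditive map from a pair of direct limits given by a compatible family of biadditive
maps. -/
noncomputable def SeqColim.lift₂ {H : Type w''} [AddCommGroup H] (g : ∀ k, G k →+ G' k →+ H)
    (hg : ∀ k x y, g (k + 1) (f k x) (f' k y) = g k x y) : SeqColim f →+ SeqColim f' →+ H :=
  have compat := SeqColim.compat₂ f f' g hg
  let L : SeqColim f → SeqColim f' → H :=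
    DirectLimit.lift₂ (seqMap f) (seqMap f') (fun k x y => g k x y) compat
  have key : ∀ i j (a : G i) (b : G' j), L (of f i a) (of f' j b) =
      g (max i j) (seqMap f i _ (le_max_left i j) a) (seqMap f' j _ (le_max_right i j) b) :=
    fun i j a b => DirectLimit.lift₂_def₂ (seqMap f) (seqMap f') (fun k x y => g k x y) compat
      ⟨i, a⟩ ⟨j, b⟩ (max i j) (le_max_left i j) (le_max_right i j)
  AddMonoidHom.mk' (fun x => AddMonoidHom.mk' (fun y => L x y)
    (by
      intro y y'
      obtain ⟨i, a, rfl⟩ := exists_of f x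
      obtain ⟨j, b, b', rfl, rfl⟩ := exists_of₂ f' y y'
      rw [← map_add, key, key, key, map_add, map_add]))
    (by
      intro x x'
      ext y
      obtain ⟨j, b, rfl⟩ := exists_of f' y
      obtain ⟨i, a, a', rfl, rfl⟩ := exists_of₂ f x x'
      rw [← map_add]
      simp only [AddMonoidHom.mk'_apply, AddMonoidHom.add_apply, key]
      rw [map_add, map_add, AddMonoidHom.add_apply])

theorem SeqColim.lift₂_of {H : Type w''} [AddCommGroup H] (g : ∀ k, G k →+ G' k →+ H)
    (hg : ∀ k x y, g (k + 1) (f k x) (f' k y) = g k x y) (k : ℕ) (x : G k) (y : G' k) :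
    lift₂ f f' g hg (of f k x) (of f' k y) = g k x y :=
  DirectLimit.lift₂_def (seqMap f) (seqMap f') (fun k x y => g k x y)
    (SeqColim.compat₂ f f' g hg) k x y

end SeqColim

end CompletedExt

namespace CompletedExt

section Completed

variable {C : Type u} [Category.{v} C] [Abelian C]

/-- The sequence `M, Z 0, Z 1, …`. -/
def syzFun (M : C) (Z : ℕ → C) : ℕ → C
  | 0 => M
  | k + 1 => Z k

/-- A projective resolution `⋯ → P 2 → P 1 → P 0 → M → 0` in terms of its syzygies: it is spliced
from short exact sequences `0 → Z k → P k → (syzygy k) → 0`, where the zeroth syzygy is `M` and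
`Z k` is the `(k + 1)`-st one. -/
structure SyzRes (M : C) where
  /-- the projective terms -/
  P : ℕ → C
  /-- the syzygies of positive index -/
  Z : ℕ → C
  ι (k : ℕ) : Z k ⟶ P k
  π (k : ℕ) : P k ⟶ syzFun M Z k
  projective (k : ℕ) : Projective (P k)
  zero (k : ℕ) : ι k ≫ π k = 0
  exact (k : ℕ) : (ShortComplex.mk (ι k) (π k) (zero k)).ShortExact

namespace SyzRes

variable {M : C} (𝓑 : SyzRes M)

/-- The `k`-th syzygy. -/
def syz (k : ℕ) : C := syzFun M 𝓑.Z k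

/-- The inclusion of a syzygy. -/
def inc (k : ℕ) : 𝓑.syz (k + 1) ⟶ 𝓑.P k := 𝓑.ι k

/-- The projection onto a syzygy. -/
def pr (k : ℕ) : 𝓑.P k ⟶ 𝓑.syz k := 𝓑.π k

theorem inc_pr (k : ℕ) : 𝓑.inc k ≫ 𝓑.pr k = 0 := 𝓑.zero k

theorem ses (k : ℕ) : (ShortComplex.mk (𝓑.inc k) (𝓑.pr k) (𝓑.inc_pr k)).ShortExact := 𝓑.exact k

end SyzRes

/-- The homomorphisms `Ext^(n+k)(A, B̃_k) → Ext^(n+k+1)(A, B̃_(k+1))`. -/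
noncomputable def extStep (K : ChainComplex C ℕ) [∀ q, Projective (K.X q)] {B : C} (𝓑 : SyzRes B)
    (n : ℤ) (k : ℕ) : ExtGrp K (𝓑.syz k) (n + k) →+ ExtGrp K (𝓑.syz (k + 1)) (n + (k + 1 : ℕ)) :=
  conn K (𝓑.ses k) (by push_cast; ring)

/-- The completed Ext-group `Êxt^n(A, B)` in the resolution construction, that is, the direct
limit of the groups `Ext^(n+k)(A, B̃_k)` along the connecting homomorphisms, where `K` is a
projective resolution of `A` and `B̃_k` is the `k`-th syzygy of `𝓑`. -/
abbrev ExtHat (K : ChainComplex C ℕ) [∀ q, Projective (K.X q)] {B : C} (𝓑 : SyzRes B) (n : ℤ) :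
    Type v :=
  SeqColim (extStep K 𝓑 n)

/-- A short exact sequence of projective resolutions over the short exact sequence `S`: the rows of
the terms and of the syzygies are short exact. -/
structure ResSES (S : ShortComplex C) (𝓑₁ : SyzRes S.X₁) (𝓑₂ : SyzRes S.X₂) (𝓑₃ : SyzRes S.X₃) where
  f (k : ℕ) : 𝓑₁.syz k ⟶ 𝓑₂.syz k
  g (k : ℕ) : 𝓑₂.syz k ⟶ 𝓑₃.syz k
  F (k : ℕ) : 𝓑₁.P k ⟶ 𝓑₂.P k
  G (k : ℕ) : 𝓑₂.P k ⟶ 𝓑₃.P k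
  f_zero : f 0 = S.f
  g_zero : g 0 = S.g
  pr_f (k : ℕ) : 𝓑₁.pr k ≫ f k = F k ≫ 𝓑₂.pr k
  pr_g (k : ℕ) : 𝓑₂.pr k ≫ g k = G k ≫ 𝓑₃.pr k
  inc_F (k : ℕ) : 𝓑₁.inc k ≫ F k = f (k + 1) ≫ 𝓑₂.inc k
  inc_G (k : ℕ) : 𝓑₂.inc k ≫ G k = g (k + 1) ≫ 𝓑₃.inc k
  f_g (k : ℕ) : f k ≫ g k = 0
  F_G (k : ℕ) : F k ≫ G k = 0
  syz_exact (k : ℕ) : (ShortComplex.mk (f k) (g k) (f_g k)).ShortExact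
  P_exact (k : ℕ) : (ShortComplex.mk (F k) (G k) (F_G k)).ShortExact

namespace ResSES

variable {S : ShortComplex C} {𝓑₁ : SyzRes S.X₁} {𝓑₂ : SyzRes S.X₂} {𝓑₃ : SyzRes S.X₃}
  (H : ResSES S 𝓑₁ 𝓑₂ 𝓑₃)

theorem conn_conn (K : ChainComplex C ℕ) [∀ q, Projective (K.X q)] (k : ℕ) {p p' r' p'' : ℤ}
    (hp : p + 1 = p') (hp' : p' + 1 = p'') (hr : p + 1 = r') (hr' : r' + 1 = p'')
    (x : ExtGrp K (𝓑₃.syz k) p) :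
    conn K (H.syz_exact (k + 1)) hr' (conn K (𝓑₃.ses k) hr x) =
      -conn K (𝓑₁.ses k) hp' (conn K (H.syz_exact k) hp x) := by
  obtain rfl : p' = r' := hp.symm.trans hr
  have e1 : Epi (𝓑₁.pr k) := (𝓑₁.ses k).epi_g
  have e3 : Epi (𝓑₃.pr k) := (𝓑₃.ses k).epi_g
  have m2 : Mono (𝓑₂.inc k) := (𝓑₂.ses k).mono_f
  have m3 : Mono (𝓑₃.inc k) := (𝓑₃.ses k).mono_f
  have eP : Epi (H.G k) := (H.P_exact k).epi_g
  obtain ⟨z, rfl⟩ := ExtGrp.mk_surjective _ _ _ x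
  obtain ⟨y, hy, hyz⟩ := exists_lift K (H.G k ≫ 𝓑₃.pr k) z.1 z.2.1
  obtain ⟨w, hw, hw'⟩ := conn_of_lift K (H.syz_exact k) hp z (fun q => y q ≫ 𝓑₂.pr k)
    (comp_mem_homDeg _ hy) (fun q => by simp [H.pr_g, ← hyz q])
  obtain ⟨w3, hw3, hw3'⟩ := conn_of_lift K (𝓑₃.ses k) hp z (fun q => y q ≫ H.G k)
    (comp_mem_homDeg _ hy) (fun q => by simp [← hyz q])
  obtain ⟨v, hv, hvw⟩ := exists_lift K (𝓑₁.pr k) w.1 w.2.1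
  obtain ⟨v1, hv1, hv1'⟩ := conn_of_lift K (𝓑₁.ses k) hp' w v hv hvw
  obtain ⟨l, hl, hly⟩ := exists_lift_of_exact K (𝓑₂.ses k) (p := p')
    (p'.negOnePow • coD K _ y - fun q => v q ≫ H.F k)
    (AddSubgroup.sub_mem _ (AddSubgroup.zsmul_mem _ (coD_mem K _ hp hy) _)
      (comp_mem_homDeg _ hv))
    (fun q => by
      have h1 := hw q
      rw [← coD_comp K y (𝓑₂.pr k)] at h1
      have h3 : v q ≫ H.F k ≫ 𝓑₂.pr k = w.1 q ≫ H.f k := by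
        rw [← H.pr_f, ← Category.assoc, hvw q]
      simp [h3, h1, Units.smul_def])
  rw [hw3', hw', hv1', ← map_neg]
  refine conn_eq K (H.syz_exact (k + 1)) hp' w3 (-v1) l hl (fun q => ?_) (fun q => ?_)
  · rw [← cancel_mono (𝓑₃.inc k)]
    have h1 := hw3 q
    rw [← coD_comp K y (H.G k)] at h1
    rw [h1, Category.assoc, ← H.inc_G, ← Category.assoc, hly q]
    simp [H.F_G, Units.smul_def]
  · rw [← cancel_mono (𝓑₂.inc k)]
    have h1 := hv1 q
    have h2 := congrFun (coD_comp K l (𝓑₂.inc k)) q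
    rw [show (fun q => l q ≫ 𝓑₂.inc k) = _ from funext hly, map_sub, Units.smul_def, map_zsmul,
      coD_coD, smul_zero, zero_sub] at h2
    have h3 := congrFun (coD_comp K v (H.F k)) q
    rw [Category.assoc, ← H.inc_F, ← Category.assoc]
    simp only [Pi.neg_apply] at h2
    rw [← h3] at h2
    simp [h1, h2, Units.smul_def]

end ResSES

/-- The connecting homomorphism `Êxt^n(A, S.X₃) → Êxt^(n+1)(A, S.X₁)` of a short exact sequence
`S`. At the `k`-th stage of the direct limit it is `(-1)^k` times the connecting homomorphism of
the short exact sequence of `k`-th syzygies; the sign is needed because the connecting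
homomorphisms of the rows and of the columns anticommute. -/
noncomputable def connHat (K : ChainComplex C ℕ) [∀ q, Projective (K.X q)] {S : ShortComplex C}
    {𝓑₁ : SyzRes S.X₁} {𝓑₂ : SyzRes S.X₂} {𝓑₃ : SyzRes S.X₃} (H : ResSES S 𝓑₁ 𝓑₂ 𝓑₃)
    {n n' : ℤ} (hn : n + 1 = n') : ExtHat K 𝓑₃ n →+ ExtHat K 𝓑₁ n' :=
  SeqColim.lift _ (fun k => (k : ℤ).negOnePow • (SeqColim.of (extStep K 𝓑₁ n') k).comp
    (conn K (H.syz_exact k) (by rw [← hn]; ring))) (by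
    intro k x
    have h1 := H.conn_conn K k (p := n + k) (p' := n' + k) (r' := n + (k + 1 : ℕ))
      (p'' := n' + (k + 1 : ℕ)) (by rw [← hn]; ring) (by push_cast; ring) (by push_cast; ring)
      (by rw [← hn]; push_cast; ring) x
    have h2 := SeqColim.of_succ (extStep K 𝓑₁ n') k (conn K (H.syz_exact k)
      (by rw [← hn]; ring) x)
    have h3 : ((k + 1 : ℕ) : ℤ).negOnePow = -(k : ℤ).negOnePow := by
      push_cast; exact Int.negOnePow_succ _
    change ((k + 1 : ℕ) : ℤ).negOnePow • SeqColim.of (extStep K 𝓑₁ n') (k + 1)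
      (conn K (H.syz_exact (k + 1)) _ (conn K (𝓑₃.ses k) _ x)) =
      (k : ℤ).negOnePow • SeqColim.of (extStep K 𝓑₁ n') k (conn K (H.syz_exact k) _ x)
    rw [← h2, h3, h1, map_neg, Units.neg_smul]
    rw [smul_neg, neg_neg]
    rfl)

theorem connHat_of (K : ChainComplex C ℕ) [∀ q, Projective (K.X q)] {S : ShortComplex C}
    {𝓑₁ : SyzRes S.X₁} {𝓑₂ : SyzRes S.X₂} {𝓑₃ : SyzRes S.X₃} (H : ResSES S 𝓑₁ 𝓑₂ 𝓑₃)
    {n n' : ℤ} (hn : n + 1 = n') (k : ℕ) (x : ExtGrp K (𝓑₃.syz k) (n + k)) :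
    connHat K H hn (SeqColim.of (extStep K 𝓑₃ n) k x) =
      (k : ℤ).negOnePow • SeqColim.of (extStep K 𝓑₁ n') k
        (conn K (H.syz_exact k) (by rw [← hn]; ring) x) := rfl

end Completed

end CompletedExt

namespace CompletedExt

section Tensor

set_option linter.unusedSectionVars false

theorem projective_sigma {C : Type u} [Category.{v} C] {β : Type*} (g : β → C) [HasCoproduct g]
    (h : ∀ b, Projective (g b)) : Projective (∐ g) where
  factors f e _ :=
    have := h
    ⟨Sigma.desc fun b => Projective.factorThru (Sigma.ι g b ≫ f) e, by ext; simp⟩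

variable {C : Type u} [Category.{v} C] [Abelian C] (T : C ⥤ C ⥤ C) [T.Additive]
  [∀ X, (T.obj X).Additive]

/-- The bifunctor sends pairs of projective objects to projective objects. -/
class TensorProjective : Prop where
  projective (P Q : C) [Projective P] [Projective Q] : Projective ((T.obj P).obj Q)

instance flip_additive (X : C) : (T.flip.obj X).Additive where
  map_add {_ _ f g} := by simp [Functor.map_add]

instance hasTensorCx (K L : ChainComplex C ℕ) :
    HomologicalComplex.HasMapBifunctor K L T (ComplexShape.down ℕ) := by
  intro r
  have : Finite ((fun i : ℕ × ℕ => ComplexShape.π (ComplexShape.down ℕ) (ComplexShape.down ℕ)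
      (ComplexShape.down ℕ) i) ⁻¹' {r}) := by
    have h : ((fun i : ℕ × ℕ => ComplexShape.π (ComplexShape.down ℕ) (ComplexShape.down ℕ)
      (ComplexShape.down ℕ) i) ⁻¹' {r}) ⊆ Set.Iic (r, r) := by
      rintro ⟨i, j⟩ hij
      have : i + j = r := hij
      simp only [Set.mem_Iic, Prod.mk_le_mk]
      omega
    exact (Set.finite_Iic (r, r)).subset h
  exact hasColimitsOfShape_discrete C _ |>.has_colimit _

/-- The tensor product of two chain complexes, with the differential
`d ⊗ 1 + (-1)^i • (1 ⊗ d)` on the summand `T (K.X i) (L.X j)`. -/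
noncomputable abbrev tensorCx (K L : ChainComplex C ℕ) : ChainComplex C ℕ :=
  HomologicalComplex.mapBifunctor K L T (ComplexShape.down ℕ)

instance tensorCx_projective [TensorProjective T] (K L : ChainComplex C ℕ)
    [∀ q, Projective (K.X q)] [∀ q, Projective (L.X q)] (r : ℕ) :
    Projective ((tensorCx T K L).X r) := by
  have : ∀ i : ℕ × ℕ, Projective ((T.obj (K.X i.1)).obj (L.X i.2)) := fun i =>
    TensorProjective.projective _ _
  have h : ∀ b, Projective ((((T.mapBifunctorHomologicalComplex (ComplexShape.down ℕ)
      (ComplexShape.down ℕ)).obj K).obj L).toGradedObject.mapObjFun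
      (ComplexShape.π (ComplexShape.down ℕ) (ComplexShape.down ℕ) (ComplexShape.down ℕ)) r b) :=
    fun b => this b.1
  have : HasCoproduct ((((T.mapBifunctorHomologicalComplex (ComplexShape.down ℕ)
      (ComplexShape.down ℕ)).obj K).obj L).toGradedObject.mapObjFun
      (ComplexShape.π (ComplexShape.down ℕ) (ComplexShape.down ℕ) (ComplexShape.down ℕ)) r) :=
    hasTensorCx T K L r
  exact projective_sigma _ h

/-- The inclusion of a summand. -/
noncomputable abbrev tensorι (K L : ChainComplex C ℕ) (i j r : ℕ) (h : i + j = r) :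
    (T.obj (K.X i)).obj (L.X j) ⟶ (tensorCx T K L).X r :=
  HomologicalComplex.ιMapBifunctor K L T (ComplexShape.down ℕ) i j r h

theorem tensorCx_hom_ext {K L : ChainComplex C ℕ} {r : ℕ} {Y : C}
    {f g : (tensorCx T K L).X r ⟶ Y}
    (h : ∀ i j h, tensorι T K L i j r h ≫ f = tensorι T K L i j r h ≫ g) : f = g :=
  HomologicalComplex.mapBifunctor.hom_ext h

/-- The tensor product of two morphisms. -/
def tensorHom {X X' Y Y' : C} (f : X ⟶ X') (g : Y ⟶ Y') :
    (T.obj X).obj Y ⟶ (T.obj X').obj Y' :=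
  (T.map f).app Y ≫ (T.obj X').map g

theorem tensorHom_units_left {X X' Y Y' : C} (s : ℤˣ) (f : X ⟶ X') (g : Y ⟶ Y') :
    tensorHom T (s • f) g = s • tensorHom T f g := by
  simp [tensorHom, Units.smul_def]

theorem tensorHom_units_right {X X' Y Y' : C} (s : ℤˣ) (f : X ⟶ X') (g : Y ⟶ Y') :
    tensorHom T f (s • g) = s • tensorHom T f g := by
  simp [tensorHom, Units.smul_def]

/-- The tensor product `u ⊗ v` of two families of morphisms. -/
noncomputable def tensorFam {K L : ChainComplex C ℕ} {B E : C} (u : ∀ q, K.X q ⟶ B)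
    (v : ∀ q, L.X q ⟶ E) (r : ℕ) : (tensorCx T K L).X r ⟶ (T.obj B).obj E :=
  HomologicalComplex.mapBifunctorDesc (fun i j _ => tensorHom T (u i) (v j))

theorem ι_tensorFam {K L : ChainComplex C ℕ} {B E : C} (u : ∀ q, K.X q ⟶ B)
    (v : ∀ q, L.X q ⟶ E) (i j r : ℕ) (h : i + j = r) :
    tensorι T K L i j r h ≫ tensorFam T u v r = tensorHom T (u i) (v j) :=
  HomologicalComplex.ι_mapBifunctorDesc _ _ _ _

theorem tensorHom_zero_left {X X' Y Y' : C} (g : Y ⟶ Y') :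
    tensorHom T (0 : X ⟶ X') g = 0 := by simp [tensorHom]

theorem tensorHom_zero_right {X X' Y Y' : C} (f : X ⟶ X') :
    tensorHom T f (0 : Y ⟶ Y') = 0 := by simp [tensorHom]

theorem tensorHom_add_left {X X' Y Y' : C} (f f' : X ⟶ X') (g : Y ⟶ Y') :
    tensorHom T (f + f') g = tensorHom T f g + tensorHom T f' g := by
  simp [tensorHom, Functor.map_add]

theorem tensorHom_add_right {X X' Y Y' : C} (f : X ⟶ X') (g g' : Y ⟶ Y') :
    tensorHom T f (g + g') = tensorHom T f g + tensorHom T f g' := by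
  simp [tensorHom, Functor.map_add]

theorem tensorHom_comp {X X' X'' Y Y' Y'' : C} (f : X ⟶ X') (f' : X' ⟶ X'') (g : Y ⟶ Y')
    (g' : Y' ⟶ Y'') : tensorHom T (f ≫ f') (g ≫ g') = tensorHom T f g ≫ tensorHom T f' g' := by
  simp [tensorHom]

theorem ι_d_tensorFam {K L : ChainComplex C ℕ} {B E : C} (u : ∀ q, K.X q ⟶ B)
    (v : ∀ q, L.X q ⟶ E) (i j r : ℕ) (h : i + j = r) :
    tensorι T K L i j r h ≫ coD _ _ (tensorFam T u v) r =
      tensorHom T (coD _ _ u i) (v j) +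
        (i : ℤ).negOnePow • tensorHom T (u i) (coD _ _ v j) := by
  rcases r with _ | r
  · obtain ⟨rfl, rfl⟩ : i = 0 ∧ j = 0 := by omega
    rw [coD_zero, coD_zero, coD_zero, tensorHom_zero_left, tensorHom_zero_right]
    simp
  · rw [coD_succ, HomologicalComplex.mapBifunctor.d_eq, Preadditive.add_comp,
      Preadditive.comp_add, HomologicalComplex.mapBifunctor.ι_D₁_assoc,
      HomologicalComplex.mapBifunctor.ι_D₂_assoc]
    congr 1
    · rcases i with _ | i
      · rw [HomologicalComplex.mapBifunctor.d₁_eq_zero _ _ _ _ _ _ _ (by simp), coD_zero,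
          tensorHom_zero_left, zero_comp]
      · have hi : i + j = r := by omega
        rw [HomologicalComplex.mapBifunctor.d₁_eq K L T (ComplexShape.down ℕ)
          (show (ComplexShape.down ℕ).Rel (i + 1) i by simp) j r hi, coD_succ]
        change ((1 : ℤˣ) • _) ≫ _ = _
        rw [one_smul, Category.assoc, ι_tensorFam T u v i j r hi]
        simp [tensorHom]
    · rcases j with _ | j
      · rw [HomologicalComplex.mapBifunctor.d₂_eq_zero _ _ _ _ _ _ _ (by simp), coD_zero,
          tensorHom_zero_right, zero_comp, smul_zero]
      · have hi : i + j = r := by omega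
        rw [HomologicalComplex.mapBifunctor.d₂_eq K L T (ComplexShape.down ℕ) i
          (show (ComplexShape.down ℕ).Rel (j + 1) j by simp) r hi, coD_succ]
        change ((i : ℤ).negOnePow • _) ≫ _ = _
        rw [Units.smul_def, Preadditive.zsmul_comp, Category.assoc, ι_tensorFam T u v i j r hi,
          Units.smul_def]
        simp [tensorHom]

theorem tensorFam_add_left {K L : ChainComplex C ℕ} {B E : C} (u u' : ∀ q, K.X q ⟶ B)
    (v : ∀ q, L.X q ⟶ E) : tensorFam T (u + u') v = tensorFam T u v + tensorFam T u' v := by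
  refine funext fun r => ?_
  refine tensorCx_hom_ext T fun i j h => ?_
  rw [Pi.add_apply, Preadditive.comp_add, ι_tensorFam, ι_tensorFam, ι_tensorFam, Pi.add_apply,
    tensorHom_add_left]

theorem tensorFam_add_right {K L : ChainComplex C ℕ} {B E : C} (u : ∀ q, K.X q ⟶ B)
    (v v' : ∀ q, L.X q ⟶ E) : tensorFam T u (v + v') = tensorFam T u v + tensorFam T u v' := by
  refine funext fun r => ?_
  refine tensorCx_hom_ext T fun i j h => ?_
  rw [Pi.add_apply, Preadditive.comp_add, ι_tensorFam, ι_tensorFam, ι_tensorFam, Pi.add_apply,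
    tensorHom_add_right]

/-- The map `(u, v) ↦ u ⊗ v` as a biadditive map. -/
noncomputable def tensorFamHom (K L : ChainComplex C ℕ) (B E : C) :
    (∀ q, K.X q ⟶ B) →+ (∀ q, L.X q ⟶ E) →+ (∀ r, (tensorCx T K L).X r ⟶ (T.obj B).obj E) :=
  AddMonoidHom.mk' (fun u => AddMonoidHom.mk' (tensorFam T u) (tensorFam_add_right T u))
    (fun u u' => by ext1 v; exact tensorFam_add_left T u u' v)

theorem tensorFamHom_apply {K L : ChainComplex C ℕ} {B E : C} (u : ∀ q, K.X q ⟶ B)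
    (v : ∀ q, L.X q ⟶ E) : tensorFamHom T K L B E u v = tensorFam T u v := rfl

theorem tensorFam_mem {K L : ChainComplex C ℕ} {B E : C} {p q r : ℤ} (h : p + q = r)
    {u : ∀ q, K.X q ⟶ B} {v : ∀ q, L.X q ⟶ E} (hu : u ∈ homDeg K B p) (hv : v ∈ homDeg L E q) :
    tensorFam T u v ∈ homDeg (tensorCx T K L) ((T.obj B).obj E) r := by
  intro s hs
  refine tensorCx_hom_ext T fun i j hij => ?_
  rw [ι_tensorFam, comp_zero]
  by_cases hi : (i : ℤ) = p
  · rw [hv j (by intro hj; exact hs (by push_cast [← hij]; lia)), tensorHom_zero_right]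
  · rw [hu i hi, tensorHom_zero_left]

theorem coD_tensorFam {K L : ChainComplex C ℕ} {B E : C} {p : ℤ}
    {u : ∀ q, K.X q ⟶ B} {v : ∀ q, L.X q ⟶ E} (hu : u ∈ homDeg K B p) :
    coD _ _ (tensorFam T u v) =
      tensorFam T (coD _ _ u) v + p.negOnePow • tensorFam T u (coD _ _ v) := by
  refine funext fun r => ?_
  refine tensorCx_hom_ext T fun i j h => ?_
  rw [ι_d_tensorFam, Pi.add_apply, Preadditive.comp_add, ι_tensorFam, Units.smul_def,
    Units.smul_def, Pi.smul_apply, Preadditive.comp_zsmul, ι_tensorFam]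
  by_cases hi : (i : ℤ) = p
  · rw [hi]
  · rw [hu i hi, tensorHom_zero_left, smul_zero, smul_zero]

/-- The tensor product of cocycles. -/
noncomputable def tensorCocycle {K L : ChainComplex C ℕ} {B E : C} {p q r : ℤ} (h : p + q = r)
    (u : cocycles K B p) (v : cocycles L E q) :
    cocycles (tensorCx T K L) ((T.obj B).obj E) r :=
  ⟨tensorFam T u.1 v.1, tensorFam_mem T h u.2.1 v.2.1, by
    have hu : coD _ _ u.1 = 0 := u.2.2
    have hv : coD _ _ v.1 = 0 := v.2.2
    change coD _ _ _ = 0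
    rw [coD_tensorFam T u.2.1, hu, hv, ← tensorFamHom_apply, ← tensorFamHom_apply, map_zero,
      map_zero, AddMonoidHom.zero_apply, smul_zero, add_zero]⟩

theorem tensorCocycle_left {K L : ChainComplex C ℕ} {B E : C} {p q r : ℤ} (h : p + q = r)
    (u : cocycles K B p) (v : cocycles L E q) (hu : ExtGrp.mk _ _ _ u = 0) :
    ExtGrp.mk _ _ _ (tensorCocycle T h u v) = 0 := by
  rw [ExtGrp.mk_eq_zero] at hu ⊢
  obtain ⟨w, hw, hwu⟩ := hu
  have hv : coD _ _ v.1 = 0 := v.2.2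
  refine ⟨tensorFam T w v.1, tensorFam_mem T (by lia) hw v.2.1, ?_⟩
  rw [coD_tensorFam T hw, hwu, hv, ← tensorFamHom_apply T w, map_zero, smul_zero, add_zero]
  rfl

theorem tensorCocycle_right {K L : ChainComplex C ℕ} {B E : C} {p q r : ℤ} (h : p + q = r)
    (u : cocycles K B p) (v : cocycles L E q) (hv : ExtGrp.mk _ _ _ v = 0) :
    ExtGrp.mk _ _ _ (tensorCocycle T h u v) = 0 := by
  rw [ExtGrp.mk_eq_zero] at hv ⊢
  obtain ⟨w, hw, hwv⟩ := hv
  have hu : coD _ _ u.1 = 0 := u.2.2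
  refine ⟨p.negOnePow • tensorFam T u.1 w, ?_, ?_⟩
  · exact AddSubgroup.zsmul_mem _ (tensorFam_mem T (by lia) u.2.1 hw) _
  · rw [Units.smul_def, map_zsmul, ← Units.smul_def, coD_tensorFam T u.2.1, hwv, hu,
      ← tensorFamHom_apply T 0, map_zero, AddMonoidHom.zero_apply, zero_add,
      negOnePow_smul_smul]
    rfl

/-- The external product with the class of a fixed cocycle. -/
noncomputable def extProdAux {K : ChainComplex C ℕ} (L : ChainComplex C ℕ) {B : C} (E : C)
    {p q r : ℤ} (h : p + q = r) (u : cocycles K B p) :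
    ExtGrp L E q →+ ExtGrp (tensorCx T K L) ((T.obj B).obj E) r :=
  ExtGrp.lift
    (AddMonoidHom.mk' (fun v => (p * q).negOnePow • ExtGrp.mk _ _ _ (tensorCocycle T h u v))
      (by
        intro v v'
        rw [← smul_add, ← map_add]
        congr 2
        exact Subtype.ext (tensorFam_add_right T _ _ _)))
    (by
      intro v hv
      rw [AddMonoidHom.mk'_apply, tensorCocycle_right T h u v hv, smul_zero])

theorem extProdAux_mk {K L : ChainComplex C ℕ} {B E : C} {p q r : ℤ} (h : p + q = r)
    (u : cocycles K B p) (v : cocycles L E q) : extProdAux T L E h u (ExtGrp.mk _ _ _ v) =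
      (p * q).negOnePow • ExtGrp.mk _ _ _ (tensorCocycle T h u v) := rfl

/-- The external product `Ext^p(A, B) × Ext^q(C, E) → Ext^(p+q)(A ⊗ C, B ⊗ E)`. It sends the
classes of `u` and `v` to the class of `(-1)^(p*q) • (u ⊗ v)`. -/
noncomputable def extProd (K L : ChainComplex C ℕ) (B E : C) {p q r : ℤ} (h : p + q = r) :
    ExtGrp K B p →+ ExtGrp L E q →+ ExtGrp (tensorCx T K L) ((T.obj B).obj E) r :=
  ExtGrp.lift (AddMonoidHom.mk' (fun u => extProdAux T L E h u)
    (by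
      intro u u'
      ext y
      obtain ⟨v, rfl⟩ := ExtGrp.mk_surjective _ _ _ y
      rw [AddMonoidHom.add_apply, extProdAux_mk, extProdAux_mk, extProdAux_mk, ← smul_add,
        ← map_add]
      congr 2
      exact Subtype.ext (tensorFam_add_left T _ _ _)))
    (by
      intro u hu
      ext y
      obtain ⟨v, rfl⟩ := ExtGrp.mk_surjective _ _ _ y
      rw [AddMonoidHom.mk'_apply, extProdAux_mk, tensorCocycle_left T h u v hu, smul_zero,
        AddMonoidHom.zero_apply])

theorem extProd_mk {K L : ChainComplex C ℕ} {B E : C} {p q r : ℤ} (h : p + q = r)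
    (u : cocycles K B p) (v : cocycles L E q) :
    extProd T K L B E h (ExtGrp.mk _ _ _ u) (ExtGrp.mk _ _ _ v) =
      (p * q).negOnePow • ExtGrp.mk _ _ _ (tensorCocycle T h u v) := rfl

variable [TensorProjective T] (K L : ChainComplex C ℕ) [∀ q, Projective (K.X q)]
  [∀ q, Projective (L.X q)]

theorem map_units_smul {G H : Type*} [AddCommGroup G] [AddCommGroup H] (φ : G →+ H) (s : ℤˣ)
    (x : G) : φ (s • x) = s • φ x := by
  rw [Units.smul_def, Units.smul_def, map_zsmul]

theorem negOnePow_eq {a b : ℤ} (h : Even (a - b)) : a.negOnePow = b.negOnePow :=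
  (Int.negOnePow_eq_iff a b).2 h

theorem conn_extProd {X Y Z : C} {f : X ⟶ Y} {g : Y ⟶ Z} {hfg : f ≫ g = 0}
    (hS : (ShortComplex.mk f g hfg).ShortExact) {E : C}
    {hfg' : tensorHom T f (𝟙 E) ≫ tensorHom T g (𝟙 E) = 0}
    (hS' : (ShortComplex.mk (tensorHom T f (𝟙 E)) (tensorHom T g (𝟙 E)) hfg').ShortExact)
    {p p' q r r' : ℤ} (hp : p + 1 = p') (hr : r + 1 = r') (h : p + q = r) (h' : p' + q = r')
    (x : ExtGrp K Z p) (y : ExtGrp L E q) :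
    conn (tensorCx T K L) hS' hr (extProd T K L Z E h x y) =
      extProd T K L X E h' (conn K hS hp x) y := by
  have : Epi g := hS.epi_g
  obtain ⟨z, rfl⟩ := ExtGrp.mk_surjective _ _ _ x
  obtain ⟨v, rfl⟩ := ExtGrp.mk_surjective _ _ _ y
  obtain ⟨l, hl, hlz⟩ := exists_lift K g z.1 z.2.1
  obtain ⟨w, hw, hw'⟩ := conn_of_lift K hS hp z l hl hlz
  have hv : coD _ _ v.1 = 0 := v.2.2
  have key := conn_eq (tensorCx T K L) hS' hr (tensorCocycle T h z v)
    (q.negOnePow • tensorCocycle T h' w v) (tensorFam T l v.1) (tensorFam_mem T h hl v.2.1)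
    (fun s => by
      refine tensorCx_hom_ext T fun i j hij => ?_
      rw [← Category.assoc, ι_tensorFam, ← tensorHom_comp, hlz, Category.comp_id]
      exact (ι_tensorFam T z.1 v.1 i j s hij).symm)
    (fun s => by
      refine tensorCx_hom_ext T fun i j hij => ?_
      have h1 : (q.negOnePow • tensorCocycle T h' w v).1 s =
        q.negOnePow • tensorFam T w.1 v.1 s := rfl
      rw [h1, coD_tensorFam T hl, hv, ← tensorFamHom_apply T l, map_zero, smul_zero, add_zero,
        Units.smul_def, Units.smul_def, Preadditive.zsmul_comp, Preadditive.comp_zsmul,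
        Preadditive.comp_zsmul, ← Category.assoc, ι_tensorFam, ι_tensorFam, ← tensorHom_comp, hw,
        Category.comp_id, tensorHom_units_left, ← Units.smul_def, ← Units.smul_def, smul_smul,
        ← Int.negOnePow_add]
      congr 1
      exact negOnePow_eq ⟨0, by lia⟩)
  rw [hw', extProd_mk, extProd_mk, Units.smul_def, map_zsmul, key, ← Units.smul_def,
    map_units_smul, smul_smul, ← Int.negOnePow_add]
  congr 1
  exact negOnePow_eq ⟨0, by rw [← hp]; ring⟩

theorem conn_extProd' {X Y Z : C} {f : X ⟶ Y} {g : Y ⟶ Z} {hfg : f ≫ g = 0}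
    (hS : (ShortComplex.mk f g hfg).ShortExact) {B : C}
    {hfg' : tensorHom T (𝟙 B) f ≫ tensorHom T (𝟙 B) g = 0}
    (hS' : (ShortComplex.mk (tensorHom T (𝟙 B) f) (tensorHom T (𝟙 B) g) hfg').ShortExact)
    {p q q' r r' : ℤ} (hq : q + 1 = q') (hr : r + 1 = r') (h : p + q = r) (h' : p + q' = r')
    (x : ExtGrp K B p) (y : ExtGrp L Z q) :
    extProd T K L B X h' x (conn L hS hq y) =
      p.negOnePow • conn (tensorCx T K L) hS' hr (extProd T K L B Z h x y) := by
  have : Epi g := hS.epi_g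
  obtain ⟨u, rfl⟩ := ExtGrp.mk_surjective _ _ _ x
  obtain ⟨z, rfl⟩ := ExtGrp.mk_surjective _ _ _ y
  obtain ⟨l, hl, hlz⟩ := exists_lift L g z.1 z.2.1
  obtain ⟨w, hw, hw'⟩ := conn_of_lift L hS hq z l hl hlz
  have hu : coD _ _ u.1 = 0 := u.2.2
  have key := conn_eq (tensorCx T K L) hS' hr (tensorCocycle T h u z)
    (tensorCocycle T h' u w) (tensorFam T u.1 l) (tensorFam_mem T h u.2.1 hl)
    (fun s => by
      refine tensorCx_hom_ext T fun i j hij => ?_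
      rw [← Category.assoc, ι_tensorFam, ← tensorHom_comp, hlz, Category.comp_id]
      exact (ι_tensorFam T u.1 z.1 i j s hij).symm)
    (fun s => by
      refine tensorCx_hom_ext T fun i j hij => ?_
      have h1 : (tensorCocycle T h' u w).1 s = tensorFam T u.1 w.1 s := rfl
      have h2 : (p.negOnePow • tensorFam T u.1 (coD _ _ l)) s =
        p.negOnePow • tensorFam T u.1 (coD _ _ l) s := rfl
      rw [h1, coD_tensorFam T u.2.1, hu, ← tensorFamHom_apply T 0, map_zero,
        AddMonoidHom.zero_apply, zero_add, h2, Units.smul_def, Units.smul_def,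
        Preadditive.comp_zsmul, Preadditive.comp_zsmul, ← Category.assoc, ι_tensorFam,
        ι_tensorFam, ← tensorHom_comp, hw, Category.comp_id, tensorHom_units_right,
        ← Units.smul_def, ← Units.smul_def, smul_smul, ← Int.negOnePow_add]
      congr 1
      exact negOnePow_eq ⟨-p, by lia⟩)
  rw [hw', extProd_mk, extProd_mk, Units.smul_def (p * q).negOnePow, map_zsmul, key,
    ← Units.smul_def, smul_smul, ← Int.negOnePow_add]
  congr 1
  exact negOnePow_eq ⟨0, by rw [← hq]; ring⟩

end Tensor

end CompletedExt

namespace CompletedExt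

section External

set_option linter.unusedSectionVars false

variable {C : Type u} [Category.{v} C] [Abelian C] (T : C ⥤ C ⥤ C) [T.Additive]
  [∀ X, (T.obj X).Additive]

/-- The functors `X ⊗ -` and `- ⊗ X` are exact and preserve projective objects. -/
structure TensorGood (X : C) : Prop where
  left_lim : PreservesFiniteLimits (T.obj X)
  left_colim : PreservesFiniteColimits (T.obj X)
  left_proj : (T.obj X).PreservesProjectiveObjects
  right_lim : PreservesFiniteLimits (T.flip.obj X)
  right_colim : PreservesFiniteColimits (T.flip.obj X)
  right_proj : (T.flip.obj X).PreservesProjectiveObjects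

/-- All syzygies `X` of the resolution, including the zeroth one, have the property that `X ⊗ -`
and `- ⊗ X` are exact and preserve projective objects. -/
def GoodRes {B : C} (𝓑 : SyzRes B) : Prop := ∀ k, TensorGood T (𝓑.syz k)

theorem tensorHom_exact_right {X Y Z : C} {f : X ⟶ Y} {g : Y ⟶ Z} {hfg : f ≫ g = 0}
    (hS : (ShortComplex.mk f g hfg).ShortExact) {E : C} (hl : PreservesFiniteLimits (T.flip.obj E))
    (hc : PreservesFiniteColimits (T.flip.obj E)) :
    ∃ h : tensorHom T f (𝟙 E) ≫ tensorHom T g (𝟙 E) = 0,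
      (ShortComplex.mk (tensorHom T f (𝟙 E)) (tensorHom T g (𝟙 E)) h).ShortExact := by
  have h := hS.map_of_exact (T.flip.obj E)
  have ef : tensorHom T f (𝟙 E) = (T.flip.obj E).map f := by simp [tensorHom]
  have eg : tensorHom T g (𝟙 E) = (T.flip.obj E).map g := by simp [tensorHom]
  rw [ef, eg]
  exact ⟨_, h⟩

theorem tensorHom_exact_left {X Y Z : C} {f : X ⟶ Y} {g : Y ⟶ Z} {hfg : f ≫ g = 0}
    (hS : (ShortComplex.mk f g hfg).ShortExact) {B : C} (hl : PreservesFiniteLimits (T.obj B))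
    (hc : PreservesFiniteColimits (T.obj B)) :
    ∃ h : tensorHom T (𝟙 B) f ≫ tensorHom T (𝟙 B) g = 0,
      (ShortComplex.mk (tensorHom T (𝟙 B) f) (tensorHom T (𝟙 B) g) h).ShortExact := by
  have h := hS.map_of_exact (T.obj B)
  have ef : tensorHom T (𝟙 B) f = (T.obj B).map f := by simp [tensorHom]
  have eg : tensorHom T (𝟙 B) g = (T.obj B).map g := by simp [tensorHom]
  rw [ef, eg]
  exact ⟨_, h⟩

/-- The successor in the order `(0, false), (0, true), (1, false), (1, true), …`. -/
def altNext : ℕ × Bool → ℕ × Bool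
  | (i, false) => (i, true)
  | (i, true) => (i + 1, false)

/-- The `k`-th index in the order `(0, false), (0, true), (1, false), (1, true), …`. -/
def altIdx : ℕ → ℕ × Bool
  | 0 => (0, false)
  | k + 1 => altNext (altIdx k)

theorem altIdx_two_mul (k : ℕ) : altIdx (2 * k) = (k, false) := by
  induction k with
  | zero => rfl
  | succ k ih => rw [show 2 * (k + 1) = 2 * k + 1 + 1 by ring, altIdx, altIdx, ih]; rfl

section

variable {B E : C} (𝓑 : SyzRes B) (𝓔 : SyzRes E)

/-- The objects `B̃_0 ⊗ Ẽ_0, B̃_1 ⊗ Ẽ_0, B̃_1 ⊗ Ẽ_1, B̃_2 ⊗ Ẽ_1, …`. -/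
def altObj : ℕ × Bool → C
  | (i, false) => (T.obj (𝓑.syz i)).obj (𝓔.syz i)
  | (i, true) => (T.obj (𝓑.syz (i + 1))).obj (𝓔.syz i)

/-- The objects `B_0 ⊗ Ẽ_0, B̃_1 ⊗ E_0, B_1 ⊗ Ẽ_1, B̃_2 ⊗ E_1, …`. -/
def altTerm : ℕ × Bool → C
  | (i, false) => (T.obj (𝓑.P i)).obj (𝓔.syz i)
  | (i, true) => (T.obj (𝓑.syz (i + 1))).obj (𝓔.P i)

/-- The inclusions. -/
def altInc : ∀ s, altObj T 𝓑 𝓔 (altNext s) ⟶ altTerm T 𝓑 𝓔 s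
  | (i, false) => tensorHom T (𝓑.inc i) (𝟙 (𝓔.syz i))
  | (i, true) => tensorHom T (𝟙 (𝓑.syz (i + 1))) (𝓔.inc i)

/-- The projections. -/
def altPr : ∀ s, altTerm T 𝓑 𝓔 s ⟶ altObj T 𝓑 𝓔 s
  | (i, false) => tensorHom T (𝓑.pr i) (𝟙 (𝓔.syz i))
  | (i, true) => tensorHom T (𝟙 (𝓑.syz (i + 1))) (𝓔.pr i)

variable {𝓑 𝓔}

theorem alt_exact (h𝓑 : GoodRes T 𝓑) (h𝓔 : GoodRes T 𝓔) :
    ∀ s, ∃ h : altInc T 𝓑 𝓔 s ≫ altPr T 𝓑 𝓔 s = 0,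
      (ShortComplex.mk (altInc T 𝓑 𝓔 s) (altPr T 𝓑 𝓔 s) h).ShortExact
  | (i, false) => tensorHom_exact_right T (𝓑.ses i) (h𝓔 i).right_lim (h𝓔 i).right_colim
  | (i, true) =>
    tensorHom_exact_left T (𝓔.ses i) (h𝓑 (i + 1)).left_lim (h𝓑 (i + 1)).left_colim

theorem altTerm_projective (h𝓑 : GoodRes T 𝓑) (h𝓔 : GoodRes T 𝓔) :
    ∀ s, Projective (altTerm T 𝓑 𝓔 s)
  | (i, false) => (h𝓔 i).right_proj.projective_obj (𝓑.projective i)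
  | (i, true) => (h𝓑 (i + 1)).left_proj.projective_obj (𝓔.projective i)

variable (𝓑 𝓔) in
/-- The projections of the resolution `tensorRes`. -/
def tensorResπ : ∀ k, altTerm T 𝓑 𝓔 (altIdx k) ⟶
    syzFun ((T.obj B).obj E) (fun k => altObj T 𝓑 𝓔 (altIdx (k + 1))) k
  | 0 => altPr T 𝓑 𝓔 (altIdx 0)
  | k + 1 => altPr T 𝓑 𝓔 (altIdx (k + 1))

theorem tensorRes_exact (h𝓑 : GoodRes T 𝓑) (h𝓔 : GoodRes T 𝓔) :
    ∀ k, ∃ h : altInc T 𝓑 𝓔 (altIdx k) ≫ tensorResπ T 𝓑 𝓔 k = 0,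
      (ShortComplex.mk (altInc T 𝓑 𝓔 (altIdx k)) (tensorResπ T 𝓑 𝓔 k) h).ShortExact
  | 0 => alt_exact T h𝓑 h𝓔 (altIdx 0)
  | k + 1 => alt_exact T h𝓑 h𝓔 (altIdx (k + 1))

/-- The projective resolution of `B ⊗ E` with the terms `B_0 ⊗ Ẽ_0, B̃_1 ⊗ E_0, B_1 ⊗ Ẽ_1,
B̃_2 ⊗ E_1, …` and the syzygies `B ⊗ E, B̃_1 ⊗ Ẽ_0, B̃_1 ⊗ Ẽ_1, B̃_2 ⊗ Ẽ_1, …`. -/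
def tensorRes (h𝓑 : GoodRes T 𝓑) (h𝓔 : GoodRes T 𝓔) : SyzRes ((T.obj B).obj E) where
  P k := altTerm T 𝓑 𝓔 (altIdx k)
  Z k := altObj T 𝓑 𝓔 (altIdx (k + 1))
  ι k := altInc T 𝓑 𝓔 (altIdx k)
  π k := tensorResπ T 𝓑 𝓔 k
  projective k := altTerm_projective T h𝓑 h𝓔 (altIdx k)
  zero k := (tensorRes_exact T h𝓑 h𝓔 k).1
  exact k := (tensorRes_exact T h𝓑 h𝓔 k).2

theorem tensorRes_syz (h𝓑 : GoodRes T 𝓑) (h𝓔 : GoodRes T 𝓔) :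
    ∀ k, (tensorRes T h𝓑 h𝓔).syz k = altObj T 𝓑 𝓔 (altIdx k)
  | 0 => rfl
  | _ + 1 => rfl

variable (M : ChainComplex C ℕ) [∀ q, Projective (M.X q)]

/-- The canonical map from the stage of the index `s`. -/
noncomputable def ofAlt (h𝓑 : GoodRes T 𝓑) (h𝓔 : GoodRes T 𝓔) (n : ℤ) (j : ℕ) (s : ℕ × Bool)
    (hs : altIdx j = s) (d : ℤ) (hd : n + j = d) :
    ExtGrp M (altObj T 𝓑 𝓔 s) d →+ ExtHat M (tensorRes T h𝓑 h𝓔) n :=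
  match j, hs, hd with
  | 0, hs, hd => hs ▸ hd ▸ SeqColim.of (extStep M (tensorRes T h𝓑 h𝓔) n) 0
  | j + 1, hs, hd => hs ▸ hd ▸ SeqColim.of (extStep M (tensorRes T h𝓑 h𝓔) n) (j + 1)

theorem ofAlt_conn (h𝓑 : GoodRes T 𝓑) (h𝓔 : GoodRes T 𝓔) (n : ℤ) (j : ℕ) (s : ℕ × Bool)
    (hs : altIdx j = s) (d d' : ℤ) (hd : n + j = d) (hd' : n + (j + 1 : ℕ) = d')
    (h : d + 1 = d') (x : ExtGrp M (altObj T 𝓑 𝓔 s) d) :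
    ofAlt T M h𝓑 h𝓔 n (j + 1) (altNext s) (by rw [altIdx, hs]) d' hd'
      (conn M (alt_exact T h𝓑 h𝓔 s).2 h x) = ofAlt T M h𝓑 h𝓔 n j s hs d hd x := by
  subst hs hd hd'
  rcases j with _ | j
  · exact SeqColim.of_succ (extStep M (tensorRes T h𝓑 h𝓔) n) 0 x
  · exact SeqColim.of_succ (extStep M (tensorRes T h𝓑 h𝓔) n) (j + 1) x

end

/-- The signs by which the external product at the `k`-th stage is multiplied, so that the products
of all stages are compatible. They have period four in `k` and are `1` if `4` divides `k`. -/
def altSign (m : ℤ) : ℕ → ℤˣ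
  | 0 => 1
  | k + 1 => altSign m k * (m + (k + 1 : ℕ)).negOnePow

variable [TensorProjective T] (K L : ChainComplex C ℕ) [∀ q, Projective (K.X q)]
  [∀ q, Projective (L.X q)]

theorem smul_map_aux {G H : Type*} [AddCommGroup G] [AddCommGroup H] (φ : G →+ H) {s t s' : ℤˣ}
    (hs : s * t = s') {a b : G} (hab : a = t • b) : s • φ a = s' • φ b := by
  rw [hab, map_units_smul, smul_smul, hs]

/-- The external product `Ext^(m+k)(A, B̃_k) × Ext^(n+k)(C, Ẽ_k) → Ext^(m+n+2k)(A ⊗ C, B̃_k ⊗ Ẽ_k)`,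
with values in the direct limit and with the sign `altSign m k`. -/
noncomputable def extHatStage {B E : C} {𝓑 : SyzRes B} {𝓔 : SyzRes E} (h𝓑 : GoodRes T 𝓑)
    (h𝓔 : GoodRes T 𝓔) {m n r : ℤ} (h : m + n = r) (k : ℕ) :
    ExtGrp K (𝓑.syz k) (m + k) →+ ExtGrp L (𝓔.syz k) (n + k) →+
      ExtHat (tensorCx T K L) (tensorRes T h𝓑 h𝓔) r :=
  altSign m k • (AddMonoidHom.compr₂
    (extProd T K L (𝓑.syz k) (𝓔.syz k) (p := m + k) (q := n + k) (r := r + (2 * k : ℕ))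
      (by rw [← h]; push_cast; ring))
    (ofAlt T (tensorCx T K L) h𝓑 h𝓔 r (2 * k) (k, false) (altIdx_two_mul k) _ rfl))

theorem extHatStage_apply {B E : C} {𝓑 : SyzRes B} {𝓔 : SyzRes E} (h𝓑 : GoodRes T 𝓑)
    (h𝓔 : GoodRes T 𝓔) {m n r : ℤ} (h : m + n = r) (k : ℕ) (x : ExtGrp K (𝓑.syz k) (m + k))
    (y : ExtGrp L (𝓔.syz k) (n + k)) :
    extHatStage T K L h𝓑 h𝓔 h k x y =
    altSign m k • ofAlt T (tensorCx T K L) h𝓑 h𝓔 r (2 * k) (k, false) (altIdx_two_mul k) _ rfl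
      (extProd T K L (𝓑.syz k) (𝓔.syz k) (p := m + k) (q := n + k) (r := r + (2 * k : ℕ))
        (by rw [← h]; push_cast; ring) x y) := rfl

theorem extHatStage_succ {B E : C} {𝓑 : SyzRes B} {𝓔 : SyzRes E} (h𝓑 : GoodRes T 𝓑)
    (h𝓔 : GoodRes T 𝓔) {m n r : ℤ} (h : m + n = r) (k : ℕ) (x : ExtGrp K (𝓑.syz k) (m + k))
    (y : ExtGrp L (𝓔.syz k) (n + k)) :
    extHatStage T K L h𝓑 h𝓔 h (k + 1) (extStep K 𝓑 m k x) (extStep L 𝓔 n k y) =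
      extHatStage T K L h𝓑 h𝓔 h k x y := by
  have e1 := conn_extProd T K L (𝓑.ses k)
    (tensorHom_exact_right T (𝓑.ses k) (h𝓔 k).right_lim (h𝓔 k).right_colim).2
    (p := m + k) (p' := m + (k + 1 : ℕ)) (q := n + k) (r := r + (2 * k : ℕ))
    (r' := r + (2 * k + 1 : ℕ)) (by push_cast; ring) (by push_cast; ring)
    (by rw [← h]; push_cast; ring) (by rw [← h]; push_cast; ring) x y
  have e2 := conn_extProd' T K L (𝓔.ses k)
    (tensorHom_exact_left T (𝓔.ses k) (h𝓑 (k + 1)).left_lim (h𝓑 (k + 1)).left_colim).2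
    (p := m + (k + 1 : ℕ)) (q := n + k) (q' := n + (k + 1 : ℕ)) (r := r + (2 * k + 1 : ℕ))
    (r' := r + (2 * (k + 1) : ℕ)) (by push_cast; ring) (by push_cast; ring)
    (by rw [← h]; push_cast; ring) (by rw [← h]; push_cast; ring) (extStep K 𝓑 m k x) y
  rw [extHatStage_apply, extHatStage_apply]
  have e2' : extProd T K L (𝓑.syz (k + 1)) (𝓔.syz (k + 1)) (p := m + (k + 1 : ℕ))
      (q := n + (k + 1 : ℕ)) (r := r + (2 * (k + 1) : ℕ)) (by rw [← h]; push_cast; ring)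
      (extStep K 𝓑 m k x) (extStep L 𝓔 n k y) = _ := e2
  have o1 := ofAlt_conn T (tensorCx T K L) h𝓑 h𝓔 r (2 * k) (k, false) (altIdx_two_mul k)
    (r + (2 * k : ℕ)) (r + (2 * k + 1 : ℕ)) rfl rfl (by push_cast; ring)
    (extProd T K L (𝓑.syz k) (𝓔.syz k) (p := m + k) (q := n + k) (r := r + (2 * k : ℕ))
        (by rw [← h]; push_cast; ring) x y)
  have o2 := ofAlt_conn T (tensorCx T K L) h𝓑 h𝓔 r (2 * k + 1) (k, true)
    (by rw [altIdx, altIdx_two_mul]; rfl) (r + (2 * k + 1 : ℕ)) (r + (2 * (k + 1) : ℕ)) rfl rfl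
    (by push_cast; ring) (extProd T K L (𝓑.syz (k + 1)) (𝓔.syz k) (p := m + (k + 1 : ℕ))
      (q := n + k) (r := r + (2 * k + 1 : ℕ)) (by rw [← h]; push_cast; ring)
      (extStep K 𝓑 m k x) y)
  have hs : altSign m (k + 1) * (m + (k + 1 : ℕ)).negOnePow = altSign m k := by
    rw [altSign, mul_assoc, ← Int.negOnePow_add, ← two_mul, Int.negOnePow_two_mul, mul_one]
  refine (smul_map_aux (ofAlt T (tensorCx T K L) h𝓑 h𝓔 r (2 * (k + 1)) (k + 1, false)
    (altIdx_two_mul (k + 1)) _ rfl) hs e2').trans ?_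
  refine congrArg (altSign m k • ·) (o2.trans (Eq.trans ?_ o1))
  exact congrArg (ofAlt T (tensorCx T K L) h𝓑 h𝓔 r (2 * k + 1) (k, true)
    (by rw [altIdx, altIdx_two_mul]; rfl) (r + (2 * k + 1 : ℕ)) rfl) e1.symm

/-- The external product on completed Ext-groups: the direct limit over `k` of the external products
`Ext^(m+k)(A, B̃_k) × Ext^(n+k)(C, Ẽ_k) → Ext^(m+n+2k)(A ⊗ C, B̃_k ⊗ Ẽ_k)`. -/
noncomputable def extHatProd {B E : C} {𝓑 : SyzRes B} {𝓔 : SyzRes E} (h𝓑 : GoodRes T 𝓑)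
    (h𝓔 : GoodRes T 𝓔) {m n r : ℤ} (h : m + n = r) :
    ExtHat K 𝓑 m →+ ExtHat L 𝓔 n →+ ExtHat (tensorCx T K L) (tensorRes T h𝓑 h𝓔) r :=
  SeqColim.lift₂ _ _ (extHatStage T K L h𝓑 h𝓔 h) (extHatStage_succ T K L h𝓑 h𝓔 h)

theorem extHatProd_of {B E : C} {𝓑 : SyzRes B} {𝓔 : SyzRes E} (h𝓑 : GoodRes T 𝓑)
    (h𝓔 : GoodRes T 𝓔) {m n r : ℤ} (h : m + n = r) (k : ℕ) (x : ExtGrp K (𝓑.syz k) (m + k))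
    (y : ExtGrp L (𝓔.syz k) (n + k)) :
    extHatProd T K L h𝓑 h𝓔 h (SeqColim.of (extStep K 𝓑 m) k x)
      (SeqColim.of (extStep L 𝓔 n) k y) = extHatStage T K L h𝓑 h𝓔 h k x y :=
  SeqColim.lift₂_of _ _ _ (extHatStage_succ T K L h𝓑 h𝓔 h) k x y

end External

end CompletedExt

namespace CompletedExt

section Cup

set_option linter.unusedSectionVars false

variable {C : Type u} [Category.{v} C] [Abelian C]

theorem coD_precomp {K L : ChainComplex C ℕ} (φ : K ⟶ L) {B : C} (u : ∀ q, L.X q ⟶ B) :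
    coD K B (fun q => φ.f q ≫ u q) = fun q => φ.f q ≫ coD L B u q := by
  refine funext fun q => ?_
  rcases q with _ | q
  · simp [coD_zero]
  · simp [coD_succ]

theorem precomp_mem {K L : ChainComplex C ℕ} (φ : K ⟶ L) {B : C} {p : ℤ} {u : ∀ q, L.X q ⟶ B}
    (hu : u ∈ homDeg L B p) : (fun q => φ.f q ≫ u q) ∈ homDeg K B p := by
  intro q hq
  simp [hu q hq]

/-- Precomposition with a chain map on cocycles. -/
def precompCocycle {K L : ChainComplex C ℕ} (φ : K ⟶ L) {B : C} {p : ℤ} (u : cocycles L B p) :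
    cocycles K B p :=
  ⟨fun q => φ.f q ≫ u.1 q, precomp_mem φ u.2.1, by
    have hu : coD _ _ u.1 = 0 := u.2.2
    change coD _ _ _ = 0
    rw [coD_precomp, hu]
    ext q
    simp⟩

/-- Precomposition with a chain map on Ext-groups. -/
def precomp {K L : ChainComplex C ℕ} (φ : K ⟶ L) (B : C) (p : ℤ) :
    ExtGrp L B p →+ ExtGrp K B p :=
  ExtGrp.lift (AddMonoidHom.mk' (fun u => ExtGrp.mk K B p (precompCocycle φ u))
    (by
      intro u u'
      rw [← map_add]
      congr 1
      refine Subtype.ext (funext fun q => ?_)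
      change φ.f q ≫ (u.1 q + u'.1 q) = φ.f q ≫ u.1 q + φ.f q ≫ u'.1 q
      rw [Preadditive.comp_add]))
    (by
      intro u hu
      rw [ExtGrp.mk_eq_zero] at hu
      obtain ⟨w, hw, hwu⟩ := hu
      rw [AddMonoidHom.mk'_apply, ExtGrp.mk_eq_zero]
      exact ⟨_, precomp_mem φ hw, by rw [coD_precomp, hwu]; rfl⟩)

theorem precomp_mk {K L : ChainComplex C ℕ} (φ : K ⟶ L) (B : C) (p : ℤ) (u : cocycles L B p) :
    precomp φ B p (ExtGrp.mk L B p u) = ExtGrp.mk K B p (precompCocycle φ u) := rfl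

theorem precomp_conn {K L : ChainComplex C ℕ} [∀ q, Projective (K.X q)]
    [∀ q, Projective (L.X q)] (φ : K ⟶ L) {X Y Z : C} {f : X ⟶ Y} {g : Y ⟶ Z} {hfg : f ≫ g = 0}
    (hS : (ShortComplex.mk f g hfg).ShortExact) {p p' : ℤ} (hp : p + 1 = p') (x : ExtGrp L Z p) :
    conn K hS hp (precomp φ Z p x) = precomp φ X p' (conn L hS hp x) := by
  have : Epi g := hS.epi_g
  obtain ⟨z, rfl⟩ := ExtGrp.mk_surjective _ _ _ x
  obtain ⟨l, hl, hlz⟩ := exists_lift L g z.1 z.2.1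
  obtain ⟨w, hw, hw'⟩ := conn_of_lift L hS hp z l hl hlz
  rw [hw', precomp_mk, precomp_mk]
  refine conn_eq K hS hp _ _ _ (precomp_mem φ hl) (fun q => ?_) (fun q => ?_)
  · rw [Category.assoc, hlz]
    rfl
  · rw [coD_precomp]
    change (φ.f q ≫ w.1 q) ≫ f = _
    rw [Category.assoc, hw, Units.smul_def, Units.smul_def, Preadditive.comp_zsmul]

/-- Precomposition with a chain map on completed Ext-groups. -/
noncomputable def precompHat {K L : ChainComplex C ℕ} [∀ q, Projective (K.X q)]
    [∀ q, Projective (L.X q)] (φ : K ⟶ L) {B : C} (𝓑 : SyzRes B) (n : ℤ) :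
    ExtHat L 𝓑 n →+ ExtHat K 𝓑 n :=
  SeqColim.lift _ (fun k => (SeqColim.of (extStep K 𝓑 n) k).comp (precomp φ (𝓑.syz k) (n + k)))
    (by
      intro k x
      have h1 := precomp_conn φ (𝓑.ses k) (p := n + k) (p' := n + (k + 1 : ℕ))
        (by push_cast; ring) x
      have h2 := SeqColim.of_succ (extStep K 𝓑 n) k (precomp φ (𝓑.syz k) (n + k) x)
      rw [AddMonoidHom.comp_apply, AddMonoidHom.comp_apply, ← h2]
      exact congrArg _ h1.symm)

variable (T : C ⥤ C ⥤ C) [T.Additive] [∀ X, (T.obj X).Additive]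

/-- The augmentation `P 0 ⟶ A` of a projective resolution, as a cocycle of degree zero. -/
noncomputable def augCocycle {A : C} (P : ProjectiveResolution A) : cocycles P.complex A 0 :=
  ⟨fun q => match q with
    | 0 => (ChainComplex.toSingle₀Equiv P.complex A P.π).1
    | _ + 1 => 0, by
    refine ⟨?_, ?_⟩
    · rintro (_ | q) hq
      · exact absurd rfl hq
      · rfl
    · refine funext fun q => ?_
      rcases q with _ | _ | q
      · exact coD_zero _ _ _
      · exact (ChainComplex.toSingle₀Equiv P.complex A P.π).2
      · exact comp_zero⟩

/-- The augmentation of the tensor product of two projective resolutions, which is the tensor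
product of the augmentations in degree zero. -/
noncomputable def augTensor {A B : C} (P : ProjectiveResolution A) (Q : ProjectiveResolution B) :
    tensorCx T P.complex Q.complex ⟶ (ChainComplex.single₀ C).obj ((T.obj A).obj B) :=
  (ChainComplex.toSingle₀Equiv (tensorCx T P.complex Q.complex) ((T.obj A).obj B)).symm
    ⟨tensorFam T (augCocycle P).1 (augCocycle Q).1 0, by
      have h := (tensorCocycle T (add_zero 0) (augCocycle P) (augCocycle Q)).2.2
      exact congrFun h 1⟩

/-- The tensor product of the projective resolutions `P` of `A` and `Q` of `B` is a resolution of
`A ⊗ B`. -/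
def IsTensorRes {A B : C} (P : ProjectiveResolution A) (Q : ProjectiveResolution B) : Prop :=
  QuasiIso (augTensor T P Q)

/-- The tensor product of two projective resolutions as a projective resolution. -/
noncomputable def tensorProjRes [TensorProjective T] {A B : C} (P : ProjectiveResolution A)
    (Q : ProjectiveResolution B) (h : IsTensorRes T P Q) :
    ProjectiveResolution ((T.obj A).obj B) where
  complex := tensorCx T P.complex Q.complex
  projective := tensorCx_projective T P.complex Q.complex
  π := augTensor T P Q
  quasiIso := h

/-- The cup product on completed cohomology `Êxt^m(R, M) × Êxt^n(R, N) → Êxt^(m+n)(R, M ⊗ N)`: the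
external product followed by the map that is induced by the isomorphism `R ≅ R ⊗ R`. -/
noncomputable def cupHat [TensorProjective T] {R : C} (e : (T.obj R).obj R ≅ R)
    {R₁ R₂ R₃ : ProjectiveResolution R} (hR : IsTensorRes T R₁ R₂)
    (Δ : ProjectiveResolution.Hom R₃ (tensorProjRes T R₁ R₂ hR) e.inv) {M N : C} {𝓜 : SyzRes M}
    {𝓝 : SyzRes N} (h𝓜 : GoodRes T 𝓜) (h𝓝 : GoodRes T 𝓝) {m n r : ℤ} (h : m + n = r) :
    ExtHat R₁.complex 𝓜 m →+ ExtHat R₂.complex 𝓝 n →+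
      ExtHat R₃.complex (tensorRes T h𝓜 h𝓝) r :=
  AddMonoidHom.compr₂ (extHatProd T R₁.complex R₂.complex h𝓜 h𝓝 h)
    (precompHat Δ.hom (tensorRes T h𝓜 h𝓝) r)

end Cup

end CompletedExt

namespace CompletedExt

section Vogel

open CochainComplex.HomComplex

variable {C : Type u} [Category.{v} C] [Preadditive C]

/-- The cochains of degree `n` that are nonzero in finitely many degrees only. -/
def bdd (K L : CochainComplex C ℤ) (n : ℤ) : AddSubgroup (Cochain K L n) where
  carrier := {z | {p : ℤ | z.v p (p + n) rfl ≠ 0}.Finite}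
  zero_mem' := by simp
  add_mem' := by
    intro a b ha hb
    refine (ha.union hb).subset fun p hp => ?_
    by_contra h
    simp only [Set.mem_union, Set.mem_ofPred_eq, not_or, not_not] at h
    exact hp (by rw [Cochain.add_v, h.1, h.2, add_zero])
  neg_mem' := by
    intro a ha
    simpa using ha

theorem mem_bdd {K L : CochainComplex C ℤ} {n : ℤ} {z : Cochain K L n} {s : Set ℤ}
    (hs : s.Finite) (h : ∀ p q (hpq : p + n = q), p ∉ s → z.v p q hpq = 0) : z ∈ bdd K L n :=
  hs.subset fun p hp => by
    by_contra hps
    exact hp (h p _ rfl hps)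

theorem exists_of_mem_bdd {K L : CochainComplex C ℤ} {n : ℤ} {z : Cochain K L n}
    (hz : z ∈ bdd K L n) :
    ∃ s : Set ℤ, s.Finite ∧ ∀ p q (hpq : p + n = q), p ∉ s → z.v p q hpq = 0 := by
  refine ⟨_, hz, ?_⟩
  rintro p _ rfl hp
  simpa using hp

theorem comp_mem_bdd_left {K L M : CochainComplex C ℤ} {m n r : ℤ} (h : m + n = r)
    {z : Cochain K L m} (hz : z ∈ bdd K L m) (w : Cochain L M n) : z.comp w h ∈ bdd K M r := by
  obtain ⟨s, hs, hz⟩ := exists_of_mem_bdd hz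
  refine mem_bdd hs fun p q hpq hp => ?_
  rw [Cochain.comp_v z w h p (p + m) q rfl (by lia), hz _ _ _ hp, zero_comp]

theorem comp_mem_bdd_right {K L M : CochainComplex C ℤ} {m n r : ℤ} (h : m + n = r)
    (z : Cochain K L m) {w : Cochain L M n} (hw : w ∈ bdd L M n) : z.comp w h ∈ bdd K M r := by
  obtain ⟨s, hs, hw⟩ := exists_of_mem_bdd hw
  refine mem_bdd (hs.preimage (f := fun p => p + m) (by simp [Set.InjOn]))
    fun p q hpq hp => ?_
  rw [Cochain.comp_v z w h p (p + m) q rfl (by lia), hw _ _ _ hp, comp_zero]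

theorem δ_mem_bdd {K L : CochainComplex C ℤ} {n n' : ℤ} (h : n + 1 = n') {z : Cochain K L n}
    (hz : z ∈ bdd K L n) : δ n n' z ∈ bdd K L n' := by
  obtain ⟨s, hs, hz⟩ := exists_of_mem_bdd hz
  refine mem_bdd (hs.union (hs.preimage (f := fun p => p + 1) (by simp [Set.InjOn])))
    fun p q hpq hp => ?_
  simp only [Set.mem_union, Set.mem_preimage, not_or] at hp
  rw [δ_v n n' h z p q hpq (q - 1) (p + 1) (by lia) (by lia), hz _ _ _ hp.1, hz _ _ _ hp.2]
  simp

/-- The cocycles of the Vogel complex: cochains whose differential is bounded. -/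
def vCocycles (K L : CochainComplex C ℤ) (n : ℤ) : AddSubgroup (Cochain K L n) :=
  (bdd K L (n + 1)).comap (δ_hom ℤ K L n (n + 1)).toAddMonoidHom

/-- The coboundaries of the Vogel complex: the cochains that differ from the differential of a
cochain by a bounded cochain. -/
def vCoboundaries (K L : CochainComplex C ℤ) (n : ℤ) : AddSubgroup (Cochain K L n) :=
  (δ_hom ℤ K L (n - 1) n).toAddMonoidHom.range ⊔ bdd K L n

theorem mem_vCocycles {K L : CochainComplex C ℤ} {n n' : ℤ} (h : n + 1 = n') (z : Cochain K L n) :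
    z ∈ vCocycles K L n ↔ δ n n' z ∈ bdd K L n' := by
  subst h
  rfl

theorem mem_vCoboundaries {K L : CochainComplex C ℤ} {n n' : ℤ} (h : n' + 1 = n)
    (z : Cochain K L n) :
    z ∈ vCoboundaries K L n ↔ ∃ w : Cochain K L n', z - δ n' n w ∈ bdd K L n := by
  obtain rfl : n' = n - 1 := by lia
  unfold vCoboundaries
  rw [AddSubgroup.mem_sup]
  constructor
  · rintro ⟨_, ⟨w, rfl⟩, b, hb, rfl⟩
    exact ⟨w, by simpa using hb⟩
  · rintro ⟨w, hw⟩
    exact ⟨_, ⟨w, rfl⟩, _, hw, by simp⟩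

/-- The cohomology in degree `n` of the Vogel complex, the quotient of the complex `Hom(K, L)` of
cochains by the subcomplex of bounded cochains. It is the completed Ext-group `Êxt^n(F, H)` in the
hypercohomology construction if `K` and `L` are projective resolutions of `F` and `H`. -/
def VExt (K L : CochainComplex C ℤ) (n : ℤ) : Type v :=
  vCocycles K L n ⧸ (vCoboundaries K L n).addSubgroupOf (vCocycles K L n)

instance (K L : CochainComplex C ℤ) (n : ℤ) : AddCommGroup (VExt K L n) :=
  inferInstanceAs
    (AddCommGroup (vCocycles K L n ⧸ (vCoboundaries K L n).addSubgroupOf (vCocycles K L n)))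

/-- The class of a cocycle. -/
def VExt.mk (K L : CochainComplex C ℤ) (n : ℤ) : vCocycles K L n →+ VExt K L n :=
  QuotientAddGroup.mk' ((vCoboundaries K L n).addSubgroupOf (vCocycles K L n))

theorem VExt.mk_surjective (K L : CochainComplex C ℤ) (n : ℤ) :
    Function.Surjective (VExt.mk K L n) :=
  QuotientAddGroup.mk'_surjective ((vCoboundaries K L n).addSubgroupOf (vCocycles K L n))

theorem VExt.mk_eq_zero {K L : CochainComplex C ℤ} {n : ℤ} (z : vCocycles K L n) :
    VExt.mk K L n z = 0 ↔ z.1 ∈ vCoboundaries K L n :=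
  (QuotientAddGroup.eq_zero_iff z).trans Iff.rfl

/-- The homomorphism induced by a homomorphism on cocycles that vanishes on coboundaries. -/
def VExt.lift {K L : CochainComplex C ℤ} {n : ℤ} {H : Type*} [AddCommGroup H]
    (g : vCocycles K L n →+ H) (hg : ∀ z, VExt.mk K L n z = 0 → g z = 0) : VExt K L n →+ H :=
  QuotientAddGroup.lift ((vCoboundaries K L n).addSubgroupOf (vCocycles K L n)) g
    (fun z hz => hg z ((QuotientAddGroup.eq_zero_iff z).2 hz))

/-- The composition of cocycles. -/
def vComp {K L M : CochainComplex C ℤ} {m n r : ℤ} (h : m + n = r) (z : vCocycles K L m)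
    (w : vCocycles L M n) : vCocycles K M r :=
  ⟨z.1.comp w.1 h, by
    rw [mem_vCocycles rfl, δ_comp z.1 w.1 h (m + 1) (n + 1) (r + 1) rfl rfl rfl]
    exact add_mem (comp_mem_bdd_right _ _ ((mem_vCocycles rfl _).1 w.2))
      (AddSubgroup.zsmul_mem _ (comp_mem_bdd_left _ ((mem_vCocycles rfl _).1 z.2) _) _)⟩

theorem vComp_left {K L M : CochainComplex C ℤ} {m n r : ℤ} (h : m + n = r) (z : vCocycles K L m)
    (w : vCocycles L M n) (hz : VExt.mk _ _ _ z = 0) : VExt.mk _ _ _ (vComp h z w) = 0 := by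
  rw [VExt.mk_eq_zero, mem_vCoboundaries (sub_add_cancel _ 1)] at hz ⊢
  obtain ⟨t, ht⟩ := hz
  refine ⟨n.negOnePow • t.comp w.1 (by lia), ?_⟩
  have e : (vComp h z w).1 - δ (r - 1) r (n.negOnePow • t.comp w.1 (by lia)) =
      (z.1 - δ (m - 1) m t).comp w.1 h - n.negOnePow • t.comp (δ n (n + 1) w.1) (by lia) := by
    rw [δ_units_smul, δ_comp t w.1 (by lia) m (n + 1) r (by lia) (by lia) (by lia), smul_add,
      negOnePow_smul_smul, Cochain.sub_comp]
    change z.1.comp w.1 h - _ = _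
    abel
  rw [e]
  exact sub_mem (comp_mem_bdd_left _ ht _) (AddSubgroup.zsmul_mem _
    (comp_mem_bdd_right _ _ ((mem_vCocycles rfl _).1 w.2)) _)

theorem vComp_right {K L M : CochainComplex C ℤ} {m n r : ℤ} (h : m + n = r) (z : vCocycles K L m)
    (w : vCocycles L M n) (hw : VExt.mk _ _ _ w = 0) : VExt.mk _ _ _ (vComp h z w) = 0 := by
  rw [VExt.mk_eq_zero, mem_vCoboundaries (sub_add_cancel _ 1)] at hw ⊢
  obtain ⟨t, ht⟩ := hw
  refine ⟨z.1.comp t (by lia), ?_⟩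
  have e : (vComp h z w).1 - δ (r - 1) r (z.1.comp t (by lia)) =
      z.1.comp (w.1 - δ (n - 1) n t) h -
        (n - 1).negOnePow • (δ m (m + 1) z.1).comp t (by lia) := by
    rw [δ_comp z.1 t (by lia) (m + 1) n r (by lia) (by lia) (by lia), Cochain.comp_sub]
    change z.1.comp w.1 h - _ = _
    abel
  rw [e]
  exact sub_mem (comp_mem_bdd_right _ _ ht) (AddSubgroup.zsmul_mem _
    (comp_mem_bdd_left _ ((mem_vCocycles rfl _).1 z.2) _) _)

/-- The Yoneda product with a fixed cocycle. -/
def yonedaAux {K L : CochainComplex C ℤ} (M : CochainComplex C ℤ) {m n r : ℤ} (h : n + m = r)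
    (w : vCocycles K L m) : VExt L M n →+ VExt K M r :=
  VExt.lift (AddMonoidHom.mk' (fun z => VExt.mk _ _ _ (vComp (by rw [add_comm, h]) w z))
    (by
      intro z z'
      rw [← map_add]
      congr 1
      exact Subtype.ext (Cochain.comp_add w.1 z.1 z'.1 (by rw [add_comm, h]))))
    (fun z hz => vComp_right _ w z hz)

/-- The Yoneda product `Êxt^n(H, J) × Êxt^m(F, H) → Êxt^(m+n)(F, J)`, `(y, x) ↦ y ∘ x`, which is
induced by the composition of cochains. -/
def yoneda (K L M : CochainComplex C ℤ) {m n r : ℤ} (h : n + m = r) :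
    VExt L M n →+ VExt K L m →+ VExt K M r :=
  AddMonoidHom.flip (VExt.lift (AddMonoidHom.mk' (fun w => yonedaAux M h w)
    (by
      intro w w'
      ext y
      obtain ⟨z, rfl⟩ := VExt.mk_surjective _ _ _ y
      change VExt.mk _ _ _ (vComp _ (w + w') z) =
        VExt.mk _ _ _ (vComp _ w z) + VExt.mk _ _ _ (vComp _ w' z)
      rw [← map_add]
      congr 1
      exact Subtype.ext (Cochain.add_comp w.1 w'.1 z.1 (by rw [add_comm, h]))))
    (by
      intro w hw
      ext y
      obtain ⟨z, rfl⟩ := VExt.mk_surjective _ _ _ y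
      exact vComp_left _ w z hw))

theorem yoneda_mk {K L M : CochainComplex C ℤ} {m n r : ℤ} (h : n + m = r)
    (z : vCocycles L M n) (w : vCocycles K L m) :
    yoneda K L M h (VExt.mk _ _ _ z) (VExt.mk _ _ _ w) =
      VExt.mk _ _ _ (vComp (by rw [add_comm, h]) w z) := rfl

/-- The pairs `(x, y)` such that `x` is the class of `z`, where `z` lifts to a cochain `l` with
values in `L₂`, and `y` is the class of `w`, where `w ≫ φ` is equal to the differential of `l` up
to bounded cochains. -/
def vConnRel (K : CochainComplex C ℤ) {L₁ L₂ L₃ : CochainComplex C ℤ} (φ : L₁ ⟶ L₂) (ψ : L₂ ⟶ L₃)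
    (n n' : ℤ) : AddSubgroup (VExt K L₃ n × VExt K L₁ n') where
  carrier := {x | ∃ (z : vCocycles K L₃ n) (w : vCocycles K L₁ n') (l : Cochain K L₂ n),
    x.1 = VExt.mk _ _ _ z ∧ x.2 = VExt.mk _ _ _ w ∧
      l.comp (Cochain.ofHom ψ) (add_zero n) = z.1 ∧
      δ n n' l - w.1.comp (Cochain.ofHom φ) (add_zero n') ∈ bdd K L₂ n'}
  zero_mem' := ⟨0, 0, 0, by simp, by simp, by simp, by simp⟩
  add_mem' := by
    rintro _ _ ⟨z, w, l, h1, h2, h3, h4⟩ ⟨z', w', l', h1', h2', h3', h4'⟩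
    refine ⟨z + z', w + w', l + l', by simp [h1, h1'], by simp [h2, h2'], by simp [h3, h3'], ?_⟩
    have := add_mem h4 h4'
    rw [sub_add_sub_comm] at this
    simpa using this
  neg_mem' := by
    rintro _ ⟨z, w, l, h1, h2, h3, h4⟩
    refine ⟨-z, -w, -l, by simp [h1], by simp [h2], by simp [h3], ?_⟩
    have := neg_mem h4
    rw [neg_sub'] at this
    simpa using this

end Vogel

section VogelConn

open CochainComplex.HomComplex

variable {C : Type u} [Category.{v} C] [Abelian C] (K : CochainComplex C ℤ)
  {L₁ L₂ L₃ : CochainComplex C ℤ} {φ : L₁ ⟶ L₂} {ψ : L₂ ⟶ L₃} {zero : ∀ p, φ.f p ≫ ψ.f p = 0}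

theorem exists_vLift [∀ p, Projective (K.X p)]
    (hL : ∀ p, (ShortComplex.mk (φ.f p) (ψ.f p) (zero p)).ShortExact) {n : ℤ}
    (z : Cochain K L₃ n) : ∃ l : Cochain K L₂ n, l.comp (Cochain.ofHom ψ) (add_zero n) = z := by
  have : ∀ p, Epi (ψ.f p) := fun p => (hL p).epi_g
  refine ⟨Cochain.mk fun p q hpq => Projective.factorThru (z.v p q hpq) (ψ.f q), ?_⟩
  ext p q hpq
  simp

theorem exists_vLift_bdd (hL : ∀ p, (ShortComplex.mk (φ.f p) (ψ.f p) (zero p)).ShortExact) {n : ℤ}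
    {y : Cochain K L₂ n} (hy : y.comp (Cochain.ofHom ψ) (add_zero n) ∈ bdd K L₃ n) :
    ∃ w : Cochain K L₁ n, y - w.comp (Cochain.ofHom φ) (add_zero n) ∈ bdd K L₂ n := by
  classical
  obtain ⟨s, hs, h⟩ := exists_of_mem_bdd hy
  have lift_ex : ∀ p q (hpq : p + n = q), y.v p q hpq ≫ ψ.f q = 0 →
      ∃ w, w ≫ φ.f q = y.v p q hpq := fun p q hpq hp => by
    have : Mono (ShortComplex.mk (φ.f q) (ψ.f q) (zero q)).f := (hL q).mono_f
    exact ⟨(hL q).exact.lift _ hp, (hL q).exact.lift_f _ _⟩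
  refine ⟨Cochain.mk fun p q hpq => if hp : y.v p q hpq ≫ ψ.f q = 0 then
    (lift_ex p q hpq hp).choose else 0, mem_bdd hs fun p q hpq hp => ?_⟩
  have h0 : y.v p q hpq ≫ ψ.f q = 0 := by
    rw [← h p q hpq hp]
    simp
  have h1 := (lift_ex p q hpq h0).choose_spec
  rw [Cochain.sub_v, Cochain.comp_zero_cochain_v, Cochain.mk_v, dif_pos h0, Cochain.ofHom_v, h1,
    sub_self]

theorem mem_bdd_of_comp (hL : ∀ p, (ShortComplex.mk (φ.f p) (ψ.f p) (zero p)).ShortExact) {n : ℤ}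
    {w : Cochain K L₁ n} (hw : w.comp (Cochain.ofHom φ) (add_zero n) ∈ bdd K L₂ n) :
    w ∈ bdd K L₁ n := by
  have : ∀ p, Mono (φ.f p) := fun p => (hL p).mono_f
  obtain ⟨s, hs, h⟩ := exists_of_mem_bdd hw
  refine mem_bdd hs fun p q hpq hp => ?_
  rw [← cancel_mono (φ.f q), zero_comp, ← h p q hpq hp]
  simp

theorem vConnRel_tot [∀ p, Projective (K.X p)]
    (hL : ∀ p, (ShortComplex.mk (φ.f p) (ψ.f p) (zero p)).ShortExact) {n n' : ℤ} (hn : n + 1 = n')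
    (x : VExt K L₃ n) : ∃ y, (x, y) ∈ vConnRel K φ ψ n n' := by
  obtain ⟨z, rfl⟩ := VExt.mk_surjective _ _ _ x
  obtain ⟨l, hl⟩ := exists_vLift K hL z.1
  obtain ⟨w, hw⟩ := exists_vLift_bdd K hL (y := δ n n' l) (by
    rw [← δ_comp_ofHom, hl]
    exact (mem_vCocycles hn _).1 z.2)
  refine ⟨VExt.mk _ _ _ ⟨w, ?_⟩, z, ⟨w, ?_⟩, l, rfl, rfl, hl, hw⟩
  all_goals
    rw [mem_vCocycles rfl]
    refine mem_bdd_of_comp K hL ?_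
    have := δ_mem_bdd (n' := n' + 1) rfl hw
    rw [δ_sub, δ_δ, zero_sub, δ_comp_ofHom] at this
    simpa using neg_mem this

theorem vConnRel_single [∀ p, Projective (K.X p)]
    (hL : ∀ p, (ShortComplex.mk (φ.f p) (ψ.f p) (zero p)).ShortExact) {n n' : ℤ} (hn : n + 1 = n')
    (y : VExt K L₁ n') (h : (0, y) ∈ vConnRel K φ ψ n n') : y = 0 := by
  obtain ⟨z, w, l, h1, h2, h3, h4⟩ := h
  dsimp only at h1 h2
  subst h2
  rw [eq_comm, VExt.mk_eq_zero, mem_vCoboundaries (sub_add_cancel n 1)] at h1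
  obtain ⟨v, hv⟩ := h1
  obtain ⟨t, ht⟩ := exists_vLift K hL v
  obtain ⟨s, hs⟩ := exists_vLift_bdd K hL (y := l - δ (n - 1) n t) (by
    rw [Cochain.sub_comp, h3, ← δ_comp_ofHom, ht]
    exact hv)
  rw [VExt.mk_eq_zero, mem_vCoboundaries hn]
  refine ⟨s, mem_bdd_of_comp K hL ?_⟩
  have := δ_mem_bdd hn hs
  rw [δ_sub, δ_sub, δ_δ, sub_zero, δ_comp_ofHom] at this
  have h5 := sub_mem this h4
  rw [Cochain.sub_comp]
  simpa using h5

/-- The connecting homomorphism `Êxt^n(F, J) → Êxt^(n+1)(F, J'')` that is induced by the short exact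
sequence of Vogel complexes of a short exact sequence of projective resolutions. -/
noncomputable def vConn [∀ p, Projective (K.X p)]
    (hL : ∀ p, (ShortComplex.mk (φ.f p) (ψ.f p) (zero p)).ShortExact) {n n' : ℤ}
    (hn : n + 1 = n') : VExt K L₃ n →+ VExt K L₁ n' :=
  homOfRel (vConnRel K φ ψ n n') (vConnRel_tot K hL hn) (vConnRel_single K hL hn)

end VogelConn

end CompletedExt

/-!
The compatibilities of external and cup products reduce to sign computations at a finite stage, once
one knows that the connecting homomorphism on completed Ext-groups does not depend on the resolution
of the middle term. The one for Yoneda products holds on the level of cochains.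

*External products.* Two classes are represented at a common stage `k`, where the claim is the
compatibility of the external product of ordinary Ext-groups with connecting homomorphisms. The
product is placed at the even stage `2 * k`, so that `connHat` of the product carries no sign,
whereas `connHat` of the factor carries `(-1)^k`; this is compensated by `altSign_succ` in the
first variable, and by the sign `(-1)^(m + k)` of the product of cochains in the second one. The
stagewise argument uses the row `0 → B̃''_k ⊗ Ẽ_k → B̃'_k ⊗ Ẽ_k → B̃_k ⊗ Ẽ_k → 0`, while `connHat`
is defined by an arbitrary resolution `𝓦` of the middle term `B' ⊗ E`. The two agree since the
syzygies of `𝓦` map to the alternating tensor products of the middle pair of resolutions, with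
identities on the outer terms (`AltSES.exists_hom`, by induction from `exists_syz_hom`), and such
morphisms do not change connecting homomorphisms (`conn_eq_of_hom`). The terms of the middle
tensor products need not be projective here.

*Cup products.* An exact functor `U` that preserves projectives carries a projective resolution of
`R` to a resolution of the projective object `U R`, which therefore has a contracting homotopy.
Two such homotopies give one of `U (R₁ ⊗ R₂)` over `U (R ⊗ R)` (`exists_tensorCx_contraction`),
and `U` reflects quasi-isomorphisms because it is exact and faithful. The cup product is an
external product followed by a precomposition, which commutes with connecting homomorphisms
(`precompHat_connHat`).

*Yoneda products.* If a cochain `l` lifts a cocycle representing `y` and `v` represents `x`, then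
`v ≫ l` lifts a representative of `y ∘ x`, and `δ (v ≫ l)` differs from `v ≫ δ l` only by
`± δ v ≫ l`, which has finitely many nonzero components (`yoneda_vConn`).
-/

namespace CompletedExt

/-! ### Independence of connecting homomorphisms from the middle resolution -/

section Comparison

variable {C : Type u} [Category.{v} C] [Abelian C]

/-- Two extensions that are related by a morphism with identities on the outer terms have the same
connecting homomorphism. -/
theorem conn_eq_of_hom (K : ChainComplex C ℕ) [∀ q, Projective (K.X q)] {X Y Y' Z : C}
    {f : X ⟶ Y} {g : Y ⟶ Z} {hfg : f ≫ g = 0} {f' : X ⟶ Y'} {g' : Y' ⟶ Z} {hfg' : f' ≫ g' = 0}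
    (hS : (ShortComplex.mk f g hfg).ShortExact) (hS' : (ShortComplex.mk f' g' hfg').ShortExact)
    (θ : Y ⟶ Y') (hf : f ≫ θ = f') (hg : θ ≫ g' = g) {p p' : ℤ} (hp : p + 1 = p')
    (x : ExtGrp K Z p) : conn K hS hp x = conn K hS' hp x := by
  have : Epi g := hS.epi_g
  obtain ⟨z, rfl⟩ := ExtGrp.mk_surjective _ _ _ x
  obtain ⟨l, hl, hlz⟩ := exists_lift K g z.1 z.2.1
  obtain ⟨w, hw, hw'⟩ := conn_of_lift K hS hp z l hl hlz
  rw [hw']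
  refine (conn_eq K hS' hp z w _ (comp_mem_homDeg θ hl) (fun q => ?_) (fun q => ?_)).symm
  · rw [Category.assoc, hg, hlz]
  · rw [← hf, ← Category.assoc, hw, ← coD_comp, Units.smul_def, Units.smul_def,
      Preadditive.zsmul_comp]

/-- The inductive step of the comparison of two resolutions of the middle term of a short exact
sequence. The rows `0 → X₁ → X₂ → X₃ → 0` are short exact sequences of syzygies, `P` denotes the
projective terms that cover them and `Z` the next syzygies. A morphism `θ` between the two middle
syzygies that is the identity on the outer ones is lifted to the terms and restricted to the next
syzygies. Only the outer term `P₃` has to be projective, since then the row of the terms `P` splits;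
the second diagram need not even have projective terms. -/
theorem exists_syz_hom {X₁ X₂ X₃ P₁ P₂ P₃ Z₁ Z₂ Z₃ X₂' P₂' Z₂' : C} [Projective P₃]
    {i₁ : Z₁ ⟶ P₁} {π₁ : P₁ ⟶ X₁} {i₂ : Z₂ ⟶ P₂} {π₂ : P₂ ⟶ X₂} {i₃ : Z₃ ⟶ P₃} {π₃ : P₃ ⟶ X₃}
    {i₂' : Z₂' ⟶ P₂'} {π₂' : P₂' ⟶ X₂'}
    {f : X₁ ⟶ X₂} {g : X₂ ⟶ X₃} {F : P₁ ⟶ P₂} {G : P₂ ⟶ P₃} {fZ : Z₁ ⟶ Z₂} {gZ : Z₂ ⟶ Z₃}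
    {f' : X₁ ⟶ X₂'} {g' : X₂' ⟶ X₃} {F' : P₁ ⟶ P₂'} {G' : P₂' ⟶ P₃} {fZ' : Z₁ ⟶ Z₂'}
    {gZ' : Z₂' ⟶ Z₃} {z₂ : i₂ ≫ π₂ = 0} {z₂' : i₂' ≫ π₂' = 0} {zF : F ≫ G = 0}
    {zf' : f' ≫ g' = 0} (hπ₁ : Epi π₁) (hi₃ : Mono i₃)
    (hP : (ShortComplex.mk F G zF).ShortExact)
    (h₂' : (ShortComplex.mk i₂' π₂' z₂').ShortExact)
    (hX' : (ShortComplex.mk f' g' zf').ShortExact) (hG' : Epi G') (zF' : F' ≫ G' = 0)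
    (e₁ : π₁ ≫ f = F ≫ π₂) (e₂ : π₂ ≫ g = G ≫ π₃) (e₃ : i₁ ≫ F = fZ ≫ i₂)
    (e₄ : i₂ ≫ G = gZ ≫ i₃)
    (e₁' : π₁ ≫ f' = F' ≫ π₂') (e₂' : π₂' ≫ g' = G' ≫ π₃) (e₃' : i₁ ≫ F' = fZ' ≫ i₂')
    (e₄' : i₂' ≫ G' = gZ' ≫ i₃) (θ : X₂ ⟶ X₂') (hf : f ≫ θ = f') (hg : θ ≫ g' = g) :
    ∃ θZ : Z₂ ⟶ Z₂', fZ ≫ θZ = fZ' ∧ θZ ≫ gZ' = gZ := by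
  have : Mono (ShortComplex.mk i₂' π₂' z₂').f := h₂'.mono_f
  have : Mono (ShortComplex.mk f' g' zf').f := hX'.mono_f
  have : Mono i₂' := h₂'.mono_f
  have : Epi G := hP.epi_g
  let sp := hP.splittingOfProjective
  -- a section `t` of `G'` over `θ`
  obtain ⟨t, ht, ht'⟩ : ∃ t : P₃ ⟶ P₂', t ≫ G' = 𝟙 P₃ ∧ t ≫ π₂' = sp.s ≫ π₂ ≫ θ := by
    let t₀ : P₃ ⟶ P₂' := Projective.factorThru (𝟙 P₃) G'
    have ht₀ : t₀ ≫ G' = 𝟙 P₃ := Projective.factorThru_comp _ _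
    have hs : sp.s ≫ G = 𝟙 P₃ := sp.s_g
    let w : P₃ ⟶ X₁ := hX'.exact.lift (sp.s ≫ π₂ ≫ θ - t₀ ≫ π₂') (by
      change (_ - _) ≫ g' = 0
      rw [Preadditive.sub_comp, Category.assoc, Category.assoc, hg, Category.assoc, e₂, e₂',
        ← Category.assoc, hs, ← Category.assoc, ht₀, sub_self])
    have hw : w ≫ f' = sp.s ≫ π₂ ≫ θ - t₀ ≫ π₂' := hX'.exact.lift_f _ _
    refine ⟨t₀ + Projective.factorThru w π₁ ≫ F', ?_, ?_⟩
    · rw [Preadditive.add_comp, Category.assoc, zF', comp_zero, add_zero, ht₀]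
    · rw [Preadditive.add_comp, Category.assoc, ← e₁', ← Category.assoc,
        Projective.factorThru_comp, hw, add_sub_cancel]
  have hFr : F ≫ sp.r = 𝟙 P₁ := sp.f_r
  have hid : sp.r ≫ F + G ≫ sp.s = 𝟙 P₂ := sp.id
  let Θ : P₂ ⟶ P₂' := sp.r ≫ F' + G ≫ t
  have hFΘ : F ≫ Θ = F' := by
    rw [Preadditive.comp_add, ← Category.assoc, hFr, Category.id_comp, ← Category.assoc, zF,
      zero_comp, add_zero]
  have hΘG : Θ ≫ G' = G := by
    rw [Preadditive.add_comp, Category.assoc, zF', comp_zero, zero_add, Category.assoc, ht,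
      Category.comp_id]
  have hΘπ : Θ ≫ π₂' = π₂ ≫ θ := by
    have h := congrArg (· ≫ π₂ ≫ θ) hid
    simp only [Preadditive.add_comp, Category.assoc, Category.id_comp] at h
    rw [Preadditive.add_comp, Category.assoc, Category.assoc, ← e₁', ht', ← hf,
      ← Category.assoc π₁, e₁, Category.assoc, h]
  let θZ : Z₂ ⟶ Z₂' := h₂'.exact.lift (i₂ ≫ Θ) (by
    change (i₂ ≫ Θ) ≫ π₂' = 0
    rw [Category.assoc, hΘπ, ← Category.assoc, z₂, zero_comp])
  have hθZ : θZ ≫ i₂' = i₂ ≫ Θ := h₂'.exact.lift_f _ _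
  refine ⟨θZ, ?_, ?_⟩
  · rw [← cancel_mono i₂', Category.assoc, hθZ, ← Category.assoc, ← e₃, Category.assoc, hFΘ, e₃']
  · rw [← cancel_mono i₃, Category.assoc, ← e₄', ← Category.assoc, hθZ, Category.assoc, hΘG, e₄]

end Comparison

/-! ### Alternating tensor products of short exact sequences of resolutions -/

universe w w'

theorem SeqColim.exists_of_of {G : ℕ → Type w} [∀ k, AddCommGroup (G k)]
    (f : ∀ k, G k →+ G (k + 1)) {G' : ℕ → Type w'} [∀ k, AddCommGroup (G' k)]
    (f' : ∀ k, G' k →+ G' (k + 1)) (x : SeqColim f) (y : SeqColim f') :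
    ∃ k a b, x = SeqColim.of f k a ∧ y = SeqColim.of f' k b := by
  obtain ⟨i, a, rfl⟩ := SeqColim.exists_of f x
  obtain ⟨j, b, rfl⟩ := SeqColim.exists_of f' y
  exact ⟨max i j, _, _, (SeqColim.of_seqMap f i _ (le_max_left i j) a).symm,
    (SeqColim.of_seqMap f' j _ (le_max_right i j) b).symm⟩

section Alternating

variable {C : Type u} [Category.{v} C] [Abelian C] (T : C ⥤ C ⥤ C) [T.Additive]
  [∀ X, (T.obj X).Additive]

section

variable {B B' E E' : C} {𝓑 : SyzRes B} {𝓑' : SyzRes B'} {𝓔 : SyzRes E} {𝓔' : SyzRes E'}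

/-- The morphisms between the objects `B̃_0 ⊗ Ẽ_0, B̃_1 ⊗ Ẽ_0, B̃_1 ⊗ Ẽ_1, …` of two pairs of
resolutions that are induced by morphisms of the syzygies. -/
def altMap (φ : ∀ k, 𝓑.syz k ⟶ 𝓑'.syz k) (ψ : ∀ k, 𝓔.syz k ⟶ 𝓔'.syz k) :
    ∀ s, altObj T 𝓑 𝓔 s ⟶ altObj T 𝓑' 𝓔' s
  | (i, false) => tensorHom T (φ i) (ψ i)
  | (i, true) => tensorHom T (φ (i + 1)) (ψ i)

/-- The morphisms between the objects `B_0 ⊗ Ẽ_0, B̃_1 ⊗ E_0, B_1 ⊗ Ẽ_1, …` of two pairs of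
resolutions that are induced by morphisms of the syzygies and of the terms. -/
def altTermMap (φ : ∀ k, 𝓑.syz k ⟶ 𝓑'.syz k) (Φ : ∀ k, 𝓑.P k ⟶ 𝓑'.P k)
    (ψ : ∀ k, 𝓔.syz k ⟶ 𝓔'.syz k) (Ψ : ∀ k, 𝓔.P k ⟶ 𝓔'.P k) :
    ∀ s, altTerm T 𝓑 𝓔 s ⟶ altTerm T 𝓑' 𝓔' s
  | (i, false) => tensorHom T (Φ i) (ψ i)
  | (i, true) => tensorHom T (φ (i + 1)) (Ψ i)

variable {φ : ∀ k, 𝓑.syz k ⟶ 𝓑'.syz k} {Φ : ∀ k, 𝓑.P k ⟶ 𝓑'.P k}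
  {ψ : ∀ k, 𝓔.syz k ⟶ 𝓔'.syz k} {Ψ : ∀ k, 𝓔.P k ⟶ 𝓔'.P k}

theorem altPr_map (hφ : ∀ k, 𝓑.pr k ≫ φ k = Φ k ≫ 𝓑'.pr k)
    (hψ : ∀ k, 𝓔.pr k ≫ ψ k = Ψ k ≫ 𝓔'.pr k) :
    ∀ s, altPr T 𝓑 𝓔 s ≫ altMap T φ ψ s = altTermMap T φ Φ ψ Ψ s ≫ altPr T 𝓑' 𝓔' s
  | (i, false) => by
    change tensorHom T _ _ ≫ tensorHom T _ _ = tensorHom T _ _ ≫ tensorHom T _ _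
    rw [← tensorHom_comp, ← tensorHom_comp, hφ, Category.id_comp, Category.comp_id]
  | (i, true) => by
    change tensorHom T _ _ ≫ tensorHom T _ _ = tensorHom T _ _ ≫ tensorHom T _ _
    rw [← tensorHom_comp, ← tensorHom_comp, hψ, Category.id_comp, Category.comp_id]

theorem altInc_map (hφ : ∀ k, 𝓑.inc k ≫ Φ k = φ (k + 1) ≫ 𝓑'.inc k)
    (hψ : ∀ k, 𝓔.inc k ≫ Ψ k = ψ (k + 1) ≫ 𝓔'.inc k) :
    ∀ s, altInc T 𝓑 𝓔 s ≫ altTermMap T φ Φ ψ Ψ s = altMap T φ ψ (altNext s) ≫ altInc T 𝓑' 𝓔' s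
  | (i, false) => by
    change tensorHom T _ _ ≫ tensorHom T _ _ = tensorHom T _ _ ≫ tensorHom T _ _
    rw [← tensorHom_comp, ← tensorHom_comp, hφ, Category.id_comp, Category.comp_id]
  | (i, true) => by
    change tensorHom T _ _ ≫ tensorHom T _ _ = tensorHom T _ _ ≫ tensorHom T _ _
    rw [← tensorHom_comp, ← tensorHom_comp, hψ, Category.id_comp, Category.comp_id]

end

/-- A short exact sequence of pairs of resolutions whose alternating tensor products form short
exact rows: the syzygies `B̃_0 ⊗ Ẽ_0, B̃_1 ⊗ Ẽ_0, B̃_1 ⊗ Ẽ_1, …` of the middle pair are linked by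
short exact sequences, although its terms `B_0 ⊗ Ẽ_0, B̃_1 ⊗ E_0, …` need not be projective. It
covers the short exact sequences in the first variable (where the second resolution is constant) and
those in the second variable. -/
structure AltSES {B₁ B₂ B₃ E₁ E₂ E₃ : C} (𝓑₁ : SyzRes B₁) (𝓑₂ : SyzRes B₂) (𝓑₃ : SyzRes B₃)
    (𝓔₁ : SyzRes E₁) (𝓔₂ : SyzRes E₂) (𝓔₃ : SyzRes E₃) where
  φ (k : ℕ) : 𝓑₁.syz k ⟶ 𝓑₂.syz k
  φ' (k : ℕ) : 𝓑₂.syz k ⟶ 𝓑₃.syz k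
  Φ (k : ℕ) : 𝓑₁.P k ⟶ 𝓑₂.P k
  Φ' (k : ℕ) : 𝓑₂.P k ⟶ 𝓑₃.P k
  ψ (k : ℕ) : 𝓔₁.syz k ⟶ 𝓔₂.syz k
  ψ' (k : ℕ) : 𝓔₂.syz k ⟶ 𝓔₃.syz k
  Ψ (k : ℕ) : 𝓔₁.P k ⟶ 𝓔₂.P k
  Ψ' (k : ℕ) : 𝓔₂.P k ⟶ 𝓔₃.P k
  pr_φ (k : ℕ) : 𝓑₁.pr k ≫ φ k = Φ k ≫ 𝓑₂.pr k
  pr_φ' (k : ℕ) : 𝓑₂.pr k ≫ φ' k = Φ' k ≫ 𝓑₃.pr k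
  inc_Φ (k : ℕ) : 𝓑₁.inc k ≫ Φ k = φ (k + 1) ≫ 𝓑₂.inc k
  inc_Φ' (k : ℕ) : 𝓑₂.inc k ≫ Φ' k = φ' (k + 1) ≫ 𝓑₃.inc k
  pr_ψ (k : ℕ) : 𝓔₁.pr k ≫ ψ k = Ψ k ≫ 𝓔₂.pr k
  pr_ψ' (k : ℕ) : 𝓔₂.pr k ≫ ψ' k = Ψ' k ≫ 𝓔₃.pr k
  inc_Ψ (k : ℕ) : 𝓔₁.inc k ≫ Ψ k = ψ (k + 1) ≫ 𝓔₂.inc k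
  inc_Ψ' (k : ℕ) : 𝓔₂.inc k ≫ Ψ' k = ψ' (k + 1) ≫ 𝓔₃.inc k
  row (s : ℕ × Bool) : ∃ h : altMap T φ ψ s ≫ altMap T φ' ψ' s = 0,
    (ShortComplex.mk (altMap T φ ψ s) (altMap T φ' ψ' s) h).ShortExact
  column (s : ℕ × Bool) : ∃ h : altInc T 𝓑₂ 𝓔₂ s ≫ altPr T 𝓑₂ 𝓔₂ s = 0,
    (ShortComplex.mk (altInc T 𝓑₂ 𝓔₂ s) (altPr T 𝓑₂ 𝓔₂ s) h).ShortExact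
  term_zero (s : ℕ × Bool) : altTermMap T φ Φ ψ Ψ s ≫ altTermMap T φ' Φ' ψ' Ψ' s = 0

variable {T} {B₁ B₂ B₃ E₁ E₂ E₃ : C}
  {𝓑₁ : SyzRes B₁} {𝓑₂ : SyzRes B₂} {𝓑₃ : SyzRes B₃}
  {𝓔₁ : SyzRes E₁} {𝓔₂ : SyzRes E₂} {𝓔₃ : SyzRes E₃}
  (h₁ : GoodRes T 𝓑₁) (h₃ : GoodRes T 𝓑₃) (g₁ : GoodRes T 𝓔₁) (g₃ : GoodRes T 𝓔₃)
  (A : AltSES T 𝓑₁ 𝓑₂ 𝓑₃ 𝓔₁ 𝓔₂ 𝓔₃)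

namespace AltSES

/-- The morphisms from the syzygies of `tensorRes T h₁ g₁` to those of the middle pair. -/
def f : ∀ j, (tensorRes T h₁ g₁).syz j ⟶ altObj T 𝓑₂ 𝓔₂ (altIdx j)
  | 0 => altMap T A.φ A.ψ (altIdx 0)
  | j + 1 => altMap T A.φ A.ψ (altIdx (j + 1))

/-- The morphisms from the syzygies of the middle pair to those of `tensorRes T h₃ g₃`. -/
def g : ∀ j, altObj T 𝓑₂ 𝓔₂ (altIdx j) ⟶ (tensorRes T h₃ g₃).syz j
  | 0 => altMap T A.φ' A.ψ' (altIdx 0)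
  | j + 1 => altMap T A.φ' A.ψ' (altIdx (j + 1))

theorem f_g : ∀ j, ∃ h : A.f h₁ g₁ j ≫ A.g h₃ g₃ j = 0,
    (ShortComplex.mk (A.f h₁ g₁ j) (A.g h₃ g₃ j) h).ShortExact
  | 0 => A.row (altIdx 0)
  | j + 1 => A.row (altIdx (j + 1))

theorem pr_f : ∀ j, (tensorRes T h₁ g₁).pr j ≫ A.f h₁ g₁ j =
    altTermMap T A.φ A.Φ A.ψ A.Ψ (altIdx j) ≫ altPr T 𝓑₂ 𝓔₂ (altIdx j)
  | 0 => altPr_map T A.pr_φ A.pr_ψ (altIdx 0)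
  | j + 1 => altPr_map T A.pr_φ A.pr_ψ (altIdx (j + 1))

theorem pr_g : ∀ j, altPr T 𝓑₂ 𝓔₂ (altIdx j) ≫ A.g h₃ g₃ j =
    altTermMap T A.φ' A.Φ' A.ψ' A.Ψ' (altIdx j) ≫ (tensorRes T h₃ g₃).pr j
  | 0 => altPr_map T A.pr_φ' A.pr_ψ' (altIdx 0)
  | j + 1 => altPr_map T A.pr_φ' A.pr_ψ' (altIdx (j + 1))

/-- The four lemma, applied to the columns of the middle and the right pair. -/
theorem epi_termMap (h₃ : GoodRes T 𝓑₃) (g₃ : GoodRes T 𝓔₃) (s : ℕ × Bool) :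
    Epi (altTermMap T A.φ' A.Φ' A.ψ' A.Ψ' s) := by
  let τ : ShortComplex.mk _ _ (A.column s).1 ⟶ ShortComplex.mk _ _ (alt_exact T h₃ g₃ s).1 :=
    { τ₁ := altMap T A.φ' A.ψ' (altNext s)
      τ₂ := altTermMap T A.φ' A.Φ' A.ψ' A.Ψ' s
      τ₃ := altMap T A.φ' A.ψ' s
      comm₁₂ := (altInc_map T A.inc_Φ' A.inc_Ψ' s).symm
      comm₂₃ := (altPr_map T A.pr_φ' A.pr_ψ' s).symm }
  have : Epi τ.τ₁ := (A.row (altNext s)).2.epi_g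
  have : Epi τ.τ₃ := (A.row s).2.epi_g
  have : Epi (ShortComplex.mk _ _ (A.column s).1).g := (A.column s).2.epi_g
  have : Epi (ShortComplex.mk _ _ (alt_exact T h₃ g₃ s).1).g := (alt_exact T h₃ g₃ s).2.epi_g
  exact ShortComplex.epi_τ₂_of_exact_of_epi τ (alt_exact T h₃ g₃ s).2.exact

variable {u : (T.obj B₁).obj E₁ ⟶ (T.obj B₂).obj E₂} {v : (T.obj B₂).obj E₂ ⟶ (T.obj B₃).obj E₃}
  {huv : u ≫ v = 0} {𝓦 : SyzRes ((T.obj B₂).obj E₂)}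
  (H : ResSES (ShortComplex.mk u v huv) (tensorRes T h₁ g₁) 𝓦 (tensorRes T h₃ g₃))

/-- Any resolution `𝓦` of the middle term maps to the alternating tensor products of the middle
pair. -/
theorem exists_hom (hu : u = altMap T A.φ A.ψ (0, false)) (hv : v = altMap T A.φ' A.ψ' (0, false))
    (j : ℕ) : ∃ θ : 𝓦.syz j ⟶ altObj T 𝓑₂ 𝓔₂ (altIdx j),
      H.f j ≫ θ = A.f h₁ g₁ j ∧ θ ≫ A.g h₃ g₃ j = H.g j := by
  induction j with
  | zero =>
    refine ⟨𝟙 _, ?_, ?_⟩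
    · exact (Category.comp_id _).trans (H.f_zero.trans hu)
    · exact (Category.id_comp _).trans (hv.symm.trans H.g_zero.symm)
  | succ j ih =>
    obtain ⟨θ, hf, hg⟩ := ih
    have : Projective ((tensorRes T h₃ g₃).P j) := (tensorRes T h₃ g₃).projective j
    exact exists_syz_hom (z₂ := 𝓦.inc_pr j) ((tensorRes T h₁ g₁).ses j).epi_g
      ((tensorRes T h₃ g₃).ses j).mono_f
      (H.P_exact j) (A.column (altIdx j)).2 (A.f_g h₁ h₃ g₁ g₃ j).2
      (A.epi_termMap h₃ g₃ (altIdx j)) (A.term_zero (altIdx j)) (H.pr_f j) (H.pr_g j) (H.inc_F j)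
      (H.inc_G j) (A.pr_f h₁ g₁ j) (A.pr_g h₃ g₃ j) (altInc_map T A.inc_Φ A.inc_Ψ (altIdx j))
      (altInc_map T A.inc_Φ' A.inc_Ψ' (altIdx j)) θ hf hg

/-- The connecting homomorphism on completed Ext-groups does not depend on the resolution of the
middle term: it can be computed from the alternating tensor products of the middle pair. -/
theorem connHat_ofAlt (M : ChainComplex C ℕ) [∀ q, Projective (M.X q)]
    (hu : u = altMap T A.φ A.ψ (0, false)) (hv : v = altMap T A.φ' A.ψ' (0, false)) {n n' : ℤ}
    (hn : n + 1 = n') (j : ℕ) (s : ℕ × Bool) (hs : altIdx j = s) (d d' : ℤ) (hd : n + j = d)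
    (hd' : n' + j = d') (h : d + 1 = d') (x : ExtGrp M (altObj T 𝓑₃ 𝓔₃ s) d) :
    connHat M H hn (ofAlt T M h₃ g₃ n j s hs d hd x) =
      (j : ℤ).negOnePow • ofAlt T M h₁ g₁ n' j s hs d' hd' (conn M (A.row s).2 h x) := by
  subst hs hd hd'
  obtain ⟨θ, hf, hg⟩ := A.exists_hom h₁ h₃ g₁ g₃ H hu hv j
  rcases j with _ | j
  · refine (connHat_of M H hn 0 x).trans ?_
    exact congrArg (fun w => ((0 : ℕ) : ℤ).negOnePow •
      SeqColim.of (extStep M (tensorRes T h₁ g₁) n') 0 w)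
      (conn_eq_of_hom M (H.syz_exact 0) (A.f_g h₁ h₃ g₁ g₃ 0).2 θ hf hg h x)
  · refine (connHat_of M H hn (j + 1) x).trans ?_
    exact congrArg (fun w => ((j + 1 : ℕ) : ℤ).negOnePow •
      SeqColim.of (extStep M (tensorRes T h₁ g₁) n') (j + 1) w)
      (conn_eq_of_hom M (H.syz_exact (j + 1)) (A.f_g h₁ h₃ g₁ g₃ (j + 1)).2 θ hf hg h x)

theorem connHat_ofAlt_two_mul (M : ChainComplex C ℕ) [∀ q, Projective (M.X q)]
    (hu : u = altMap T A.φ A.ψ (0, false)) (hv : v = altMap T A.φ' A.ψ' (0, false)) {n n' : ℤ}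
    (hn : n + 1 = n') (k : ℕ) (s : ℤˣ)
    (x : ExtGrp M (altObj T 𝓑₃ 𝓔₃ (k, false)) (n + (2 * k : ℕ))) :
    connHat M H hn (s • ofAlt T M h₃ g₃ n (2 * k) (k, false) (altIdx_two_mul k) _ rfl x) =
      s • ofAlt T M h₁ g₁ n' (2 * k) (k, false) (altIdx_two_mul k) _ rfl
        (conn M (A.row (k, false)).2 (by rw [← hn]; ring) x) := by
  have hk : ((2 * k : ℕ) : ℤ).negOnePow = 1 := by
    push_cast
    exact Int.negOnePow_two_mul _
  rw [map_units_smul, A.connHat_ofAlt h₁ h₃ g₁ g₃ H M hu hv hn (2 * k) (k, false)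
    (altIdx_two_mul k) _ _ rfl rfl (by rw [← hn]; ring), hk, one_smul]

end AltSES

/-- A short exact sequence of resolutions in the first variable. -/
def ResSES.altLeft {S : ShortComplex C} {𝓑₁ : SyzRes S.X₁} {𝓑₂ : SyzRes S.X₂}
    {𝓑₃ : SyzRes S.X₃} (H : ResSES S 𝓑₁ 𝓑₂ 𝓑₃) {E : C} {𝓔 : SyzRes E} (hE : GoodRes T 𝓔)
    (h₂ : ∀ k, PreservesFiniteLimits (T.obj (𝓑₂.syz k)) ∧
      PreservesFiniteColimits (T.obj (𝓑₂.syz k))) : AltSES T 𝓑₁ 𝓑₂ 𝓑₃ 𝓔 𝓔 𝓔 where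
  φ := H.f
  φ' := H.g
  Φ := H.F
  Φ' := H.G
  ψ _ := 𝟙 _
  ψ' _ := 𝟙 _
  Ψ _ := 𝟙 _
  Ψ' _ := 𝟙 _
  pr_φ := H.pr_f
  pr_φ' := H.pr_g
  inc_Φ := H.inc_F
  inc_Φ' := H.inc_G
  pr_ψ _ := by simp
  pr_ψ' _ := by simp
  inc_Ψ _ := by simp
  inc_Ψ' _ := by simp
  row := by
    rintro ⟨i, _ | _⟩
    · exact tensorHom_exact_right T (H.syz_exact i) (hE i).right_lim (hE i).right_colim
    · exact tensorHom_exact_right T (H.syz_exact (i + 1)) (hE i).right_lim (hE i).right_colim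
  column := by
    rintro ⟨i, _ | _⟩
    · exact tensorHom_exact_right T (𝓑₂.ses i) (hE i).right_lim (hE i).right_colim
    · exact tensorHom_exact_left T (𝓔.ses i) (h₂ (i + 1)).1 (h₂ (i + 1)).2
  term_zero := by
    rintro ⟨i, _ | _⟩
    · exact (tensorHom_comp T _ _ _ _).symm.trans (by rw [H.F_G, tensorHom_zero_left]; rfl)
    · exact (tensorHom_comp T _ _ _ _).symm.trans (by rw [H.f_g, tensorHom_zero_left]; rfl)

/-- A short exact sequence of resolutions in the second variable. -/
def ResSES.altRight {S : ShortComplex C} {𝓔₁ : SyzRes S.X₁} {𝓔₂ : SyzRes S.X₂}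
    {𝓔₃ : SyzRes S.X₃} (H : ResSES S 𝓔₁ 𝓔₂ 𝓔₃) {B : C} {𝓑 : SyzRes B} (hB : GoodRes T 𝓑)
    (h₂ : ∀ k, PreservesFiniteLimits (T.flip.obj (𝓔₂.syz k)) ∧
      PreservesFiniteColimits (T.flip.obj (𝓔₂.syz k))) : AltSES T 𝓑 𝓑 𝓑 𝓔₁ 𝓔₂ 𝓔₃ where
  φ _ := 𝟙 _
  φ' _ := 𝟙 _
  Φ _ := 𝟙 _
  Φ' _ := 𝟙 _
  ψ := H.f
  ψ' := H.g
  Ψ := H.F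
  Ψ' := H.G
  pr_φ _ := by simp
  pr_φ' _ := by simp
  inc_Φ _ := by simp
  inc_Φ' _ := by simp
  pr_ψ := H.pr_f
  pr_ψ' := H.pr_g
  inc_Ψ := H.inc_F
  inc_Ψ' := H.inc_G
  row := by
    rintro ⟨i, _ | _⟩
    · exact tensorHom_exact_left T (H.syz_exact i) (hB i).left_lim (hB i).left_colim
    · exact tensorHom_exact_left T (H.syz_exact i) (hB (i + 1)).left_lim (hB (i + 1)).left_colim
  column := by
    rintro ⟨i, _ | _⟩
    · exact tensorHom_exact_right T (𝓑.ses i) (h₂ i).1 (h₂ i).2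
    · exact tensorHom_exact_left T (𝓔₂.ses i) (hB (i + 1)).left_lim (hB (i + 1)).left_colim
  term_zero := by
    rintro ⟨i, _ | _⟩
    · exact (tensorHom_comp T _ _ _ _).symm.trans (by rw [H.f_g, tensorHom_zero_right]; rfl)
    · exact (tensorHom_comp T _ _ _ _).symm.trans (by rw [H.F_G, tensorHom_zero_right]; rfl)

theorem ResSES.altLeft_f_zero {S : ShortComplex C} {𝓑₁ : SyzRes S.X₁} {𝓑₂ : SyzRes S.X₂}
    {𝓑₃ : SyzRes S.X₃} (H : ResSES S 𝓑₁ 𝓑₂ 𝓑₃) {E : C} {𝓔 : SyzRes E} (hE : GoodRes T 𝓔)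
    (h₂ : ∀ k, PreservesFiniteLimits (T.obj (𝓑₂.syz k)) ∧
      PreservesFiniteColimits (T.obj (𝓑₂.syz k))) :
    altMap T (H.altLeft hE h₂).φ (H.altLeft hE h₂).ψ (0, false) = (T.flip.obj E).map S.f := by
  rw [← H.f_zero]
  change tensorHom T (H.f 0) (𝟙 E) = _
  simp [tensorHom]
  rfl

theorem ResSES.altLeft_g_zero {S : ShortComplex C} {𝓑₁ : SyzRes S.X₁} {𝓑₂ : SyzRes S.X₂}
    {𝓑₃ : SyzRes S.X₃} (H : ResSES S 𝓑₁ 𝓑₂ 𝓑₃) {E : C} {𝓔 : SyzRes E} (hE : GoodRes T 𝓔)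
    (h₂ : ∀ k, PreservesFiniteLimits (T.obj (𝓑₂.syz k)) ∧
      PreservesFiniteColimits (T.obj (𝓑₂.syz k))) :
    altMap T (H.altLeft hE h₂).φ' (H.altLeft hE h₂).ψ' (0, false) = (T.flip.obj E).map S.g := by
  rw [← H.g_zero]
  change tensorHom T (H.g 0) (𝟙 E) = _
  simp [tensorHom]
  rfl

theorem ResSES.altRight_f_zero {S : ShortComplex C} {𝓔₁ : SyzRes S.X₁} {𝓔₂ : SyzRes S.X₂}
    {𝓔₃ : SyzRes S.X₃} (H : ResSES S 𝓔₁ 𝓔₂ 𝓔₃) {B : C} {𝓑 : SyzRes B} (hB : GoodRes T 𝓑)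
    (h₂ : ∀ k, PreservesFiniteLimits (T.flip.obj (𝓔₂.syz k)) ∧
      PreservesFiniteColimits (T.flip.obj (𝓔₂.syz k))) :
    altMap T (H.altRight hB h₂).φ (H.altRight hB h₂).ψ (0, false) = (T.obj B).map S.f := by
  rw [← H.f_zero]
  change tensorHom T (𝟙 B) (H.f 0) = _
  simp [tensorHom]
  rfl

theorem ResSES.altRight_g_zero {S : ShortComplex C} {𝓔₁ : SyzRes S.X₁} {𝓔₂ : SyzRes S.X₂}
    {𝓔₃ : SyzRes S.X₃} (H : ResSES S 𝓔₁ 𝓔₂ 𝓔₃) {B : C} {𝓑 : SyzRes B} (hB : GoodRes T 𝓑)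
    (h₂ : ∀ k, PreservesFiniteLimits (T.flip.obj (𝓔₂.syz k)) ∧
      PreservesFiniteColimits (T.flip.obj (𝓔₂.syz k))) :
    altMap T (H.altRight hB h₂).φ' (H.altRight hB h₂).ψ' (0, false) = (T.obj B).map S.g := by
  rw [← H.g_zero]
  change tensorHom T (𝟙 B) (H.g 0) = _
  simp [tensorHom]
  rfl

/-! ### External products and connecting homomorphisms -/

/-- Raising the degree of the first factor by one changes the sign at stage `k` by `(-1)^k`, which
is the sign of `connHat` at stage `k`. -/
theorem altSign_succ {m m' : ℤ} (hm : m + 1 = m') (k : ℕ) :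
    altSign m' k = (k : ℤ).negOnePow * altSign m k := by
  induction k with
  | zero => simp [altSign]
  | succ k ih =>
    rw [altSign, altSign, ih, ← hm]
    rw [show m + 1 + ((k + 1 : ℕ) : ℤ) = m + (k + 1 : ℕ) + 1 by ring, Int.negOnePow_succ,
      Nat.cast_succ k, Int.negOnePow_succ (k : ℤ), mul_neg, neg_mul, mul_assoc]

/-- Both sides are computed at a common stage `k`. There `connHat` contributes `(-1)^k` on the left
and, because the product lives at the even stage `2 * k`, no sign on the right; the former cancels
against the change of `altSign`. -/
theorem extHatProd_connHat_left [TensorProjective T] (K L : ChainComplex C ℕ)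
    [∀ q, Projective (K.X q)] [∀ q, Projective (L.X q)] {S : ShortComplex C} {E : C}
    {𝓑₁ : SyzRes S.X₁} {𝓑₂ : SyzRes S.X₂} {𝓑₃ : SyzRes S.X₃} {𝓔 : SyzRes E}
    (h₁ : GoodRes T 𝓑₁) (h₃ : GoodRes T 𝓑₃) (hE : GoodRes T 𝓔)
    (h₂ : ∀ k, PreservesFiniteLimits (T.obj (𝓑₂.syz k)) ∧
      PreservesFiniteColimits (T.obj (𝓑₂.syz k))) (H : ResSES S 𝓑₁ 𝓑₂ 𝓑₃)
    {𝓦 : SyzRes ((T.obj S.X₂).obj E)}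
    (H' : ResSES (S.map (T.flip.obj E)) (tensorRes T h₁ hE) 𝓦 (tensorRes T h₃ hE))
    {m m' n r r' : ℤ} (hm : m + 1 = m') (hr : r + 1 = r') (h : m + n = r) (h' : m' + n = r')
    (x : ExtHat K 𝓑₃ m) (y : ExtHat L 𝓔 n) :
    extHatProd T K L h₁ hE h' (connHat K H hm x) y =
      connHat (tensorCx T K L) H' hr (extHatProd T K L h₃ hE h x y) := by
  obtain ⟨k, a, b, rfl, rfl⟩ := SeqColim.exists_of_of _ _ x y
  rw [connHat_of, map_units_smul, AddMonoidHom.smul_apply, extHatProd_of, extHatProd_of,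
    extHatStage_apply, extHatStage_apply]
  have e := conn_extProd T K L (H.syz_exact k)
    ((H.altLeft hE h₂).row (k, false)).2 (p := m + k) (p' := m' + k) (q := n + k)
    (r := r + (2 * k : ℕ)) (r' := r' + (2 * k : ℕ)) (by rw [← hm]; ring) (by rw [← hr]; ring)
    (by rw [← h]; push_cast; ring) (by rw [← h']; push_cast; ring) a b
  refine Eq.trans ?_ ((H.altLeft hE h₂).connHat_ofAlt_two_mul h₁ h₃ hE hE H' (tensorCx T K L)
    (H.altLeft_f_zero hE h₂).symm
    (H.altLeft_g_zero hE h₂).symm hr k _ _).symm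
  rw [smul_smul, altSign_succ hm, ← mul_assoc, ← Int.negOnePow_add, ← two_mul,
    Int.negOnePow_two_mul, one_mul]
  exact congrArg (fun w => altSign m k • ofAlt T (tensorCx T K L) h₁ hE r' (2 * k) (k, false)
    (altIdx_two_mul k) _ rfl w) e.symm

/-- At stage `k`, moving the connecting homomorphism past a class of degree `m + k` gives the sign
`(-1)^(m + k)`, and `connHat` on the left gives `(-1)^k`; the sign `(-1)^m` is what remains. -/
theorem extHatProd_connHat_right [TensorProjective T] (K L : ChainComplex C ℕ)
    [∀ q, Projective (K.X q)] [∀ q, Projective (L.X q)] {S : ShortComplex C} {B : C}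
    {𝓑 : SyzRes B} {𝓔₁ : SyzRes S.X₁} {𝓔₂ : SyzRes S.X₂} {𝓔₃ : SyzRes S.X₃}
    (hB : GoodRes T 𝓑) (h₁ : GoodRes T 𝓔₁) (h₃ : GoodRes T 𝓔₃)
    (h₂ : ∀ k, PreservesFiniteLimits (T.flip.obj (𝓔₂.syz k)) ∧
      PreservesFiniteColimits (T.flip.obj (𝓔₂.syz k))) (H : ResSES S 𝓔₁ 𝓔₂ 𝓔₃)
    {𝓦 : SyzRes ((T.obj B).obj S.X₂)}
    (H' : ResSES (S.map (T.obj B)) (tensorRes T hB h₁) 𝓦 (tensorRes T hB h₃))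
    {m n n' r r' : ℤ} (hn : n + 1 = n') (hr : r + 1 = r') (h : m + n = r) (h' : m + n' = r')
    (x : ExtHat K 𝓑 m) (y : ExtHat L 𝓔₃ n) :
    extHatProd T K L hB h₁ h' x (connHat L H hn y) =
      m.negOnePow • connHat (tensorCx T K L) H' hr (extHatProd T K L hB h₃ h x y) := by
  obtain ⟨k, a, b, rfl, rfl⟩ := SeqColim.exists_of_of _ _ x y
  rw [connHat_of, map_units_smul, extHatProd_of, extHatProd_of,
    extHatStage_apply, extHatStage_apply]
  have e := conn_extProd' T K L (H.syz_exact k)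
    ((H.altRight hB h₂).row (k, false)).2 (p := m + k) (q := n + k) (q' := n' + k)
    (r := r + (2 * k : ℕ)) (r' := r' + (2 * k : ℕ)) (by rw [← hn]; ring) (by rw [← hr]; ring)
    (by rw [← h]; push_cast; ring) (by rw [← h']; push_cast; ring) a b
  refine Eq.trans ?_ (congrArg (m.negOnePow • ·) ((H.altRight hB h₂).connHat_ofAlt_two_mul
    hB hB h₁ h₃ H' (tensorCx T K L) (H.altRight_f_zero hB h₂).symm
    (H.altRight_g_zero hB h₂).symm hr k _ _).symm)
  rw [smul_smul]
  refine Eq.trans ?_ (smul_smul _ _ _).symm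
  refine smul_map_aux (ofAlt T (tensorCx T K L) hB h₁ r' (2 * k) (k, false)
    (altIdx_two_mul k) _ rfl) ?_ e
  rw [mul_right_comm, ← Int.negOnePow_add]
  congr 1
  exact negOnePow_eq ⟨k, by ring⟩

end Alternating

/-! ### Precomposition and connecting homomorphisms -/

section Precomposition

variable {C : Type u} [Category.{v} C] [Abelian C]

/-- Precomposition with a chain map commutes with the connecting homomorphism at every stage. -/
theorem precompHat_connHat {K L : ChainComplex C ℕ} [∀ q, Projective (K.X q)]
    [∀ q, Projective (L.X q)] (φ : K ⟶ L) {S : ShortComplex C} {𝓑₁ : SyzRes S.X₁}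
    {𝓑₂ : SyzRes S.X₂} {𝓑₃ : SyzRes S.X₃} (H : ResSES S 𝓑₁ 𝓑₂ 𝓑₃) {n n' : ℤ}
    (hn : n + 1 = n') (x : ExtHat L 𝓑₃ n) :
    precompHat φ 𝓑₁ n' (connHat L H hn x) = connHat K H hn (precompHat φ 𝓑₃ n x) := by
  obtain ⟨k, a, rfl⟩ := SeqColim.exists_of _ x
  rw [connHat_of, map_units_smul]
  exact congrArg (fun w => (k : ℤ).negOnePow • SeqColim.of (extStep K 𝓑₁ n') k w)
    (precomp_conn φ (H.syz_exact k) (show n + (k : ℤ) + 1 = n' + k by rw [← hn]; ring) a).symm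

end Precomposition

/-! ### Yoneda products and connecting homomorphisms -/

section Yoneda

open CochainComplex.HomComplex

variable {C : Type u} [Category.{v} C] [Abelian C]

/-- The Yoneda product `y ∘ x` is represented by the composite of a cochain representing `x` with
one representing `y`, so the connecting homomorphism only affects the second factor, up to the
term `δ x`, which is bounded. -/
theorem yoneda_vConn {K L M₁ M₂ M₃ : CochainComplex C ℤ} [∀ p, Projective (K.X p)]
    [∀ p, Projective (L.X p)] {φ : M₁ ⟶ M₂} {ψ : M₂ ⟶ M₃} {zero : ∀ p, φ.f p ≫ ψ.f p = 0}
    (hM : ∀ p, (ShortComplex.mk (φ.f p) (ψ.f p) (zero p)).ShortExact) {m n n' r r' : ℤ}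
    (hn : n + 1 = n') (hr : r + 1 = r') (h : n + m = r) (h' : n' + m = r') (y : VExt L M₃ n)
    (x : VExt K L m) :
    yoneda K L M₁ h' (vConn L hM hn y) x = vConn K hM hr (yoneda K L M₃ h y x) := by
  obtain ⟨v, rfl⟩ := VExt.mk_surjective _ _ _ x
  obtain ⟨z, w, l, rfl, hw, hl, hlw⟩ := homOfRel_mem (vConnRel L φ ψ n n') (vConnRel_tot L hM hn)
    (vConnRel_single L hM hn) y
  change vConn L hM hn _ = _ at hw
  rw [hw, yoneda_mk, yoneda_mk]
  refine (homOfRel_eq _ (vConnRel_tot K hM hr) (vConnRel_single K hM hr)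
    ⟨_, _, v.1.comp l (by lia), rfl, rfl, ?_, ?_⟩).symm
  · rw [Cochain.comp_assoc_of_third_is_zero_cochain, hl]
    rfl
  · have e : δ r r' (v.1.comp l (by lia)) -
        (vComp (show m + n' = r' by lia) v w).1.comp (Cochain.ofHom φ) (add_zero r') =
        v.1.comp (δ n n' l - w.1.comp (Cochain.ofHom φ) (add_zero n')) (by lia) +
          n.negOnePow • (δ m (m + 1) v.1).comp l (by lia) := by
      rw [δ_comp v.1 l (by lia) (m + 1) n' r' (by lia) rfl hn, Cochain.comp_sub,
        ← Cochain.comp_assoc_of_third_is_zero_cochain]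
      change _ - (v.1.comp w.1 (show m + n' = r' by lia)).comp _ _ = _
      abel
    rw [e]
    exact add_mem (comp_mem_bdd_right _ _ hlw) (AddSubgroup.zsmul_mem _
      (comp_mem_bdd_left _ ((mem_vCocycles rfl _).1 v.2) _) _)

end Yoneda

/-! ### Contracting homotopies and resolutions -/

section Contraction

variable {D : Type u'} [Category.{v'} D] [Abelian D]

/-- An augmented complex with a contracting homotopy is a resolution. -/
theorem quasiIso_of_contraction {M : ChainComplex D ℕ} {W : D}
    (η : M ⟶ (ChainComplex.single₀ D).obj W) (s : W ⟶ M.X 0) (H : ∀ i, M.X i ⟶ M.X (i + 1))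
    (hs : s ≫ η.f 0 = 𝟙 W) (h₀ : H 0 ≫ M.d 1 0 = 𝟙 _ - η.f 0 ≫ s)
    (h : ∀ i, M.d (i + 1) i ≫ H i + H (i + 1) ≫ M.d (i + 2) (i + 1) = 𝟙 _) : QuasiIso η := by
  let σ : (ChainComplex.single₀ D).obj W ⟶ M := (ChainComplex.fromSingle₀Equiv M W).symm s
  have hσ : σ.f 0 = s := ChainComplex.fromSingle₀Equiv_symm_apply_f_zero s
  have e : 𝟙 M - η ≫ σ = Homotopy.nullHomotopicMap' (fun i j hij =>
      H i ≫ eqToHom (by rw [show i + 1 = j from hij])) := by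
    ext i
    rcases i with _ | i
    · rw [Homotopy.nullHomotopicMap'_f_of_not_rel_left (k₁ := 1) (k₀ := 0) (by simp) (by simp)]
      simp [h₀, hσ]
    · rw [Homotopy.nullHomotopicMap'_f (k₂ := i + 2) (k₁ := i + 1) (k₀ := i) (by simp) (by simp)]
      have : η.f (i + 1) = 0 :=
        (HomologicalComplex.isZero_single_obj_X _ _ _ _ (by simp)).eq_of_tgt _ _
      simp [this]
      exact (h i).symm
  let E : HomotopyEquiv M ((ChainComplex.single₀ D).obj W) :=
    { hom := η
      inv := σ
      homotopyHomInvId := (Homotopy.equivSubZero.symm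
        ((Homotopy.ofEq e).trans (Homotopy.nullHomotopy' _))).symm
      homotopyInvHomId := Homotopy.ofEq (by
        ext
        simpa [hσ] using hs) }
  exact E.quasiIso_hom

/-- A projective resolution of a projective object is contractible as an augmented complex. -/
theorem exists_contraction {V : D} [Projective V] (P : ProjectiveResolution V) :
    ∃ (s : V ⟶ P.complex.X 0) (h : ∀ i, P.complex.X i ⟶ P.complex.X (i + 1)),
      s ≫ P.π.f 0 = 𝟙 V ∧ h 0 ≫ P.complex.d 1 0 = 𝟙 _ - P.π.f 0 ≫ s ∧
      ∀ i, P.complex.d (i + 1) i ≫ h i + h (i + 1) ≫ P.complex.d (i + 2) (i + 1) = 𝟙 _ := by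
  let E := ProjectiveResolution.homotopyEquiv P (ProjectiveResolution.self V)
  have e1 : E.hom = P.π := by
    have := ProjectiveResolution.homotopyEquiv_hom_π P (ProjectiveResolution.self V)
    exact (Category.comp_id _).symm.trans this
  have e2 : E.inv ≫ P.π = 𝟙 _ :=
    ProjectiveResolution.homotopyEquiv_inv_π P (ProjectiveResolution.self V)
  let τ : (ChainComplex.single₀ D).obj V ⟶ P.complex := E.inv
  let Ht : Homotopy (P.π ≫ τ) (𝟙 P.complex) :=
    (Homotopy.ofEq (by rw [e1]; rfl)).trans E.homotopyHomInvId
  refine ⟨τ.f 0, fun i => -Ht.hom i (i + 1), ?_, ?_, fun i => ?_⟩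
  · exact congrArg (fun f => HomologicalComplex.Hom.f f 0) e2
  · have := Ht.comm 0
    rw [Homotopy.dNext_zero_chainComplex, zero_add, Homotopy.prevD_chainComplex] at this
    change P.π.f 0 ≫ τ.f 0 = _ + 𝟙 _ at this
    rw [this, Preadditive.neg_comp]
    abel
  · have := Ht.comm (i + 1)
    rw [Homotopy.dNext_succ_chainComplex, Homotopy.prevD_chainComplex] at this
    change P.π.f (i + 1) ≫ τ.f (i + 1) = _ + 𝟙 _ at this
    rw [P.π_f_succ, zero_comp] at this
    rw [Preadditive.neg_comp, Preadditive.comp_neg, ← neg_add, eq_comm]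
    exact eq_neg_of_add_eq_zero_right this.symm

end Contraction

/-! ### Tensor products of resolutions that become contractible -/

section TensorResolution

set_option linter.unusedSectionVars false

variable {C : Type u} [Category.{v} C] [Abelian C] (T : C ⥤ C ⥤ C) [T.Additive]
  [∀ X, (T.obj X).Additive]

section Differential

variable (K L : ChainComplex C ℕ)

theorem ι_d_succ_zero (i : ℕ) :
    tensorι T K L (i + 1) 0 (i + 1) rfl ≫ (tensorCx T K L).d (i + 1) i =
      tensorHom T (K.d (i + 1) i) (𝟙 _) ≫ tensorι T K L i 0 i rfl := by
  rw [HomologicalComplex.mapBifunctor.d_eq, Preadditive.comp_add,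
    HomologicalComplex.mapBifunctor.ι_D₁, HomologicalComplex.mapBifunctor.ι_D₂,
    HomologicalComplex.mapBifunctor.d₂_eq_zero _ _ _ _ _ _ _ (by simp), add_zero,
    HomologicalComplex.mapBifunctor.d₁_eq K L T (ComplexShape.down ℕ)
      (show (ComplexShape.down ℕ).Rel (i + 1) i by simp) 0 i rfl]
  change (1 : ℤˣ) • _ = _
  rw [one_smul]
  simp [tensorHom]

theorem ι_d_zero_succ (j r : ℕ) (h : 0 + (j + 1) = r + 1) (h' : 0 + j = r) :
    tensorι T K L 0 (j + 1) (r + 1) h ≫ (tensorCx T K L).d (r + 1) r =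
      tensorHom T (𝟙 _) (L.d (j + 1) j) ≫ tensorι T K L 0 j r h' := by
  rw [HomologicalComplex.mapBifunctor.d_eq, Preadditive.comp_add,
    HomologicalComplex.mapBifunctor.ι_D₁, HomologicalComplex.mapBifunctor.ι_D₂,
    HomologicalComplex.mapBifunctor.d₁_eq_zero _ _ _ _ _ _ _ (by simp), zero_add,
    HomologicalComplex.mapBifunctor.d₂_eq K L T (ComplexShape.down ℕ) 0
      (show (ComplexShape.down ℕ).Rel (j + 1) j by simp) r h']
  change ((0 : ℕ) : ℤ).negOnePow • _ = _
  simp [tensorHom]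

theorem ι_d_succ_succ (i j r : ℕ) (h : i + 1 + (j + 1) = r + 1) (h' : i + (j + 1) = r)
    (h'' : i + 1 + j = r) :
    tensorι T K L (i + 1) (j + 1) (r + 1) h ≫ (tensorCx T K L).d (r + 1) r =
      tensorHom T (K.d (i + 1) i) (𝟙 _) ≫ tensorι T K L i (j + 1) r h' +
        ((i + 1 : ℕ) : ℤ).negOnePow •
          tensorHom T (𝟙 _) (L.d (j + 1) j) ≫ tensorι T K L (i + 1) j r h'' := by
  rw [HomologicalComplex.mapBifunctor.d_eq, Preadditive.comp_add,
    HomologicalComplex.mapBifunctor.ι_D₁, HomologicalComplex.mapBifunctor.ι_D₂,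
    HomologicalComplex.mapBifunctor.d₁_eq K L T (ComplexShape.down ℕ)
      (show (ComplexShape.down ℕ).Rel (i + 1) i by simp) (j + 1) r h',
    HomologicalComplex.mapBifunctor.d₂_eq K L T (ComplexShape.down ℕ) (i + 1)
      (show (ComplexShape.down ℕ).Rel (j + 1) j by simp) r h'']
  change (1 : ℤˣ) • _ + ((i + 1 : ℕ) : ℤ).negOnePow • _ = _
  rw [one_smul]
  simp [tensorHom]

end Differential

variable {D : Type u'} [Category.{v'} D] [Abelian D] (TD : D ⥤ D ⥤ D) [TD.Additive]
  [∀ X, (TD.obj X).Additive] (U : C ⥤ D)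

section Cofan

variable [PreservesFiniteColimits U] (K L : ChainComplex C ℕ) (r : ℕ)

theorem map_tensorCx_isColimit : Nonempty (IsColimit (Cofan.mk (U.obj ((tensorCx T K L).X r))
    (fun s : ((fun s : ℕ × ℕ => s.1 + s.2) ⁻¹' {r} : Set (ℕ × ℕ)) =>
      U.map (tensorι T K L s.1.1 s.1.2 r s.2)))) := by
  have : Finite ((fun s : ℕ × ℕ => s.1 + s.2) ⁻¹' {r} : Set (ℕ × ℕ)) := by
    refine (Set.finite_Iic (r, r)).subset ?_
    rintro ⟨i, j⟩ hij
    have : i + j = r := hij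
    simp only [Set.mem_Iic, Prod.mk_le_mk]
    lia
  have := hasTensorCx T K L
  exact ⟨isColimitMapCoconeCofanMkEquiv U _ _ (isColimitOfPreserves U
    (GradedObject.isColimitCofanMapObj ((((T.mapBifunctorHomologicalComplex (ComplexShape.down ℕ)
      (ComplexShape.down ℕ)).obj K).obj L).toGradedObject)
      (ComplexShape.π (ComplexShape.down ℕ) (ComplexShape.down ℕ) (ComplexShape.down ℕ)) r))⟩

theorem exists_map_desc {N : D}
    (g : ∀ i j, i + j = r → (U.obj ((T.obj (K.X i)).obj (L.X j)) ⟶ N)) :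
    ∃ f : U.obj ((tensorCx T K L).X r) ⟶ N,
      ∀ i j h, U.map (tensorι T K L i j r h) ≫ f = g i j h := by
  obtain ⟨hc⟩ := map_tensorCx_isColimit T U K L r
  exact ⟨Cofan.IsColimit.desc hc (fun s => g s.1.1 s.1.2 s.2), fun i j h =>
    Cofan.IsColimit.fac hc (fun s => g s.1.1 s.1.2 s.2) ⟨(i, j), h⟩⟩

variable {K L r} in
theorem map_hom_ext {N : D} {f f' : U.obj ((tensorCx T K L).X r) ⟶ N}
    (h : ∀ i j h, U.map (tensorι T K L i j r h) ≫ f = U.map (tensorι T K L i j r h) ≫ f') :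
    f = f' := by
  obtain ⟨hc⟩ := map_tensorCx_isColimit T U K L r
  exact Cofan.IsColimit.hom_ext hc _ _ (fun s => h s.1.1 s.1.2 s.2)

end Cofan

section Transport

variable {T TD U}
  (α : T ⋙ (Functor.whiskeringRight C C D).obj U ≅ U ⋙ TD ⋙ (Functor.whiskeringLeft C D D).obj U)

/-- The tensor product of morphisms `U X ⟶ U X'` and `U Y ⟶ U Y'`, which need not come from `C`, as
a morphism `U (X ⊗ Y) ⟶ U (X' ⊗ Y')`. -/
def transport {X X' Y Y' : C} (f : U.obj X ⟶ U.obj X') (g : U.obj Y ⟶ U.obj Y') :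
    U.obj ((T.obj X).obj Y) ⟶ U.obj ((T.obj X').obj Y') :=
  (α.hom.app X).app Y ≫ tensorHom TD f g ≫ (α.inv.app X').app Y'

theorem transport_comp {X X' X'' Y Y' Y'' : C} (f : U.obj X ⟶ U.obj X') (f' : U.obj X' ⟶ U.obj X'')
    (g : U.obj Y ⟶ U.obj Y') (g' : U.obj Y' ⟶ U.obj Y'') :
    transport α f g ≫ transport α f' g' = transport α (f ≫ f') (g ≫ g') := by
  have e : (α.inv.app X').app Y' ≫ (α.hom.app X').app Y' = 𝟙 _ := by
    rw [← NatTrans.comp_app, ← NatTrans.comp_app, α.inv_hom_id]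
    rfl
  simp only [transport, Category.assoc, reassoc_of% e, tensorHom_comp]

theorem transport_map {X X' Y Y' : C} (f : X ⟶ X') (g : Y ⟶ Y') :
    transport α (U.map f) (U.map g) = U.map (tensorHom T f g) := by
  have e : (α.hom.app X').app Y' ≫ (α.inv.app X').app Y' = 𝟙 _ := by
    rw [← NatTrans.comp_app, ← NatTrans.comp_app, α.hom_inv_id]
    rfl
  have e1 : U.map ((T.obj X').map g) ≫ (α.hom.app X').app Y' =
    (α.hom.app X').app Y ≫ (TD.obj (U.obj X')).map (U.map g) := (α.hom.app X').naturality g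
  have e2 : U.map ((T.map f).app Y) ≫ (α.hom.app X').app Y =
    (α.hom.app X).app Y ≫ (TD.map (U.map f)).app (U.obj Y) :=
      congrArg (fun t => NatTrans.app t Y) (α.hom.naturality f)
  have e3 : (α.hom.app X).app Y ≫ tensorHom TD (U.map f) (U.map g) =
      U.map (tensorHom T f g) ≫ (α.hom.app X').app Y' := by
    rw [tensorHom, tensorHom, U.map_comp, Category.assoc, e1, ← Category.assoc, ← e2,
      Category.assoc]
  rw [transport, ← Category.assoc, e3, Category.assoc, e]
  exact Category.comp_id _

theorem transport_id (X Y : C) : transport α (𝟙 (U.obj X)) (𝟙 (U.obj Y)) = 𝟙 _ := by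
  rw [← U.map_id, ← U.map_id, transport_map]
  simp [tensorHom]

theorem transport_zero_left {X X' Y Y' : C} (g : U.obj Y ⟶ U.obj Y') :
    transport α (0 : U.obj X ⟶ U.obj X') g = 0 := by
  simp [transport, tensorHom_zero_left]

theorem transport_add_left {X X' Y Y' : C} (f f' : U.obj X ⟶ U.obj X') (g : U.obj Y ⟶ U.obj Y') :
    transport α (f + f') g = transport α f g + transport α f' g := by
  simp [transport, tensorHom_add_left]

theorem transport_add_right {X X' Y Y' : C} (f : U.obj X ⟶ U.obj X') (g g' : U.obj Y ⟶ U.obj Y') :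
    transport α f (g + g') = transport α f g + transport α f g' := by
  simp [transport, tensorHom_add_right]

end Transport

/-- The identification of `U` applied to a complex concentrated in degree zero with such a complex
is the identity in degree zero. -/
theorem map_comp_single [U.PreservesZeroMorphisms] {K : ChainComplex C ℕ} {A : C}
    (φ : K ⟶ (ChainComplex.single₀ C).obj A) :
    ((U.mapHomologicalComplex _).map φ ≫ (HomologicalComplex.singleMapHomologicalComplex U
      (ComplexShape.down ℕ) 0).hom.app _).f 0 = U.map (φ.f 0) := by
  simp
  exact Category.comp_id _

theorem exists_map_contraction [U.Additive] [PreservesFiniteLimits U] [PreservesFiniteColimits U]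
    [U.PreservesProjectiveObjects] {R : C} [Projective (U.obj R)] (P : ProjectiveResolution R) :
    ∃ (s : U.obj R ⟶ U.obj (P.complex.X 0))
      (h : ∀ i, U.obj (P.complex.X i) ⟶ U.obj (P.complex.X (i + 1))),
      s ≫ U.map ((augCocycle P).1 0) = 𝟙 _ ∧
      h 0 ≫ U.map (P.complex.d 1 0) + U.map ((augCocycle P).1 0) ≫ s = 𝟙 _ ∧
      ∀ i, U.map (P.complex.d (i + 1) i) ≫ h i + h (i + 1) ≫ U.map (P.complex.d (i + 2) (i + 1)) =
        𝟙 _ := by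
  obtain ⟨s, h, h1, h2, h3⟩ := exists_contraction (U.mapProjectiveResolution P)
  have e : (U.mapProjectiveResolution P).π.f 0 = U.map ((augCocycle P).1 0) := by
    rw [Functor.mapProjectiveResolution_π]
    exact map_comp_single U P.π
  rw [e] at h1 h2
  exact ⟨s, h, h1, eq_sub_iff_add_eq.1 h2, h3⟩

variable {T TD U} in
/-- The tensor product of two augmented complexes with contracting homotopies `h`, `h'` has the
contracting homotopy `h ⊗ 1 + (ε ≫ s) ⊗ h'`, where `ε` is the augmentation of the first complex and
`s` is its section. The homotopies live in the category `D` only. -/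
theorem exists_tensorCx_contraction [U.Additive] [PreservesFiniteColimits U]
    (α : T ⋙ (Functor.whiskeringRight C C D).obj U ≅
      U ⋙ TD ⋙ (Functor.whiskeringLeft C D D).obj U)
    {K L : ChainComplex C ℕ} {A B : C} (ε : K.X 0 ⟶ A) (ε' : L.X 0 ⟶ B)
    (hε : K.d 1 0 ≫ ε = 0) {s : U.obj A ⟶ U.obj (K.X 0)} {s' : U.obj B ⟶ U.obj (L.X 0)}
    {h : ∀ i, U.obj (K.X i) ⟶ U.obj (K.X (i + 1))} {h' : ∀ i, U.obj (L.X i) ⟶ U.obj (L.X (i + 1))}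
    (h₀ : h 0 ≫ U.map (K.d 1 0) + U.map ε ≫ s = 𝟙 _)
    (h₀' : h' 0 ≫ U.map (L.d 1 0) + U.map ε' ≫ s' = 𝟙 _)
    (hh : ∀ i, U.map (K.d (i + 1) i) ≫ h i + h (i + 1) ≫ U.map (K.d (i + 2) (i + 1)) = 𝟙 _)
    (hh' : ∀ i, U.map (L.d (i + 1) i) ≫ h' i + h' (i + 1) ≫ U.map (L.d (i + 2) (i + 1)) = 𝟙 _)
    (η : (tensorCx T K L).X 0 ⟶ (T.obj A).obj B)
    (hη : tensorι T K L 0 0 0 rfl ≫ η = tensorHom T ε ε') :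
    ∃ H : ∀ r, U.obj ((tensorCx T K L).X r) ⟶ U.obj ((tensorCx T K L).X (r + 1)),
      H 0 ≫ U.map ((tensorCx T K L).d 1 0) +
        U.map η ≫ transport α s s' ≫ U.map (tensorι T K L 0 0 0 rfl) = 𝟙 _ ∧
      ∀ r, U.map ((tensorCx T K L).d (r + 1) r) ≫ H r +
        H (r + 1) ≫ U.map ((tensorCx T K L).d (r + 2) (r + 1)) = 𝟙 _ := by
  -- the endomorphism `ε ≫ s`, extended by zero to positive degrees
  let ρ : ∀ i, U.obj (K.X i) ⟶ U.obj (K.X i) := fun i => match i with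
    | 0 => U.map ε ≫ s
    | _ + 1 => 0
  have dρ : ∀ i, U.map (K.d (i + 1) i) ≫ ρ i = 0 := fun i => match i with
    | 0 => by
      change _ ≫ _ ≫ s = 0
      rw [← Category.assoc, ← U.map_comp, hε, U.map_zero, zero_comp]
    | _ + 1 => comp_zero
  have ρ₀ : ρ 0 = U.map ε ≫ s := rfl
  have ρ₁ : ∀ i, ρ (i + 1) = 0 := fun i => rfl
  have hH : ∀ r, ∃ H : U.obj ((tensorCx T K L).X r) ⟶ U.obj ((tensorCx T K L).X (r + 1)),
      ∀ i j (hr : i + j = r), U.map (tensorι T K L i j r hr) ≫ H =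
        transport α (h i) (𝟙 _) ≫ U.map (tensorι T K L (i + 1) j (r + 1) (by lia)) +
        transport α (ρ i) (h' j) ≫ U.map (tensorι T K L i (j + 1) (r + 1) (by lia)) :=
    fun r => exists_map_desc T U _ _ _ _
  choose H hH using hH
  clear_value ρ
  have tL : ∀ {X X' : C} (f : X ⟶ X') (Y : C),
      U.map (tensorHom T f (𝟙 Y)) = transport α (U.map f) (𝟙 _) := fun f Y => by
    rw [← transport_map α, U.map_id]
  have tR : ∀ {Y Y' : C} (X : C) (g : Y ⟶ Y'),
      U.map (tensorHom T (𝟙 X) g) = transport α (𝟙 _) (U.map g) := fun X g => by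
    rw [← transport_map α, U.map_id]
  have t1 : ∀ (X Y : C), transport α (𝟙 (U.obj X)) (𝟙 (U.obj Y)) = 𝟙 _ := transport_id α
  refine ⟨H, ?_, fun r => ?_⟩
  · refine map_hom_ext T U fun i j hij => ?_
    obtain ⟨rfl, rfl⟩ : i = 0 ∧ j = 0 := by lia
    rw [Preadditive.comp_add, ← Category.assoc, hH, Preadditive.add_comp, Category.assoc,
      Category.assoc, ← U.map_comp, ← U.map_comp, ι_d_succ_zero, ι_d_zero_succ T K L 0 0 rfl rfl,
      U.map_comp, U.map_comp, tL, tR, ← Category.assoc, ← Category.assoc, transport_comp,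
      transport_comp, ← Category.assoc (U.map _) (U.map η), ← U.map_comp, hη, ← transport_map α,
      ← Category.assoc, transport_comp, ← Preadditive.add_comp, ← Preadditive.add_comp]
    simp only [Category.comp_id]
    rw [ρ₀, add_assoc, ← transport_add_right, h₀', ← transport_add_left, h₀, t1, Category.id_comp]
  · have tc : ∀ {X X' X'' Y Y' Y'' : C} (f : U.obj X ⟶ U.obj X') (f' : U.obj X' ⟶ U.obj X'')
        (g : U.obj Y ⟶ U.obj Y') (g' : U.obj Y' ⟶ U.obj Y'') {N : D} (k : _ ⟶ N),
        transport α f g ≫ transport α f' g' ≫ k = transport α (f ≫ f') (g ≫ g') ≫ k :=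
      fun f f' g g' N k => by rw [← transport_comp, Category.assoc]
    have e₁ : ∀ i, U.map (tensorι T K L (i + 1) 0 (i + 1) rfl) ≫
        U.map ((tensorCx T K L).d (i + 1) i) =
        transport α (U.map (K.d (i + 1) i)) (𝟙 _) ≫ U.map (tensorι T K L i 0 i rfl) := fun i => by
      rw [← U.map_comp, ι_d_succ_zero, U.map_comp, tL]
    have e₂ : ∀ j r (h : 0 + (j + 1) = r + 1) (h' : 0 + j = r),
        U.map (tensorι T K L 0 (j + 1) (r + 1) h) ≫ U.map ((tensorCx T K L).d (r + 1) r) =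
        transport α (𝟙 _) (U.map (L.d (j + 1) j)) ≫ U.map (tensorι T K L 0 j r h') :=
      fun j r h h' => by rw [← U.map_comp, ι_d_zero_succ T K L j r h h', U.map_comp, tR]
    have e₃ : ∀ i j r (h : i + 1 + (j + 1) = r + 1) (h' : i + (j + 1) = r) (h'' : i + 1 + j = r),
        U.map (tensorι T K L (i + 1) (j + 1) (r + 1) h) ≫ U.map ((tensorCx T K L).d (r + 1) r) =
        transport α (U.map (K.d (i + 1) i)) (𝟙 _) ≫ U.map (tensorι T K L i (j + 1) r h') +
        (((i + 1 : ℕ) : ℤ).negOnePow : ℤ) • (transport α (𝟙 _) (U.map (L.d (j + 1) j)) ≫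
          U.map (tensorι T K L (i + 1) j r h'')) := fun i j r h h' h'' => by
      rw [← U.map_comp, ι_d_succ_succ T K L i j r h h' h'', U.map_add, Units.smul_def,
        U.map_zsmul, U.map_comp, U.map_comp, tL, tR]
    refine map_hom_ext T U fun i j hij => ?_
    rw [Preadditive.comp_add, ← Category.assoc (U.map (tensorι T K L i j (r + 1) hij)) (U.map _),
      ← Category.assoc (U.map (tensorι T K L i j (r + 1) hij)) (H (r + 1)), hH,
      Preadditive.add_comp, Category.assoc (transport α (h i) (𝟙 _)),
      Category.assoc (transport α (ρ i) (h' j)), Category.comp_id]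
    rcases i with _ | i
    · obtain ⟨j, rfl⟩ : ∃ j', j = j' + 1 := ⟨j - 1, by lia⟩
      rw [e₂ j r (by lia) (by lia), Category.assoc, hH, e₃ 0 j (r + 1) (by lia) (by lia) (by lia),
        e₂ (j + 1) (r + 1) (by lia) (by lia)]
      simp only [Preadditive.comp_add, Preadditive.comp_zsmul, tc, Category.id_comp,
        Category.comp_id]
      have key : transport α (h 0 ≫ U.map (K.d (0 + 1) 0)) (𝟙 (U.obj (L.X (j + 1)))) +
          (transport α (ρ 0) (U.map (L.d (j + 1) j) ≫ h' j) +
            transport α (ρ 0) (h' (j + 1) ≫ U.map (L.d (j + 1 + 1) (j + 1)))) = 𝟙 _ := by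
        rw [← transport_add_right, hh', ρ₀, ← transport_add_left, h₀, t1]
      have key' := congrArg (· ≫ U.map (tensorι T K L 0 (j + 1) (r + 1) hij)) key
      simp only [Preadditive.add_comp, Category.id_comp] at key'
      have sg : (((0 + 1 : ℕ) : ℤ).negOnePow : ℤ) = -1 := by simp
      rw [sg, neg_smul, one_smul]
      refine Eq.trans ?_ key'
      abel
    · rcases j with _ | j
      · obtain rfl : r = i := by lia
        rw [e₁, Category.assoc, hH, e₁, ρ₁, transport_zero_left, zero_comp]
        simp only [Preadditive.comp_add, tc, Category.comp_id, dρ, transport_zero_left, zero_comp,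
          add_zero]
        rw [← Preadditive.add_comp, ← transport_add_left, hh, t1, Category.id_comp]
      · rw [e₃ i j r (by lia) (by lia) (by lia), e₃ (i + 1) j (r + 1) (by lia) (by lia) (by lia),
          ρ₁, transport_zero_left, zero_comp, add_zero, Preadditive.add_comp, Category.assoc, hH,
          Preadditive.zsmul_comp, Category.assoc, hH, ρ₁, transport_zero_left, zero_comp, add_zero]
        simp only [Preadditive.comp_add, Preadditive.comp_zsmul, tc, Category.id_comp,
          Category.comp_id, dρ, transport_zero_left, zero_comp, add_zero]
        have sg : (((i + 1 + 1 : ℕ) : ℤ).negOnePow : ℤ) = -(((i + 1 : ℕ) : ℤ).negOnePow : ℤ) := by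
          rw [Nat.cast_succ (i + 1), Int.negOnePow_succ, Units.val_neg]
        have key := congrArg (· ≫ U.map (tensorι T K L (i + 1) (j + 1) (r + 1) hij))
          (((transport_add_left α _ _ (𝟙 (U.obj (L.X (j + 1))))).symm.trans
            (congrArg (fun t => transport α t _) (hh i))).trans (t1 _ _))
        simp only [Preadditive.add_comp, Category.id_comp] at key
        rw [sg, neg_smul]
        refine Eq.trans ?_ key
        abel

/-- If an exact faithful functor `U` that preserves projective objects and commutes with the tensor
products makes `R` projective, then the tensor product of two projective resolutions of `R` is a
resolution: its image under `U` is contractible. -/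
theorem isTensorRes_of_projective [U.Additive] [PreservesFiniteLimits U]
    [PreservesFiniteColimits U] [U.Faithful] [U.PreservesProjectiveObjects]
    (α : T ⋙ (Functor.whiskeringRight C C D).obj U ≅
      U ⋙ TD ⋙ (Functor.whiskeringLeft C D D).obj U)
    {R : C} [Projective (U.obj R)] (P Q : ProjectiveResolution R) : IsTensorRes T P Q := by
  obtain ⟨s, h, hs, h₀, hh⟩ := exists_map_contraction U P
  obtain ⟨s', h', hs', h₀', hh'⟩ := exists_map_contraction U Q
  have hη : tensorι T P.complex Q.complex 0 0 0 rfl ≫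
      tensorFam T (augCocycle P).1 (augCocycle Q).1 0 =
      tensorHom T ((augCocycle P).1 0) ((augCocycle Q).1 0) := ι_tensorFam T _ _ 0 0 0 rfl
  have hε : P.complex.d 1 0 ≫ (augCocycle P).1 0 = 0 := congrFun (augCocycle P).2.2 1
  obtain ⟨H, H₀, HH⟩ := exists_tensorCx_contraction α _ _ hε h₀ h₀' hh hh' _ hη
  let φ := (U.mapHomologicalComplex _).map (augTensor T P Q) ≫
    (HomologicalComplex.singleMapHomologicalComplex U (ComplexShape.down ℕ) 0).hom.app _
  have hφ : φ.f 0 = U.map (tensorFam T (augCocycle P).1 (augCocycle Q).1 0) := by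
    refine (map_comp_single U _).trans (congrArg U.map ?_)
    exact ChainComplex.toSingle₀Equiv_symm_apply_f_zero
      (C := tensorCx T P.complex Q.complex) _ _
  have : QuasiIso φ := by
    refine quasiIso_of_contraction φ (transport α s s' ≫
      U.map (tensorι T P.complex Q.complex 0 0 0 rfl)) H ?_ ?_ HH
    · have e : transport α s s' ≫ U.map (tensorι T P.complex Q.complex 0 0 0 rfl) ≫
          U.map (tensorFam T (augCocycle P).1 (augCocycle Q).1 0) = 𝟙 _ := by
        rw [← U.map_comp, hη, ← transport_map α, transport_comp, hs, hs', transport_id]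
      rw [hφ]
      exact (Category.assoc _ _ _).trans e
    · rw [hφ]
      exact eq_sub_of_add_eq H₀
  -- an exact faithful functor reflects quasi-isomorphisms
  have : QuasiIso ((U.mapHomologicalComplex (ComplexShape.down ℕ)).map (augTensor T P Q)) :=
    quasiIso_of_comp_right _
      ((HomologicalComplex.singleMapHomologicalComplex U (ComplexShape.down ℕ) 0).hom.app _)
  exact (HomologicalComplex.quasiIso_map_iff_of_preservesHomology _ U).1 this

end TensorResolution

end CompletedExt

theorem lemma6p6 {C : Type u} [Category.{v} C] [Abelian C] (T : C ⥤ C ⥤ C) [T.Additive]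
    [∀ X, (T.obj X).Additive] [CompletedExt.TensorProjective T]
    {𝒜 : Type u''} [Category.{v''} 𝒜] [Abelian 𝒜] :
    -- external products and connecting homomorphisms in the first variable
    (∀ (A A' E : C) (PA : ProjectiveResolution A) (PA' : ProjectiveResolution A'),
      CompletedExt.IsTensorRes T PA PA' →
      ∀ (S : ShortComplex C), S.ShortExact →
      ∀ (𝓑₁ : CompletedExt.SyzRes S.X₁) (𝓑₂ : CompletedExt.SyzRes S.X₂)
        (𝓑₃ : CompletedExt.SyzRes S.X₃) (𝓔 : CompletedExt.SyzRes E)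
        (h₁ : CompletedExt.GoodRes T 𝓑₁) (h₃ : CompletedExt.GoodRes T 𝓑₃)
        (hE : CompletedExt.GoodRes T 𝓔),
      (∀ k, PreservesFiniteLimits (T.obj (𝓑₂.syz k)) ∧
        PreservesFiniteColimits (T.obj (𝓑₂.syz k))) →
      ∀ (H : CompletedExt.ResSES S 𝓑₁ 𝓑₂ 𝓑₃)
        (𝓦 : CompletedExt.SyzRes ((T.obj S.X₂).obj E))
        (H' : CompletedExt.ResSES (S.map (T.flip.obj E)) (CompletedExt.tensorRes T h₁ hE) 𝓦
          (CompletedExt.tensorRes T h₃ hE))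
        (m m' n r r' : ℤ) (hm : m + 1 = m') (hr : r + 1 = r') (h : m + n = r) (h' : m' + n = r')
        (x : CompletedExt.ExtHat PA.complex 𝓑₃ m) (y : CompletedExt.ExtHat PA'.complex 𝓔 n),
      CompletedExt.extHatProd T PA.complex PA'.complex h₁ hE h'
          (CompletedExt.connHat PA.complex H hm x) y =
        CompletedExt.connHat (CompletedExt.tensorCx T PA.complex PA'.complex) H' hr
          (CompletedExt.extHatProd T PA.complex PA'.complex h₃ hE h x y)) ∧
    -- external products and connecting homomorphisms in the second variable
    (∀ (A A' B : C) (PA : ProjectiveResolution A) (PA' : ProjectiveResolution A'),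
      CompletedExt.IsTensorRes T PA PA' →
      ∀ (S : ShortComplex C), S.ShortExact →
      ∀ (𝓑 : CompletedExt.SyzRes B) (𝓔₁ : CompletedExt.SyzRes S.X₁)
        (𝓔₂ : CompletedExt.SyzRes S.X₂) (𝓔₃ : CompletedExt.SyzRes S.X₃)
        (hB : CompletedExt.GoodRes T 𝓑) (h₁ : CompletedExt.GoodRes T 𝓔₁)
        (h₃ : CompletedExt.GoodRes T 𝓔₃),
      (∀ k, PreservesFiniteLimits (T.flip.obj (𝓔₂.syz k)) ∧
        PreservesFiniteColimits (T.flip.obj (𝓔₂.syz k))) →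
      ∀ (H : CompletedExt.ResSES S 𝓔₁ 𝓔₂ 𝓔₃)
        (𝓦 : CompletedExt.SyzRes ((T.obj B).obj S.X₂))
        (H' : CompletedExt.ResSES (S.map (T.obj B)) (CompletedExt.tensorRes T hB h₁) 𝓦
          (CompletedExt.tensorRes T hB h₃))
        (m n n' r r' : ℤ) (hn : n + 1 = n') (hr : r + 1 = r') (h : m + n = r) (h' : m + n' = r')
        (x : CompletedExt.ExtHat PA.complex 𝓑 m) (y : CompletedExt.ExtHat PA'.complex 𝓔₃ n),
      CompletedExt.extHatProd T PA.complex PA'.complex hB h₁ h' x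
          (CompletedExt.connHat PA'.complex H hn y) =
        m.negOnePow • CompletedExt.connHat (CompletedExt.tensorCx T PA.complex PA'.complex) H' hr
          (CompletedExt.extHatProd T PA.complex PA'.complex hB h₃ h x y)) ∧
    -- cup products
    (∀ (D : Type u') [Category.{v'} D] [Abelian D] (TD : D ⥤ D ⥤ D) [TD.Additive]
        [∀ X, (TD.obj X).Additive] (U : C ⥤ D) [U.Additive] [PreservesFiniteLimits U]
        [PreservesFiniteColimits U] [U.Faithful] [U.PreservesProjectiveObjects]
        (_ : T ⋙ (Functor.whiskeringRight C C D).obj U ≅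
          U ⋙ TD ⋙ (Functor.whiskeringLeft C D D).obj U)
        (R : C) [Projective (U.obj R)] (e : (T.obj R).obj R ≅ R)
        (R₁ R₂ R₃ : ProjectiveResolution R),
      ∃ hR : CompletedExt.IsTensorRes T R₁ R₂,
      ∀ (Δ : ProjectiveResolution.Hom R₃ (CompletedExt.tensorProjRes T R₁ R₂ hR) e.inv),
        (∀ (N : C) (S : ShortComplex C), S.ShortExact →
          ∀ (𝓜₁ : CompletedExt.SyzRes S.X₁) (𝓜₂ : CompletedExt.SyzRes S.X₂)
            (𝓜₃ : CompletedExt.SyzRes S.X₃) (𝓝 : CompletedExt.SyzRes N)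
            (h₁ : CompletedExt.GoodRes T 𝓜₁) (h₃ : CompletedExt.GoodRes T 𝓜₃)
            (hN : CompletedExt.GoodRes T 𝓝),
          (∀ k, PreservesFiniteLimits (T.obj (𝓜₂.syz k)) ∧
            PreservesFiniteColimits (T.obj (𝓜₂.syz k))) →
          ∀ (H : CompletedExt.ResSES S 𝓜₁ 𝓜₂ 𝓜₃)
            (𝓦 : CompletedExt.SyzRes ((T.obj S.X₂).obj N))
            (H' : CompletedExt.ResSES (S.map (T.flip.obj N)) (CompletedExt.tensorRes T h₁ hN) 𝓦
              (CompletedExt.tensorRes T h₃ hN))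
            (m m' n r r' : ℤ) (hm : m + 1 = m') (hr : r + 1 = r') (h : m + n = r)
            (h' : m' + n = r') (x : CompletedExt.ExtHat R₁.complex 𝓜₃ m)
            (y : CompletedExt.ExtHat R₂.complex 𝓝 n),
          CompletedExt.cupHat T e hR Δ h₁ hN h' (CompletedExt.connHat R₁.complex H hm x) y =
            CompletedExt.connHat R₃.complex H' hr (CompletedExt.cupHat T e hR Δ h₃ hN h x y)) ∧
        (∀ (M : C) (S : ShortComplex C), S.ShortExact →
          ∀ (𝓜 : CompletedExt.SyzRes M) (𝓝₁ : CompletedExt.SyzRes S.X₁)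
            (𝓝₂ : CompletedExt.SyzRes S.X₂) (𝓝₃ : CompletedExt.SyzRes S.X₃)
            (hM : CompletedExt.GoodRes T 𝓜) (h₁ : CompletedExt.GoodRes T 𝓝₁)
            (h₃ : CompletedExt.GoodRes T 𝓝₃),
          (∀ k, PreservesFiniteLimits (T.flip.obj (𝓝₂.syz k)) ∧
            PreservesFiniteColimits (T.flip.obj (𝓝₂.syz k))) →
          ∀ (H : CompletedExt.ResSES S 𝓝₁ 𝓝₂ 𝓝₃)
            (𝓦 : CompletedExt.SyzRes ((T.obj M).obj S.X₂))
            (H' : CompletedExt.ResSES (S.map (T.obj M)) (CompletedExt.tensorRes T hM h₁) 𝓦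
              (CompletedExt.tensorRes T hM h₃))
            (m n n' r r' : ℤ) (hn : n + 1 = n') (hr : r + 1 = r') (h : m + n = r)
            (h' : m + n' = r') (x : CompletedExt.ExtHat R₁.complex 𝓜 m)
            (y : CompletedExt.ExtHat R₂.complex 𝓝₃ n),
          CompletedExt.cupHat T e hR Δ hM h₁ h' x (CompletedExt.connHat R₂.complex H hn y) =
            m.negOnePow • CompletedExt.connHat R₃.complex H' hr
              (CompletedExt.cupHat T e hR Δ hM h₃ h x y))) ∧
    -- Yoneda products
    (∀ (F G : 𝒜) (S : ShortComplex 𝒜), S.ShortExact →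
      ∀ (PF : ProjectiveResolution F) (PG : ProjectiveResolution G)
        (J₁ : ProjectiveResolution S.X₁) (J₂ : ProjectiveResolution S.X₂)
        (J₃ : ProjectiveResolution S.X₃) (φ : ProjectiveResolution.Hom J₁ J₂ S.f)
        (ψ : ProjectiveResolution.Hom J₂ J₃ S.g) (zero : ∀ p, φ.hom'.f p ≫ ψ.hom'.f p = 0)
        (hJ : ∀ p, (ShortComplex.mk (φ.hom'.f p) (ψ.hom'.f p) (zero p)).ShortExact)
        (m n n' r r' : ℤ) (hn : n + 1 = n') (hr : r + 1 = r') (h : n + m = r) (h' : n' + m = r')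
        (y : CompletedExt.VExt PG.cochainComplex J₃.cochainComplex n)
        (x : CompletedExt.VExt PF.cochainComplex PG.cochainComplex m),
      CompletedExt.yoneda PF.cochainComplex PG.cochainComplex J₁.cochainComplex h'
          (CompletedExt.vConn PG.cochainComplex hJ hn y) x =
        CompletedExt.vConn PF.cochainComplex hJ hr
          (CompletedExt.yoneda PF.cochainComplex PG.cochainComplex J₃.cochainComplex h y x)) := by
  refine ⟨?_, ?_, ?_, ?_⟩
  · intro A A' E PA PA' _ S _ 𝓑₁ 𝓑₂ 𝓑₃ 𝓔 h₁ h₃ hE h₂ H 𝓦 H' m m' n r r' hm hr h h' x y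
    exact CompletedExt.extHatProd_connHat_left PA.complex PA'.complex h₁ h₃ hE h₂ H H'
      hm hr h h' x y
  · intro A A' B PA PA' _ S _ 𝓑 𝓔₁ 𝓔₂ 𝓔₃ hB h₁ h₃ h₂ H 𝓦 H' m n n' r r' hn hr h h' x y
    exact CompletedExt.extHatProd_connHat_right PA.complex PA'.complex hB h₁ h₃ h₂ H H'
      hn hr h h' x y
  · intro D _ _ TD _ _ U _ _ _ _ _ α R _ e R₁ R₂ R₃
    refine ⟨CompletedExt.isTensorRes_of_projective T TD U α R₁ R₂, fun Δ => ⟨?_, ?_⟩⟩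
    · intro N S _ 𝓜₁ 𝓜₂ 𝓜₃ 𝓝 h₁ h₃ hN h₂ H 𝓦 H' m m' n r r' hm hr h h' x y
      exact (congrArg (CompletedExt.precompHat Δ.hom _ r')
        (CompletedExt.extHatProd_connHat_left R₁.complex R₂.complex h₁ h₃ hN h₂ H H'
          hm hr h h' x y)).trans (CompletedExt.precompHat_connHat Δ.hom H' hr _)
    · intro M S _ 𝓜 𝓝₁ 𝓝₂ 𝓝₃ hM h₁ h₃ h₂ H 𝓦 H' m n n' r r' hn hr h h' x y
      refine (congrArg (CompletedExt.precompHat Δ.hom _ r')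
        (CompletedExt.extHatProd_connHat_right R₁.complex R₂.complex hM h₁ h₃ h₂ H H'
          hn hr h h' x y)).trans ?_
      refine Eq.trans (map_zsmul (CompletedExt.precompHat Δ.hom _ r') _ _) ?_
      exact congrArg (m.negOnePow • ·) (CompletedExt.precompHat_connHat Δ.hom H' hr _)
  · intro F G S _ PF PG J₁ J₂ J₃ φ ψ zero hJ m n n' r r' hn hr h h' y x
    exact CompletedExt.yoneda_vConn hJ hn hr h h' y x
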